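/- Let $s,d,m\in\mathbb N$ with $s\ge 1$, let $\alpha_0>1$, and put $\alpha_i=\frac{s}{s-i}\alpha_0$ for $0\le i\le\lfloor\frac{s-1}{2}\rfloor$. Let $\{(\Xi_l^{(1)},\dots,\Xi_l^{(s)})\}_{l\in\mathbb Z}$ be i.i.d. zero-mean random elements of $\mathbb R^{m\times s}$ with columns $\Xi_l^{(r)}\in\mathbb R^m$ (for fixed $l$ the columns may be dependent), such that $E\big[\|\Xi_1^{(r)}\|_F^{\,s\vee 2}\big]<\infty$ for $1\le r\le s$ and $$\max_{\pi}\ \max_{0\le i\le\lfloor\frac{s-1}{2}\rfloor}\ \sup_{t\ge 0}\ t^{\alpha_i}\,P\Big(\prod_{r\in\{\pi(1),\dots,\pi(s-i)\}}\|\Xi_1^{(r)}\|_F>t\Big)<\infty ,$$ where $\pi$ ranges over the permutations of $\{1,\dots,s\}$ and $\|A\|_F=\sqrt{\operatorname{trace}(A^TA)}$ is the Frobenius norm. Let $C_l^{(r)}\in\mathbb R^{d\times m}$ ($l\in\mathbb Z$, $1\le r\le s$) satisfy $\sup_{l\in\mathbb Z}|l|^{\sigma_r}\|C_l^{(r)}\|_F<\infty$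 for some $\sigma_r\in(\frac12,1]$, $1\le r\le s$. Then for all $1\le r\le s$ and $k\in\mathbb Z$ the two-sided series $X_k^{(r)}=\sum_{l=-\infty}^{\infty}C_{k-l}^{(r)}\Xi_l^{(r)}$ converges almost surely (in the sense that $\sum_{l=-M}^{N}$ converges as $M,N\to\infty$), the tensor product $\bigotimes_{r=1}^sX_k^{(r)}\in(\mathbb R^d)^{\otimes s}$ is integrable, and $$\lim_{n\to\infty}n^{-\frac1p}\sum_{k=1}^n\Big(\bigotimes_{r=1}^sX_k^{(r)}-E\Big[\bigotimes_{r=1}^sX_k^{(r)}\Big]\Big)=0\quad\text{a.s.}$$ for every $p$ with $$0<p<\begin{cases}\frac{2}{3-2\sigma_1}, & s=1,\\[2pt] 2\wedge\alpha_0\wedge\frac{1}{2-\sigma_1-\sigma_2}, & s=2,\\[2pt] \alpha_0\wedge\frac{2}{3-2\min_{1\le i\le s}\sigma_i}, & s>2,\end{cases}$$ where $\frac{1}{2-\sigma_1-\sigma_2}=\infty$ if $\sigma_1=\sigma_2=1$. -/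

import Mathlib

open MeasureTheory ProbabilityTheory Filter Topology

noncomputable section

namespace LinearProcessMSLLN

/-- The Frobenius norm `√(trace (Aᵀ A))` of a real matrix. -/
def frobNorm {d m : ℕ} (A : Matrix (Fin d) (Fin m) ℝ) : ℝ :=
  Real.sqrt (Matrix.trace (A.transpose * A))

/-- The tensor product `v⁽¹⁾ ⊗ ⋯ ⊗ v⁽ˢ⁾` of `s` vectors of `ℝᵈ`, as an element of
`(ℝᵈ)^{⊗ s} = ℝ^{d^s}`: its coordinate at the multi-index `(j₁, …, j_s)` is
`v⁽¹⁾_{j₁} ⋯ v⁽ˢ⁾_{j_s}`. -/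
def tensorProd {s d : ℕ} (v : Fin s → EuclideanSpace ℝ (Fin d)) :
    EuclideanSpace ℝ (Fin s → Fin d) :=
  WithLp.toLp 2 (fun j => ∏ r, v r (j r))

/-- The partial sum `∑_{l = -M}^{N} C_{k-l} Ξ_l` of a two-sided series, with `K = (M, N)`. -/
def partialSum {Ω : Type*} {d m : ℕ} (C : ℤ → Matrix (Fin d) (Fin m) ℝ)
    (Ξ : ℤ → Ω → EuclideanSpace ℝ (Fin m)) (k : ℤ) (ω : Ω) (K : ℕ × ℕ) :
    EuclideanSpace ℝ (Fin d) :=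
  ∑ l ∈ Finset.Icc (-(K.1 : ℤ)) (K.2 : ℤ), WithLp.toLp 2 ((C (k - l)).mulVec (Ξ l ω).ofLp)

/-- The two-sided linear process `X_k = ∑_{l ∈ ℤ} C_{k-l} Ξ_l`: the limit of
`∑_{l = -M}^{N} C_{k-l} Ξ_l` as `M, N → ∞`. The series need not converge absolutely, so this is
not a `tsum`. The value is arbitrary at those `ω` at which the series diverges. -/
def linearProcess {Ω : Type*} {d m : ℕ} (C : ℤ → Matrix (Fin d) (Fin m) ℝ)
    (Ξ : ℤ → Ω → EuclideanSpace ℝ (Fin m)) (k : ℤ) (ω : Ω) : EuclideanSpace ℝ (Fin d) :=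
  limUnder atTop (partialSum C Ξ k ω)

/-- The tail exponents `α_i = s / (s - i) * α₀`; in particular the exponent at `i = 0` is `α₀`. -/
def tailExponent (s : ℕ) (α₀ : ℝ) (i : ℕ) : ℝ :=
  (s : ℝ) / ((s : ℝ) - (i : ℝ)) * α₀

/-- The range of the exponent `p`:
`0 < p < 2 / (3 - 2 σ₁)` if `s = 1`,
`0 < p < 2 ∧ α₀ ∧ 1 / (2 - σ₁ - σ₂)` if `s = 2` (with `1 / 0 = ∞`, hence the product form),
`0 < p < α₀ ∧ 2 / (3 - 2 min_r σ_r)` if `s > 2`. -/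
def IsAdmissibleExponent (s : ℕ) (α₀ : ℝ) (σ : Fin s → ℝ) (p : ℝ) : Prop :=
  0 < p ∧
  (s = 1 → ∀ r, p < 2 / (3 - 2 * σ r)) ∧
  (s = 2 → p < 2 ∧ p < α₀ ∧ p * (2 - ∑ r, σ r) < 1) ∧
  (2 < s → p < α₀ ∧ ∀ r, p < 2 / (3 - 2 * σ r))

end LinearProcessMSLLN

end

noncomputable section

set_option linter.unusedSectionVars false

namespace LinearProcessMSLLN

/-! ### Elementary inequalities -/

/-! Each coordinate of the tensor product is a finite sum of products `∏ r, Y r k` of scalar linear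
processes `Y r k = ∑ l, c r (k - l) * ξ l r`, so a scalar law (`ae_tendsto_sum_prod_sub_integral`)
is enough. It is proved with `ℤ` replaced by a finite set `L`, with all bounds uniform in `L`.

Expand the product and group the coordinates that carry the same index `l` into a block. Writing
each block product as its centred version plus its mean gives a Hoeffding decomposition
(`prod_sum_eq_sum_assignments`). It is indexed by partial assignments `g`, which send some
coordinates to indices and leave the others free. The free coordinates are summed into a
deterministic coefficient, which is bounded, and which vanishes when exactly one coordinate is free
(`freeCoeff_eq_zero`). Terms whose sets of indices differ are orthogonal, so variances reduce to
sums of squared coefficients (`integral_sq_sum_blockProd_le`).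

Let `S = max s 2`. A block of at most `S / 2` coordinates is square integrable. A larger, heavy,
block has only moments of order `q < α₀`, so it is truncated at a level `T`; any term contains at
most one heavy block. Coefficient correlations decay like `|k - k'| ^ (-κ r)` for every `κ r < 2 * σ
r - 1`. Hence the centred sum over a window of length `n` is a main part plus a remainder. The main
part has second moment `O(n ^ β + T ^ (2 - q) * n)`, where the heavy term is linear in `n` because
two coordinates sharing an index have an absolutely summable coefficient product. The remainder is
`O(T ^ (1 - q))` in mean at each time.

A Rademacher–Menshov maximal inequality on dyadic windows, with `T = (2 ^ j) ^ (1 / p)`, yields tail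
bounds that are geometric in `j` up to a factor `j ^ 2` once `β < 2 / p` and `p < q`. These bounds
pass to the limit of `L`, and Borel–Cantelli concludes. The range of `p` encodes when suitable `κ`,
`β` and `q` exist. For `s = 2` the vanishing coefficient removes all supports but the full one, so
that `κ` is summed over both coordinates. -/

lemma succ_mul_pow_mul_le (m : ℕ) {u v : ℝ} (hu : 0 ≤ u) (hv : 0 ≤ v) :
    (m + 1 : ℝ) * v ^ m * u ≤ u ^ (m + 1) + m * v ^ (m + 1) := by
  induction m with
  | zero => simp
  | succ m ih =>
    have h1 : v * u ^ (m + 1) + v ^ (m + 1) * u ≤ u ^ (m + 2) + v ^ (m + 2) := by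
      have : 0 ≤ (u - v) * (u ^ (m + 1) - v ^ (m + 1)) := by
        rcases le_total u v with h | h
        · exact mul_nonneg_of_nonpos_of_nonpos (by linarith)
            (by linarith [pow_le_pow_left₀ hu h (m + 1)])
        · exact mul_nonneg (by linarith) (by linarith [pow_le_pow_left₀ hv h (m + 1)])
      ring_nf at this ⊢
      linarith
    have h2 := mul_le_mul_of_nonneg_left ih hv
    push_cast
    ring_nf at h1 h2 ⊢
    linarith

/-- Up to a constant `t * |t| ^ n` is the derivative of `|t| ^ (n + 2)`; this Lipschitz estimate is
what controls the second order remainder in `abs_add_pow_le`. -/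
lemma abs_mul_abs_pow_sub_le (n : ℕ) {a x m : ℝ} (ha : |a| ≤ m) (hx : |x| ≤ m) :
    |a * |a| ^ n - x * |x| ^ n| ≤ (n + 1) * |a - x| * m ^ n := by
  have hm : 0 ≤ m := (abs_nonneg a).trans ha
  induction n with
  | zero => simp
  | succ n ih =>
    have e : a * |a| ^ (n + 1) - x * |x| ^ (n + 1)
        = (a * |a| ^ n - x * |x| ^ n) * |a| + x * |x| ^ n * (|a| - |x|) := by ring
    rw [e]
    have h1 : |(a * |a| ^ n - x * |x| ^ n) * (|a|)| ≤ ((n + 1) * |a - x| * m ^ n) * m := by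
      rw [abs_mul, abs_abs]
      exact mul_le_mul ih ha (abs_nonneg _) (by positivity)
    have h2 : |x * |x| ^ n * (|a| - |x|)| ≤ m ^ (n + 1) * |a - x| := by
      rw [abs_mul, abs_mul, abs_pow, abs_abs, ← pow_succ']
      exact mul_le_mul (pow_le_pow_left₀ (abs_nonneg _) hx _) (abs_abs_sub_abs_le a x)
        (abs_nonneg _) (by positivity)
    refine (abs_add_le _ _).trans ((add_le_add h1 h2).trans (le_of_eq ?_))
    push_cast
    ring

lemma add_pow_le_two_pow_mul (n : ℕ) {u v : ℝ} (hu : 0 ≤ u) (hv : 0 ≤ v) :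
    (u + v) ^ n ≤ 2 ^ n * (u ^ n + v ^ n) := by
  rcases le_total u v with h | h
  · calc (u + v) ^ n ≤ (2 * v) ^ n := pow_le_pow_left₀ (by positivity) (by linarith) _
      _ = 2 ^ n * v ^ n := mul_pow _ _ _
      _ ≤ _ := by gcongr; linarith [pow_nonneg hu n]
  · calc (u + v) ^ n ≤ (2 * u) ^ n := pow_le_pow_left₀ (by positivity) (by linarith) _
      _ = 2 ^ n * u ^ n := mul_pow _ _ _
      _ ≤ _ := by gcongr; linarith [pow_nonneg hv n]

/-- A second order Taylor bound for `t ↦ |t| ^ (n + 2)`. -/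
lemma abs_add_pow_le (n : ℕ) (x y : ℝ) :
    |x + y| ^ (n + 2) ≤ |x| ^ (n + 2) + (n + 2) * (x * |x| ^ n) * y
      + ((n + 2) * (n + 1) * 2 ^ n) * (|x| ^ n * y ^ 2 + |y| ^ (n + 2)) := by
  set a := x + y with ha
  have hy : y = a - x := by rw [ha]; ring
  -- Convexity gives the tangent line bound at `a = x + y`; `h3` then moves the derivative from `a`
  -- back to `x`, at the price of the quadratic term.
  have h1 := succ_mul_pow_mul_le (n + 1) (abs_nonneg x) (abs_nonneg a)
  have h2 : |a| ^ (n + 2) ≤ |x| ^ (n + 2) + (n + 2) * (a * |a| ^ n) * y := by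
    have e1 : a * x ≤ |a| * |x| := by rw [← abs_mul]; exact le_abs_self _
    have e2 : |a| ^ n * (a * x) ≤ |a| ^ n * (|a| * |x|) :=
      mul_le_mul_of_nonneg_left e1 (by positivity)
    have e3 : a * a = |a| ^ 2 := by rw [sq_abs]; ring
    have e4 : (n + 2 : ℝ) * (a * |a| ^ n) * y
        = (n + 2) * |a| ^ (n + 2) - (n + 2) * (|a| ^ n * (a * x)) := by
      rw [hy, pow_add, ← e3]; ring
    rw [e4]
    push_cast at h1
    have e5 : (n + 2 : ℝ) * (|a| ^ n * (a * x)) ≤ (n + 2) * (|a| ^ n * (|a| * |x|)) :=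
      mul_le_mul_of_nonneg_left e2 (by positivity)
    have e6 : ((n : ℝ) + 1 + 1) * |a| ^ (n + 1) * |x| = (n + 2) * (|a| ^ n * (|a| * |x|)) := by
      ring
    have e7 : n + 1 + 1 = n + 2 := rfl
    rw [e7] at h1
    linarith
  have h3 : (a * |a| ^ n - x * |x| ^ n) * y
      ≤ (n + 1) * 2 ^ n * (|x| ^ n * y ^ 2 + |y| ^ (n + 2)) := by
    have hl := abs_mul_abs_pow_sub_le n (a := a) (x := x) (m := |x| + |y|)
      (abs_add_le _ _) (by linarith [abs_nonneg y])
    rw [← hy] at hl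
    calc (a * |a| ^ n - x * |x| ^ n) * y ≤ |(a * |a| ^ n - x * |x| ^ n) * y| := le_abs_self _
      _ = |a * |a| ^ n - x * |x| ^ n| * |y| := abs_mul _ _
      _ ≤ ((n + 1) * |y| * (2 ^ n * (|x| ^ n + |y| ^ n))) * |y| := by
          gcongr
          refine hl.trans ?_
          gcongr
          exact add_pow_le_two_pow_mul n (abs_nonneg _) (abs_nonneg _)
      _ = (n + 1) * 2 ^ n * (|x| ^ n * |y| ^ 2 + |y| ^ (n + 2)) := by ring
      _ = _ := by rw [sq_abs]
  have h4 : (n + 2 : ℝ) * (a * |a| ^ n) * y = (n + 2) * (x * |x| ^ n) * y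
      + (n + 2) * ((a * |a| ^ n - x * |x| ^ n) * y) := by ring
  have h5 := mul_le_mul_of_nonneg_left h3 (by positivity : (0 : ℝ) ≤ n + 2)
  rw [h4] at h2
  nlinarith [h2, h5]

/-- Either every factor is at most `1`, or the largest one exceeds `1` and its `S`-th power
dominates the product. Moments of order `S` of single coordinates thus control all products of up to
`S` coordinates, with no independence among them. -/
lemma prod_abs_le_one_add_sum_pow {ι : Type*} (B : Finset ι) (x : ι → ℝ) {S : ℕ}
    (hB : B.card ≤ S) : ∏ r ∈ B, |x r| ≤ 1 + ∑ r ∈ B, |x r| ^ S := by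
  classical
  have hs : 0 ≤ ∑ r ∈ B, |x r| ^ S := Finset.sum_nonneg fun _ _ => by positivity
  by_cases h : ∀ r ∈ B, |x r| ≤ 1
  · linarith [Finset.prod_le_one (fun r (_ : r ∈ B) => abs_nonneg (x r)) h]
  · push Not at h
    obtain ⟨r1, hr1, h1⟩ := h
    obtain ⟨r0, hr0, hmax⟩ := B.exists_max_image (fun r => |x r|) ⟨r1, hr1⟩
    have h0 : 1 ≤ |x r0| := h1.le.trans (hmax r1 hr1)
    calc ∏ r ∈ B, |x r| ≤ ∏ _r ∈ B, |x r0| :=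
          Finset.prod_le_prod (fun _ _ => abs_nonneg _) hmax
      _ = |x r0| ^ B.card := by simp
      _ ≤ |x r0| ^ S := pow_le_pow_right₀ h0 hB
      _ ≤ ∑ r ∈ B, |x r| ^ S :=
          Finset.single_le_sum (f := fun r => |x r| ^ S) (fun _ _ => by positivity) hr0
      _ ≤ _ := by linarith

lemma pow_le_one_add_pow {n N : ℕ} (h : n ≤ N) {x : ℝ} (hx : 0 ≤ x) : x ^ n ≤ 1 + x ^ N := by
  rcases le_total x 1 with h1 | h1
  · linarith [pow_le_one₀ (n := n) hx h1, pow_nonneg hx N]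
  · linarith [pow_le_pow_right₀ h1 h]

/-! ### A dyadic maximal inequality -/

/-- The sum of the squares of all proper dyadic block sums of `y` over the window
`[a, a + 2 ^ j)`. -/
def dyadicSq (y : ℕ → ℝ) : ℕ → ℕ → ℝ
  | 0, _ => 0
  | j + 1, a => (∑ i ∈ Finset.range (2 ^ j), y (a + i)) ^ 2 + dyadicSq y j a
      + dyadicSq y j (a + 2 ^ j)

lemma dyadicSq_nonneg (y : ℕ → ℝ) (j a : ℕ) : 0 ≤ dyadicSq y j a := by
  induction j generalizing a with
  | zero => simp [dyadicSq]
  | succ j ih =>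
    have := sq_nonneg (∑ i ∈ Finset.range (2 ^ j), y (a + i))
    simp only [dyadicSq]
    linarith [ih a, ih (a + 2 ^ j)]

/-- The binary expansion of `n` cuts `[a, a + n)` into at most `j` blocks, each the left half of a
dyadic window; these are the only blocks recorded in `dyadicSq`. Cauchy–Schwarz gives the factor
`j`. -/
lemma sq_sum_range_le_dyadicSq (y : ℕ → ℝ) (j a n : ℕ) (hn : n < 2 ^ j) :
    (∑ i ∈ Finset.range n, y (a + i)) ^ 2 ≤ j * dyadicSq y j a := by
  induction j generalizing a n with
  | zero =>
    have : n = 0 := by simpa using hn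
    subst this; simp
  | succ j ih =>
    have p1 := dyadicSq_nonneg y j a
    have p2 := dyadicSq_nonneg y j (a + 2 ^ j)
    have p3 := sq_nonneg (∑ i ∈ Finset.range (2 ^ j), y (a + i))
    have hj : (0 : ℝ) ≤ j := Nat.cast_nonneg j
    simp only [dyadicSq]
    push_cast
    rcases lt_or_ge n (2 ^ j) with h | h
    · nlinarith [ih a n h, mul_nonneg hj p2, mul_nonneg hj p3]
    · obtain ⟨m, rfl⟩ := Nat.exists_eq_add_of_le h
      have hm : m < 2 ^ j := by rw [pow_succ] at hn; omega
      rw [Finset.sum_range_add]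
      have ih' := ih (a + 2 ^ j) m hm
      simp only [← add_assoc]
      set u := ∑ i ∈ Finset.range (2 ^ j), y (a + i)
      set v := ∑ i ∈ Finset.range m, y (a + 2 ^ j + i)
      set Q := dyadicSq y j (a + 2 ^ j)
      -- Cauchy–Schwarz with weights `1` and `j`. For `j = 0` the second piece is empty and the
      -- weight cannot be divided by.
      have key : (u + v) ^ 2 ≤ (j + 1) * (u ^ 2 + Q) := by
        rcases Nat.eq_zero_or_pos j with h0 | h0
        · subst h0
          have : v ^ 2 ≤ 0 := by simpa using ih'
          have hv : v = 0 := by nlinarith [sq_nonneg v]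
          rw [hv]; push_cast; nlinarith
        · have hj1 : (0 : ℝ) < j := by exact_mod_cast h0
          have hQ : v ^ 2 / j ≤ Q := by rw [div_le_iff₀ hj1]; linarith
          have : (u + v) ^ 2 ≤ (j + 1) * (u ^ 2 + v ^ 2 / j) := by
            have : (j + 1) * (u ^ 2 + v ^ 2 / j) - (u + v) ^ 2 = (j * u - v) ^ 2 / j := by
              field_simp; ring
            have h3 : 0 ≤ (j * u - v) ^ 2 / j := by positivity
            linarith
          refine this.trans ?_
          gcongr
      nlinarith [key, mul_nonneg hj p1]

/-- Since `β ≥ 1`, halving a window does not increase the total of the bounds, so each of the `j`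
levels costs at most the bound for the whole window. Combined with `sq_sum_range_le_dyadicSq` the
loss is `j ^ 2`, harmless against geometric decay. -/
lemma integral_dyadicSq_le {Ω : Type*} [MeasurableSpace Ω] {μ : Measure Ω} (y : ℕ → Ω → ℝ)
    {V₁ V₂ β : ℝ} (hβ : 1 ≤ β) (hV₁ : 0 ≤ V₁) (hV₂ : 0 ≤ V₂)
    (hint : ∀ a n, Integrable (fun ω => (∑ i ∈ Finset.range n, y (a + i) ω) ^ 2) μ)
    (hle : ∀ a n, ∫ ω, (∑ i ∈ Finset.range n, y (a + i) ω) ^ 2 ∂μ ≤ V₁ * (n : ℝ) ^ β + V₂ * n)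
    (j a : ℕ) :
    Integrable (fun ω => dyadicSq (fun k => y k ω) j a) μ ∧
      ∫ ω, dyadicSq (fun k => y k ω) j a ∂μ
        ≤ j * (V₁ * ((2 : ℝ) ^ j) ^ β + V₂ * 2 ^ j) := by
  induction j generalizing a with
  | zero => simp [dyadicSq]
  | succ j ih =>
    obtain ⟨i1, l1⟩ := ih a
    obtain ⟨i2, l2⟩ := ih (a + 2 ^ j)
    have i0 := hint a (2 ^ j)
    have l0 := hle a (2 ^ j)
    simp only [dyadicSq]
    refine ⟨(i0.add i1).add i2, ?_⟩
    have e : ∫ ω, ((∑ i ∈ Finset.range (2 ^ j), y (a + i) ω) ^ 2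
        + dyadicSq (fun k => y k ω) j a + dyadicSq (fun k => y k ω) j (a + 2 ^ j)) ∂μ
        = ∫ ω, (∑ i ∈ Finset.range (2 ^ j), y (a + i) ω) ^ 2 ∂μ
          + ∫ ω, dyadicSq (fun k => y k ω) j a ∂μ
          + ∫ ω, dyadicSq (fun k => y k ω) j (a + 2 ^ j) ∂μ := by
      rw [← integral_add i0 i1]
      exact integral_add (i0.add i1) i2
    rw [e]
    push_cast at l0 ⊢
    have h2 : 2 * ((2 : ℝ) ^ j) ^ β ≤ ((2 : ℝ) ^ (j + 1)) ^ β := by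
      rw [pow_succ, Real.mul_rpow (by positivity) (by norm_num), mul_comm]
      gcongr
      calc (2 : ℝ) = 2 ^ (1 : ℝ) := by simp
        _ ≤ 2 ^ β := Real.rpow_le_rpow_of_exponent_le (by norm_num) hβ
    have hp : (0 : ℝ) ≤ ((2 : ℝ) ^ j) ^ β := by positivity
    have h3 := mul_le_mul_of_nonneg_left h2 hV₁
    have h4 : V₁ * ((2 : ℝ) ^ j) ^ β ≤ V₁ * ((2 : ℝ) ^ (j + 1)) ^ β := by
      nlinarith [mul_nonneg hV₁ hp]
    have h5 := mul_le_mul_of_nonneg_left h3 (Nat.cast_nonneg (α := ℝ) j)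
    have h6 : V₂ * (2 : ℝ) ^ j ≤ V₂ * 2 ^ (j + 1) := by
      gcongr <;> norm_num
    have h7 : (j : ℝ) * (V₂ * 2 ^ (j + 1)) = 2 * (j * (V₂ * 2 ^ j)) := by ring
    nlinarith

/-! ### Convolution estimates for polynomially decaying sequences -/

lemma summable_one_add_abs_rpow {a : ℝ} (ha : 1 < a) :
    Summable (fun l : ℤ => (1 + |(l : ℝ)|) ^ (-a)) := by
  have h := (Real.summable_abs_int_rpow ha)
  refine Summable.of_norm_bounded_eventually (g := fun l : ℤ => |(l : ℝ)| ^ (-a)) h ?_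
  have : ∀ᶠ l : ℤ in cofinite, l ≠ 0 := by
    simpa using (Set.finite_singleton (0 : ℤ)).compl_mem_cofinite
  filter_upwards [this] with l hl
  rw [Real.norm_of_nonneg (by positivity)]
  have : 0 < |(l : ℝ)| := by positivity
  exact Real.rpow_le_rpow_of_nonpos this (by linarith) (by linarith)

lemma exists_sum_one_add_abs_sub_rpow_le {a : ℝ} (ha : 1 < a) :
    ∃ Z : ℝ, 0 ≤ Z ∧ ∀ (L : Finset ℤ) (k : ℤ),
      ∑ l ∈ L, (1 + |((k - l : ℤ) : ℝ)|) ^ (-a) ≤ Z := by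
  have hs := summable_one_add_abs_rpow ha
  refine ⟨∑' l : ℤ, (1 + |(l : ℝ)|) ^ (-a), tsum_nonneg fun _ => by positivity, fun L k => ?_⟩
  have hs' := (Equiv.subLeft k).summable_iff.2 hs
  have := hs'.sum_le_tsum L (fun l _ => by simp only [Function.comp]; positivity)
  simp only [Function.comp] at this
  rw [(Equiv.subLeft k).tsum_eq (fun l : ℤ => (1 + |(l : ℝ)|) ^ (-a))] at this
  simpa using this

/-- Of `u = 1 + |k - l|` and `v = 1 + |k' - l|` the larger is at least half of `1 + |k - k'|`. The
power `κ` is taken out of the larger and the rest is given to the smaller, whose exponent `2 * σ - κ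
> 1` is summable. The exchange needs `κ ≤ σ`, which follows from `κ < 2 * σ - 1` and `σ ≤ 1`. -/
lemma exists_sum_abs_mul_abs_le {σ κ K : ℝ} (hσ : σ ≤ 1) (hκ0 : 0 ≤ κ) (hκ : κ < 2 * σ - 1)
    {c : ℤ → ℝ} (hc : ∀ l, |c l| ≤ K * (1 + |(l : ℝ)|) ^ (-σ)) :
    ∃ C : ℝ, 0 ≤ C ∧ ∀ (L : Finset ℤ) (k k' : ℤ),
      ∑ l ∈ L, |c (k - l)| * |c (k' - l)| ≤ C * (1 + |((k - k' : ℤ) : ℝ)|) ^ (-κ) := by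
  obtain ⟨Z, hZ0, hZ⟩ := exists_sum_one_add_abs_sub_rpow_le (a := 2 * σ - κ) (by linarith)
  refine ⟨K ^ 2 * 2 ^ κ * (Z + Z), by positivity, fun L k k' => ?_⟩
  set w := (1 + |((k - k' : ℤ) : ℝ)|) with hw
  have hw1 : 1 ≤ w := by rw [hw]; linarith [abs_nonneg ((k - k' : ℤ) : ℝ)]
  have aux : ∀ u v : ℝ, 1 ≤ u → u ≤ v → w ≤ 2 * v →
      u ^ (-σ) * v ^ (-σ) ≤ u ^ (-(2 * σ - κ)) * (2 ^ κ * w ^ (-κ)) := by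
    intro u v hu huv hwv
    have hu0 : 0 < u := by linarith
    have hv0 : 0 < v := by linarith
    have e1 : u ^ (-σ) = u ^ (-(2 * σ - κ)) * u ^ (σ - κ) := by
      rw [← Real.rpow_add hu0]; ring_nf
    have e2 : v ^ (-κ) = v ^ (σ - κ) * v ^ (-σ) := by
      rw [← Real.rpow_add hv0]; ring_nf
    have e3 : u ^ (σ - κ) ≤ v ^ (σ - κ) := Real.rpow_le_rpow hu0.le huv (by linarith)
    have e4 : v ^ (-κ) ≤ 2 ^ κ * w ^ (-κ) := by
      have : (2 * v) ^ (-κ) ≤ w ^ (-κ) :=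
        Real.rpow_le_rpow_of_nonpos (by linarith) hwv (by linarith)
      rw [Real.mul_rpow (by norm_num) hv0.le] at this
      calc v ^ (-κ) = 2 ^ κ * (2 ^ (-κ) * v ^ (-κ)) := by
            rw [← mul_assoc, ← Real.rpow_add (by norm_num)]; simp
        _ ≤ _ := by gcongr
    calc u ^ (-σ) * v ^ (-σ) = u ^ (-(2 * σ - κ)) * (u ^ (σ - κ) * v ^ (-σ)) := by rw [e1]; ring
      _ ≤ u ^ (-(2 * σ - κ)) * (v ^ (σ - κ) * v ^ (-σ)) := by gcongr
      _ = u ^ (-(2 * σ - κ)) * v ^ (-κ) := by rw [e2]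
      _ ≤ _ := by gcongr
  have hterm : ∀ l ∈ L, |c (k - l)| * |c (k' - l)| ≤ K ^ 2 * 2 ^ κ * w ^ (-κ) *
      ((1 + |((k - l : ℤ) : ℝ)|) ^ (-(2 * σ - κ)) + (1 + |((k' - l : ℤ) : ℝ)|) ^ (-(2 * σ - κ))) := by
    intro l _
    set u := (1 + |((k - l : ℤ) : ℝ)|) with hu
    set v := (1 + |((k' - l : ℤ) : ℝ)|) with hv
    have hu1 : 1 ≤ u := by rw [hu]; linarith [abs_nonneg ((k - l : ℤ) : ℝ)]
    have hv1 : 1 ≤ v := by rw [hv]; linarith [abs_nonneg ((k' - l : ℤ) : ℝ)]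
    have hwuv : w ≤ u + v - 1 := by
      rw [hw, hu, hv]
      have : ((k - k' : ℤ) : ℝ) = ((k - l : ℤ) : ℝ) - ((k' - l : ℤ) : ℝ) := by push_cast; ring
      rw [this]
      linarith [abs_sub ((k - l : ℤ) : ℝ) ((k' - l : ℤ) : ℝ)]
    have hcc : |c (k - l)| * |c (k' - l)| ≤ K ^ 2 * (u ^ (-σ) * v ^ (-σ)) := by
      calc _ ≤ (K * u ^ (-σ)) * (K * v ^ (-σ)) :=
            mul_le_mul (hc _) (hc _) (abs_nonneg _) ((abs_nonneg _).trans (hc _))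
        _ = _ := by ring
    refine hcc.trans ?_
    have pu : 0 ≤ u ^ (-(2 * σ - κ)) := by positivity
    have pv : 0 ≤ v ^ (-(2 * σ - κ)) := by positivity
    have pc : 0 ≤ (2 : ℝ) ^ κ * w ^ (-κ) := by positivity
    have : u ^ (-σ) * v ^ (-σ)
        ≤ (u ^ (-(2 * σ - κ)) + v ^ (-(2 * σ - κ))) * (2 ^ κ * w ^ (-κ)) := by
      rcases le_total u v with h | h
      · refine (aux u v hu1 h (by linarith)).trans ?_
        gcongr; linarith
      · rw [mul_comm (u ^ (-σ))]
        refine (aux v u hv1 h (by linarith)).trans ?_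
        gcongr; linarith
    calc _ ≤ K ^ 2 * ((u ^ (-(2 * σ - κ)) + v ^ (-(2 * σ - κ))) * (2 ^ κ * w ^ (-κ))) := by gcongr
      _ = _ := by ring
  refine (Finset.sum_le_sum hterm).trans ?_
  rw [← Finset.mul_sum, Finset.sum_add_distrib]
  have : K ^ 2 * 2 ^ κ * (Z + Z) * w ^ (-κ) = K ^ 2 * 2 ^ κ * w ^ (-κ) * (Z + Z) := by ring
  rw [this]
  gcongr
  · exact hZ L k
  · exact hZ L k'

/-- Within a window `1 + |i - i'| ≤ n`, so a factor `n ^ (β - 1)` can be traded for the exponent `κ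
+ β - 1 > 1`, which makes each inner sum bounded. -/
lemma exists_sum_sum_rpow_le {κ β : ℝ} (hβ1 : 1 ≤ β) (hβ : 2 - κ < β) :
    ∃ C : ℝ, 0 ≤ C ∧ ∀ a n : ℕ, ∑ i ∈ Finset.range n, ∑ i' ∈ Finset.range n,
      (1 + |((((a + i : ℕ) : ℤ) - ((a + i' : ℕ) : ℤ) : ℤ) : ℝ)|) ^ (-κ) ≤ C * (n : ℝ) ^ β := by
  obtain ⟨Z, hZ0, hZ⟩ := exists_sum_one_add_abs_sub_rpow_le (a := κ + β - 1) (by linarith)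
  refine ⟨Z, hZ0, fun a n => ?_⟩
  rcases Nat.eq_zero_or_pos n with rfl | hn
  · simp; positivity
  have hn' : (0 : ℝ) < n := by exact_mod_cast hn
  have inner : ∀ i ∈ Finset.range n, ∑ i' ∈ Finset.range n,
      (1 + |((((a + i : ℕ) : ℤ) - ((a + i' : ℕ) : ℤ) : ℤ) : ℝ)|) ^ (-κ) ≤ (n : ℝ) ^ (β - 1) * Z := by
    intro i hi
    have h1 : ∀ i' ∈ Finset.range n,
        (1 + |((((a + i : ℕ) : ℤ) - ((a + i' : ℕ) : ℤ) : ℤ) : ℝ)|) ^ (-κ)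
        ≤ (n : ℝ) ^ (β - 1) *
          (1 + |((((a + i : ℕ) : ℤ) - ((a + i' : ℕ) : ℤ) : ℤ) : ℝ)|) ^ (-(κ + β - 1)) := by
      intro i' hi'
      set t := (1 + |((((a + i : ℕ) : ℤ) - ((a + i' : ℕ) : ℤ) : ℤ) : ℝ)|) with ht
      have ht0 : 0 < t := by positivity
      have htn : t ≤ n := by
        rw [Finset.mem_range] at hi hi'
        have : 1 + |(((a + i : ℕ) : ℤ) - ((a + i' : ℕ) : ℤ))| ≤ (n : ℤ) := by
          have := abs_lt.2 (show -(n : ℤ) < ((a + i : ℕ) : ℤ) - ((a + i' : ℕ) : ℤ) ∧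
            ((a + i : ℕ) : ℤ) - ((a + i' : ℕ) : ℤ) < n by constructor <;> push_cast <;> omega)
          omega
        rw [ht]; exact_mod_cast this
      calc t ^ (-κ) = t ^ (β - 1) * t ^ (-(κ + β - 1)) := by
            rw [← Real.rpow_add ht0]; ring_nf
        _ ≤ _ := by gcongr
    refine (Finset.sum_le_sum h1).trans ?_
    rw [← Finset.mul_sum]
    gcongr
    have h2 := hZ ((Finset.range n).map ⟨fun i' : ℕ => ((a + i' : ℕ) : ℤ),
      fun x y h => by simpa using h⟩) ((a + i : ℕ) : ℤ)
    rw [Finset.sum_map] at h2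
    exact h2
  refine (Finset.sum_le_sum inner).trans (le_of_eq ?_)
  rw [Finset.sum_const, Finset.card_range, nsmul_eq_mul]
  have : (n : ℝ) ^ β = n * n ^ (β - 1) := by
    rw [← Real.rpow_one_add' hn'.le (by linarith)]; ring_nf
  rw [this]; ring

/-! ### Moments of weighted sums of independent centred random variables -/

section Moments

variable {Ω : Type*} [MeasurableSpace Ω] {μ : Measure Ω} [IsProbabilityMeasure μ]

lemma integrable_abs_pow_of_le {f : Ω → ℝ} (hf : AEStronglyMeasurable f μ) {n N : ℕ} (h : n ≤ N)
    (hi : Integrable (fun ω => |f ω| ^ N) μ) : Integrable (fun ω => |f ω| ^ n) μ := by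
  refine ((integrable_const 1).add hi).mono' (by fun_prop) (ae_of_all _ fun ω => ?_)
  rw [Real.norm_of_nonneg (by positivity)]
  exact pow_le_one_add_pow h (abs_nonneg _)

lemma integral_abs_pow_le_of_le {f : Ω → ℝ} (hf : AEStronglyMeasurable f μ) {n N : ℕ} (h : n ≤ N)
    (hi : Integrable (fun ω => |f ω| ^ N) μ) :
    ∫ ω, |f ω| ^ n ∂μ ≤ 1 + ∫ ω, |f ω| ^ N ∂μ := by
  have : ∫ ω, (1 + |f ω| ^ N) ∂μ = 1 + ∫ ω, |f ω| ^ N ∂μ := by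
    rw [integral_add (integrable_const 1) hi]; simp
  rw [← this]
  exact integral_mono (integrable_abs_pow_of_le hf h hi) ((integrable_const 1).add hi)
    fun ω => pow_le_one_add_pow h (abs_nonneg _)

/-- Taking expectations in `abs_add_pow_le`: independence and the zero mean of `y` kill the linear
term, and independence factors the mixed one. -/
lemma integral_abs_add_pow_le (n : ℕ) {x y : Ω → ℝ} (hx : Measurable x) (hy : Measurable y)
    (hxy : IndepFun x y μ) (hix : Integrable (fun ω => |x ω| ^ (n + 2)) μ)
    (hiy : Integrable (fun ω => |y ω| ^ (n + 2)) μ) (hy0 : ∫ ω, y ω ∂μ = 0) :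
    Integrable (fun ω => |x ω + y ω| ^ (n + 2)) μ ∧
    ∫ ω, |x ω + y ω| ^ (n + 2) ∂μ ≤ ∫ ω, |x ω| ^ (n + 2) ∂μ
      + ((n + 2) * (n + 1) * 2 ^ n) * ((∫ ω, |x ω| ^ n ∂μ) * (∫ ω, y ω ^ 2 ∂μ)
        + ∫ ω, |y ω| ^ (n + 2) ∂μ) := by
  have ixn := integrable_abs_pow_of_le hx.aestronglyMeasurable (by omega : n ≤ n + 2) hix
  have ixn1 := integrable_abs_pow_of_le hx.aestronglyMeasurable (by omega : n + 1 ≤ n + 2) hix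
  have iy1 : Integrable y μ := by
    have := integrable_abs_pow_of_le hy.aestronglyMeasurable (by omega : 1 ≤ n + 2) hiy
    simp only [pow_one] at this
    exact (integrable_norm_iff hy.aestronglyMeasurable).1 this
  have iy2 : Integrable (fun ω => y ω ^ 2) μ := by
    have := integrable_abs_pow_of_le hy.aestronglyMeasurable (by omega : 2 ≤ n + 2) hiy
    simpa only [sq_abs] using this
  have ixx : Integrable (fun ω => x ω * |x ω| ^ n) μ := by
    refine ixn1.mono' (by fun_prop) (ae_of_all _ fun ω => ?_)
    rw [norm_mul, norm_pow, Real.norm_eq_abs, Real.norm_eq_abs, abs_abs, pow_succ']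
  have ind1 : IndepFun (fun ω => x ω * |x ω| ^ n) y μ :=
    hxy.comp (φ := fun t : ℝ => t * |t| ^ n) (ψ := id) (by fun_prop) measurable_id
  have ind2 : IndepFun (fun ω => |x ω| ^ n) (fun ω => y ω ^ 2) μ :=
    hxy.comp (φ := fun t : ℝ => |t| ^ n) (ψ := fun t : ℝ => t ^ 2) (by fun_prop) (by fun_prop)
  have i1 : Integrable (fun ω => x ω * |x ω| ^ n * y ω) μ := ind1.integrable_mul ixx iy1
  have i2 : Integrable (fun ω => |x ω| ^ n * y ω ^ 2) μ := ind2.integrable_mul ixn iy2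
  have e1 : ∫ ω, x ω * |x ω| ^ n * y ω ∂μ = 0 := by
    rw [ind1.integral_fun_mul_eq_mul_integral ixx.aestronglyMeasurable iy1.aestronglyMeasurable,
      hy0, mul_zero]
  have e2 : ∫ ω, |x ω| ^ n * y ω ^ 2 ∂μ = (∫ ω, |x ω| ^ n ∂μ) * ∫ ω, y ω ^ 2 ∂μ :=
    ind2.integral_fun_mul_eq_mul_integral ixn.aestronglyMeasurable iy2.aestronglyMeasurable
  have ir : Integrable (fun ω => |x ω| ^ (n + 2) + (n + 2) * (x ω * |x ω| ^ n * y ω)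
      + ((n + 2) * (n + 1) * 2 ^ n) * (|x ω| ^ n * y ω ^ 2 + |y ω| ^ (n + 2))) μ :=
    (hix.add (i1.const_mul _)).add ((i2.add hiy).const_mul _)
  have hle : ∀ ω, |x ω + y ω| ^ (n + 2) ≤ |x ω| ^ (n + 2) + (n + 2) * (x ω * |x ω| ^ n * y ω)
      + ((n + 2) * (n + 1) * 2 ^ n) * (|x ω| ^ n * y ω ^ 2 + |y ω| ^ (n + 2)) := fun ω => by
    have := abs_add_pow_le n (x ω) (y ω)
    simpa only [mul_assoc] using this
  have il : Integrable (fun ω => |x ω + y ω| ^ (n + 2)) μ := by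
    refine ir.mono' (by fun_prop) (ae_of_all _ fun ω => ?_)
    rw [Real.norm_of_nonneg (by positivity)]
    exact hle ω
  refine ⟨il, (integral_mono il ir hle).trans (le_of_eq ?_)⟩
  have ir1 : Integrable (fun ω => |x ω| ^ (n + 2) + (n + 2) * (x ω * |x ω| ^ n * y ω)) μ :=
    hix.add (i1.const_mul _)
  have ir2 : Integrable (fun ω => ((n + 2) * (n + 1) * 2 ^ n : ℝ) *
      (|x ω| ^ n * y ω ^ 2 + |y ω| ^ (n + 2))) μ := (i2.add hiy).const_mul _
  rw [integral_add ir1 ir2, integral_add hix (i1.const_mul _), integral_const_mul, integral_const_mul,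
    integral_add i2 hiy, e1, e2]
  ring

/-- A Marcinkiewicz–Zygmund type bound: weighted sums with square summable weights have bounded
moments. -/
lemma integral_abs_sum_pow_add_one_le (n : ℕ) {η : ℤ → Ω → ℝ} (hmeas : ∀ l, Measurable (η l))
    (hind : iIndepFun η μ) (hmean : ∀ l, ∫ ω, η l ω ∂μ = 0)
    (hint : ∀ l, Integrable (fun ω => |η l ω| ^ (n + 2)) μ) {m : ℝ}
    (hm : ∀ l, ∫ ω, |η l ω| ^ (n + 2) ∂μ ≤ m) (L : Finset ℤ) (a : ℤ → ℝ)
    (ha : ∀ l ∈ L, |a l| ≤ 1) :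
    Integrable (fun ω => |∑ l ∈ L, a l * η l ω| ^ (n + 2)) μ ∧
    ∫ ω, |∑ l ∈ L, a l * η l ω| ^ (n + 2) ∂μ + 1
      ≤ Real.exp (((n + 2) * (n + 1) * 2 ^ n) * (2 * (1 + m)) * ∑ l ∈ L, a l ^ 2) := by
  have hm0 : 0 ≤ m := (integral_nonneg fun ω => by positivity).trans (hm 0)
  induction L using Finset.induction_on with
  | empty => simp
  | insert l₀ L hl₀ ih =>
    obtain ⟨i1, h1⟩ := ih fun l hl => ha l (Finset.mem_insert_of_mem hl)
    have hb : |a l₀| ≤ 1 := ha l₀ (Finset.mem_insert_self _ _)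
    set x : Ω → ℝ := fun ω => ∑ l ∈ L, a l * η l ω with hx
    set y : Ω → ℝ := fun ω => a l₀ * η l₀ ω with hy
    have mx : Measurable x := by
      rw [hx]; exact Finset.measurable_fun_sum _ fun l _ => (hmeas l).const_mul _
    have my : Measurable y := (hmeas l₀).const_mul _
    have hxy : IndepFun x y μ := by
      have := (hind.comp (fun l t => a l * t) (fun l => by fun_prop)).indepFun_finsetSum_of_notMem
        (fun l => (hmeas l).const_mul (a l)) hl₀
      have e : (∑ j ∈ L, (fun t => a j * t) ∘ η j) = x := by
        ext ω; simp [hx, Finset.sum_apply]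
      rw [e] at this
      exact this
    have ey : ∀ ω, |y ω| ^ (n + 2) = |a l₀| ^ (n + 2) * |η l₀ ω| ^ (n + 2) := fun ω => by
      rw [hy, abs_mul, mul_pow]
    have iy : Integrable (fun ω => |y ω| ^ (n + 2)) μ := by
      simp only [ey]; exact (hint l₀).const_mul _
    have y0 : ∫ ω, y ω ∂μ = 0 := by rw [hy, integral_const_mul, hmean, mul_zero]
    obtain ⟨i2, h2⟩ := integral_abs_add_pow_le n mx my hxy i1 iy y0
    have es : ∀ ω, ∑ l ∈ insert l₀ L, a l * η l ω = x ω + y ω := fun ω => by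
      rw [Finset.sum_insert hl₀, add_comm]
    simp only [es]
    refine ⟨i2, ?_⟩
    rw [Finset.sum_insert hl₀]
    set b := a l₀
    set M := ∫ ω, |x ω| ^ (n + 2) ∂μ with hM
    have hM0 : 0 ≤ M := integral_nonneg fun ω => by positivity
    have b1 : ∫ ω, |x ω| ^ n ∂μ ≤ 1 + M :=
      integral_abs_pow_le_of_le mx.aestronglyMeasurable (by omega) i1
    have b2 : ∫ ω, y ω ^ 2 ∂μ ≤ b ^ 2 * (1 + m) := by
      have : ∀ ω, y ω ^ 2 = b ^ 2 * |η l₀ ω| ^ 2 := fun ω => by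
        rw [hy, sq_abs]; ring
      simp only [this, integral_const_mul]
      gcongr
      exact (integral_abs_pow_le_of_le (hmeas l₀).aestronglyMeasurable (by omega)
        (hint l₀)).trans (by linarith [hm l₀])
    have b3 : ∫ ω, |y ω| ^ (n + 2) ∂μ ≤ b ^ 2 * m := by
      simp only [ey, integral_const_mul]
      have : |b| ^ (n + 2) ≤ b ^ 2 := by
        rw [← sq_abs b]
        exact pow_le_pow_of_le_one (abs_nonneg _) hb (by omega)
      exact mul_le_mul this (hm l₀) (integral_nonneg fun ω => by positivity) (by positivity)
    set C : ℝ := (n + 2) * (n + 1) * 2 ^ n with hC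
    have hC0 : 0 ≤ C := by positivity
    have hb2 : 0 ≤ ∫ ω, y ω ^ 2 ∂μ := integral_nonneg fun ω => by positivity
    have b4 : (∫ ω, |x ω| ^ n ∂μ) * (∫ ω, y ω ^ 2 ∂μ) ≤ (1 + M) * (b ^ 2 * (1 + m)) :=
      mul_le_mul b1 b2 hb2 (by linarith)
    have b5 : b ^ 2 * m ≤ (1 + M) * (b ^ 2 * (1 + m)) := by
      have : b ^ 2 * m ≤ b ^ 2 * (1 + m) := by gcongr; linarith
      have h3 : 0 ≤ M * (b ^ 2 * (1 + m)) := by positivity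
      linarith
    -- Adding `1` absorbs the lower moment through `E|x|^n ≤ 1 + M`, so a new summand multiplies `M
    -- + 1` by at most `1 + const * b ^ 2 ≤ exp (const * b ^ 2)`, and the exponents add up.
    have b6 : ∫ ω, |x ω + y ω| ^ (n + 2) ∂μ + 1 ≤ (M + 1) * (C * (2 * (1 + m)) * b ^ 2 + 1) := by
      have := mul_le_mul_of_nonneg_left (add_le_add b4 (b3.trans b5)) hC0
      nlinarith [h2, this]
    refine b6.trans ?_
    rw [mul_add (C * (2 * (1 + m))), Real.exp_add, mul_comm (Real.exp _)]
    exact mul_le_mul h1 (Real.add_one_le_exp _) (by positivity) (Real.exp_pos _).le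

end Moments

/-- An i.i.d. sequence of centred random vectors indexed by `ℤ` whose coordinates have a finite
moment of order `S`, where `S` is at least the number of coordinates and at least `2`. -/
structure IsInnovation {Ω ι : Type*} [MeasurableSpace Ω] [Fintype ι] (μ : Measure Ω) (S : ℕ)
    (ξ : ℤ → Ω → ι → ℝ) : Prop where
  measurable : ∀ l, Measurable (ξ l)
  indep : iIndepFun ξ μ
  ident : ∀ l, IdentDistrib (ξ l) (ξ 1) μ μ
  mean : ∀ r, ∫ ω, ξ 1 ω r ∂μ = 0
  moment : ∀ r, Integrable (fun ω => |ξ 1 ω r| ^ S) μ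
  card_le : Fintype.card ι ≤ S
  two_le : 2 ≤ S

/-! ### Moments and independence for products of innovations -/

section Products

variable {Ω ι : Type*} [MeasurableSpace Ω] {μ : Measure Ω} [IsProbabilityMeasure μ] [Fintype ι]
  {S : ℕ}

lemma integrable_prod_of_moment {f : ι → Ω → ℝ} (hf : ∀ r, AEStronglyMeasurable (f r) μ)
    (hi : ∀ r, Integrable (fun ω => |f r ω| ^ S) μ) {B : Finset ι} (hB : B.card ≤ S) :
    Integrable (fun ω => ∏ r ∈ B, f r ω) μ ∧
      ∫ ω, ∏ r ∈ B, |f r ω| ∂μ ≤ 1 + ∑ r ∈ B, ∫ ω, |f r ω| ^ S ∂μ := by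
  have ir : Integrable (fun ω => 1 + ∑ r ∈ B, |f r ω| ^ S) μ :=
    (integrable_const 1).add (integrable_finsetSum _ fun r _ => hi r)
  have hle : ∀ ω, ∏ r ∈ B, |f r ω| ≤ 1 + ∑ r ∈ B, |f r ω| ^ S := fun ω =>
    prod_abs_le_one_add_sum_pow B (fun r => f r ω) hB
  have hm : AEStronglyMeasurable (fun ω => ∏ r ∈ B, f r ω) μ :=
    Finset.aestronglyMeasurable_fun_prod _ fun r _ => hf r
  have il : Integrable (fun ω => ∏ r ∈ B, f r ω) μ := by
    refine ir.mono' hm (ae_of_all _ fun ω => ?_)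
    rw [Real.norm_eq_abs, Finset.abs_prod]
    exact hle ω
  refine ⟨il, ?_⟩
  have il' : Integrable (fun ω => ∏ r ∈ B, |f r ω|) μ := by
    have := il.abs
    simpa only [Finset.abs_prod] using this
  refine (integral_mono il' ir hle).trans (le_of_eq ?_)
  rw [integral_add (integrable_const 1) (integrable_finsetSum _ fun r _ => hi r),
    integral_finsetSum _ fun r _ => hi r]
  simp

namespace IsInnovation

variable {ξ : ℤ → Ω → ι → ℝ} (h : IsInnovation μ S ξ)
include h

lemma measurable_apply (l : ℤ) (r : ι) : Measurable (fun ω => ξ l ω r) :=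
  (measurable_pi_apply r).comp (h.measurable l)

lemma integral_comp (l : ℤ) {ψ : (ι → ℝ) → ℝ} (hψ : Measurable ψ) :
    ∫ ω, ψ (ξ l ω) ∂μ = ∫ ω, ψ (ξ 1 ω) ∂μ :=
  ((h.ident l).comp hψ).integral_eq

lemma integrable_comp (l : ℤ) {ψ : (ι → ℝ) → ℝ} (hψ : Measurable ψ)
    (hi : Integrable (fun ω => ψ (ξ 1 ω)) μ) : Integrable (fun ω => ψ (ξ l ω)) μ :=
  ((h.ident l).comp hψ).integrable_iff.2 hi

lemma moment_apply (l : ℤ) (r : ι) : Integrable (fun ω => |ξ l ω r| ^ S) μ :=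
  h.integrable_comp l (ψ := fun v => |v r| ^ S) (by fun_prop) (h.moment r)

lemma mean_apply (l : ℤ) (r : ι) : ∫ ω, ξ l ω r ∂μ = 0 := by
  rw [h.integral_comp l (ψ := fun v => v r) (by fun_prop), h.mean]

lemma iIndepFun_apply (r : ι) : iIndepFun (fun l ω => ξ l ω r) μ :=
  h.indep.comp (fun _ v => v r) fun _ => measurable_pi_apply r

lemma measurable_sum (a : ℤ → ℝ) (L : Finset ℤ) (r : ι) :
    Measurable (fun ω => ∑ l ∈ L, a l * ξ l ω r) :=
  Finset.measurable_fun_sum _ fun l _ => (h.measurable_apply l r).const_mul _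

/-- Dividing the weights by `δ` makes their square sum at most `1`. Each weight is then at most `1`
in absolute value, and the exponential bound becomes a constant independent of `L` and of the
weights. -/
lemma exists_moment_sum_le : ∃ K : ℝ, 0 ≤ K ∧ ∀ (r : ι) (L : Finset ℤ) (a : ℤ → ℝ) (δ : ℝ),
    0 < δ → ∑ l ∈ L, a l ^ 2 ≤ δ ^ 2 →
    Integrable (fun ω => |∑ l ∈ L, a l * ξ l ω r| ^ S) μ ∧
    ∫ ω, |∑ l ∈ L, a l * ξ l ω r| ^ S ∂μ ≤ K * δ ^ S := by
  obtain ⟨n, rfl⟩ := Nat.exists_eq_add_of_le' h.two_le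
  set m : ℝ := ∑ r, ∫ ω, |ξ 1 ω r| ^ (n + 2) ∂μ with hm
  have hm0 : 0 ≤ m := Finset.sum_nonneg fun r _ => integral_nonneg fun ω => by positivity
  have hmr : ∀ r l, ∫ ω, |ξ l ω r| ^ (n + 2) ∂μ ≤ m := fun r l => by
    rw [h.integral_comp l (ψ := fun v => |v r| ^ (n + 2)) (by fun_prop)]
    exact Finset.single_le_sum (f := fun r => ∫ ω, |ξ 1 ω r| ^ (n + 2) ∂μ)
      (fun r _ => integral_nonneg fun ω => by positivity) (Finset.mem_univ r)
  refine ⟨Real.exp (((n + 2) * (n + 1) * 2 ^ n) * (2 * (1 + m))), (Real.exp_pos _).le,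
    fun r L a δ hδ hL => ?_⟩
  have hsum : ∑ l ∈ L, (a l / δ) ^ 2 ≤ 1 := by
    simp only [div_pow]
    rw [← Finset.sum_div]
    exact div_le_one_of_le₀ hL (by positivity)
  have ha : ∀ l ∈ L, |a l / δ| ≤ 1 := fun l hl => by
    rw [← sq_le_one_iff_abs_le_one]
    exact (Finset.single_le_sum (f := fun l => (a l / δ) ^ 2) (fun _ _ => by positivity) hl).trans
      hsum
  obtain ⟨i1, h1⟩ := integral_abs_sum_pow_add_one_le n (fun l => h.measurable_apply l r)
    (h.iIndepFun_apply r) (fun l => h.mean_apply l r) (fun l => h.moment_apply l r)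
    (hmr r) L (fun l => a l / δ) ha
  have e : ∀ ω, |∑ l ∈ L, a l * ξ l ω r| ^ (n + 2)
      = δ ^ (n + 2) * |∑ l ∈ L, a l / δ * ξ l ω r| ^ (n + 2) := fun ω => by
    have : ∑ l ∈ L, a l * ξ l ω r = δ * ∑ l ∈ L, a l / δ * ξ l ω r := by
      rw [Finset.mul_sum]
      refine Finset.sum_congr rfl fun l _ => ?_
      field_simp
    rw [this, abs_mul, mul_pow, abs_of_pos hδ]
  simp only [e]
  refine ⟨i1.const_mul _, ?_⟩
  rw [integral_const_mul, mul_comm]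
  gcongr
  refine (by linarith : _ ≤ _ + (1 : ℝ)).trans (h1.trans (Real.exp_le_exp.2 ?_))
  exact mul_le_of_le_one_right (by positivity) hsum

lemma exists_integral_prod_sum_le (Λ : ℝ) : ∃ K : ℝ, 0 ≤ K ∧
    ∀ (B : Finset ι) (L : Finset ℤ) (a : ι → ℤ → ℝ), (∀ r, ∑ l ∈ L, a r l ^ 2 ≤ Λ) →
    Integrable (fun ω => ∏ r ∈ B, ∑ l ∈ L, a r l * ξ l ω r) μ ∧
    ∫ ω, ∏ r ∈ B, |∑ l ∈ L, a r l * ξ l ω r| ∂μ ≤ K := by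
  obtain ⟨K, hK0, hK⟩ := h.exists_moment_sum_le
  refine ⟨1 + Fintype.card ι * (K * (1 + |Λ|) ^ S), by positivity, fun B L a ha => ?_⟩
  have hΛ : ∀ r, ∑ l ∈ L, a r l ^ 2 ≤ (1 + |Λ|) ^ 2 := fun r => by
    refine (ha r).trans ((le_abs_self Λ).trans ?_)
    nlinarith [abs_nonneg Λ]
  have hB : B.card ≤ S := (Finset.card_le_univ B).trans h.card_le
  obtain ⟨i1, h1⟩ := integrable_prod_of_moment (μ := μ) (S := S)
    (f := fun r ω => ∑ l ∈ L, a r l * ξ l ω r)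
    (fun r => (h.measurable_sum (a r) L r).aestronglyMeasurable)
    (fun r => (hK r L (a r) _ (by positivity) (hΛ r)).1) hB
  refine ⟨i1, h1.trans ?_⟩
  gcongr
  calc ∑ r ∈ B, ∫ ω, |∑ l ∈ L, a r l * ξ l ω r| ^ S ∂μ
      ≤ ∑ _r ∈ B, K * (1 + |Λ|) ^ S :=
        Finset.sum_le_sum fun r _ => (hK r L (a r) _ (by positivity) (hΛ r)).2
    _ = B.card * (K * (1 + |Λ|) ^ S) := by simp
    _ ≤ _ := by gcongr; exact Finset.card_le_univ B

lemma integral_finset_prod_comp (L : Finset ℤ) {ψ : ℤ → (ι → ℝ) → ℝ}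
    (hψ : ∀ l, Measurable (ψ l)) :
    ∫ ω, ∏ l ∈ L, ψ l (ξ l ω) ∂μ = ∏ l ∈ L, ∫ ω, ψ l (ξ 1 ω) ∂μ := by
  have hind : iIndepFun (fun l : L => ξ l) μ := h.indep.precomp Subtype.val_injective
  have := hind.integral_fun_prod_comp (𝕜 := ℝ) (f := fun l : L => ψ l)
    (fun l => (h.measurable l).aemeasurable) (fun l => (hψ l).aestronglyMeasurable)
  simp only [Finset.univ_eq_attach] at this
  rw [Finset.prod_attach L (fun l => ∫ ω, ψ l (ξ l ω) ∂μ)] at this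
  rw [← Finset.prod_congr rfl fun l _ => h.integral_comp l (hψ l), ← this]
  refine integral_congr_ae (ae_of_all _ fun ω => ?_)
  exact (Finset.prod_attach L (fun l => ψ l (ξ l ω))).symm

lemma integrable_finset_prod_comp (L : Finset ℤ) {ψ : ℤ → (ι → ℝ) → ℝ}
    (hψ : ∀ l, Measurable (ψ l)) (hi : ∀ l ∈ L, Integrable (fun ω => ψ l (ξ 1 ω)) μ) :
    Integrable (fun ω => ∏ l ∈ L, ψ l (ξ l ω)) μ := by
  induction L using Finset.induction_on with
  | empty => simp
  | insert l₀ L hl₀ ih =>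
    simp only [Finset.prod_insert hl₀]
    have h1 := h.integrable_comp l₀ (hψ l₀) (hi l₀ (Finset.mem_insert_self _ _))
    have h2 := ih fun l hl => hi l (Finset.mem_insert_of_mem hl)
    have hind : IndepFun (∏ l ∈ L, (ψ l) ∘ (ξ l)) ((ψ l₀) ∘ (ξ l₀)) μ :=
      (h.indep.comp ψ hψ).indepFun_finsetProd_of_notMem (fun l => (hψ l).comp (h.measurable l)) hl₀
    have e : (∏ l ∈ L, (ψ l) ∘ (ξ l)) = fun ω => ∏ l ∈ L, ψ l (ξ l ω) := by
      ext ω; simp [Finset.prod_apply]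
    rw [e] at hind
    exact hind.symm.integrable_mul h1 h2

end IsInnovation

end Products

/-! ### The Hoeffding decomposition of a product of sums -/

section Combinatorics

variable {ι : Type*} [Fintype ι] [DecidableEq ι]

/-- The coordinates that a partial assignment `g` sends to `l`. -/
def block (g : ι → Option ℤ) (l : ℤ) : Finset ι := Finset.univ.filter fun r => g r = some l

/-- The values of a partial assignment. -/
def values (g : ι → Option ℤ) : Finset ℤ := Finset.eraseNone (Finset.univ.image g)

/-- The coordinates at which a partial assignment is undefined. -/
def free (g : ι → Option ℤ) : Finset ι := Finset.univ.filter fun r => g r = none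

/-- The product of the coefficients selected by a partial assignment. -/
def weight (a : ι → ℤ → ℝ) (g : ι → Option ℤ) : ℝ := ∏ r, (g r).elim 1 (a r)

/-- The partial assignments with values in `L`. -/
def assignments (ι : Type*) [Fintype ι] [DecidableEq ι] (L : Finset ℤ) :
    Finset (ι → Option ℤ) :=
  Fintype.piFinset fun _ => Finset.insertNone L

@[simp] lemma mem_block {g : ι → Option ℤ} {l : ℤ} {r : ι} : r ∈ block g l ↔ g r = some l := by
  simp [block]

@[simp] lemma mem_values {g : ι → Option ℤ} {l : ℤ} : l ∈ values g ↔ ∃ r, g r = some l := by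
  simp [values]

@[simp] lemma mem_free {g : ι → Option ℤ} {r : ι} : r ∈ free g ↔ g r = none := by
  simp [free]

lemma mem_assignments {L : Finset ℤ} {g : ι → Option ℤ} :
    g ∈ assignments ι L ↔ ∀ r l, g r = some l → l ∈ L := by
  simp [assignments, Fintype.mem_piFinset]

lemma block_eq_empty_iff {g : ι → Option ℤ} {l : ℤ} : block g l = ∅ ↔ l ∉ values g := by
  simp [Finset.eq_empty_iff_forall_notMem]

lemma values_subset {L : Finset ℤ} {g : ι → Option ℤ} (hg : g ∈ assignments ι L) :
    values g ⊆ L := fun l hl => by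
  obtain ⟨r, hr⟩ := mem_values.1 hl
  exact mem_assignments.1 hg r l hr

lemma card_values_le (g : ι → Option ℤ) : (values g).card ≤ Fintype.card ι := by
  have h1 : (values g).card ≤ (Finset.univ.image g).card := by
    have : (values g).map Function.Embedding.some ⊆ Finset.univ.image g := by
      intro o ho
      simp only [Finset.mem_map, mem_values] at ho
      obtain ⟨l, ⟨r, hr⟩, rfl⟩ := ho
      simp only [Finset.mem_image, Finset.mem_univ, true_and]
      exact ⟨r, hr⟩
    simpa using Finset.card_le_card this
  exact h1.trans Finset.card_image_le

/-- The fibre of an assignment. -/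
def fib (f : ι → ℤ) (l : ℤ) : Finset ι := Finset.univ.filter fun r => f r = l

/-- The restriction of a full assignment to the coordinates with values in `T`. -/
def restrictTo (f : ι → ℤ) (T : Finset ℤ) : ι → Option ℤ :=
  fun r => if f r ∈ T then some (f r) else none

/-- The values that completions of a partial assignment may take. -/
def completions (L : Finset ℤ) (g : ι → Option ℤ) : Finset (ι → ℤ) :=
  Fintype.piFinset fun r => (g r).elim (L \ values g) fun l => {l}

lemma mem_completions {L : Finset ℤ} {g : ι → Option ℤ} {f : ι → ℤ} :
    f ∈ completions L g ↔ (∀ r l, g r = some l → f r = l) ∧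
      ∀ r, g r = none → f r ∈ L \ values g := by
  simp only [completions, Fintype.mem_piFinset]
  constructor
  · intro h
    refine ⟨fun r l hr => ?_, fun r hr => ?_⟩
    · have := h r; rw [hr] at this; simpa using this
    · have := h r; rw [hr] at this; simpa using this
  · rintro ⟨h1, h2⟩ r
    cases hr : g r with
    | none => simpa using h2 r hr
    | some l => simpa using h1 r l hr

lemma fib_eq_block {L : Finset ℤ} {g : ι → Option ℤ} {f : ι → ℤ} (hf : f ∈ completions L g)
    {l : ℤ} (hl : l ∈ values g) : fib f l = block g l := by
  obtain ⟨h1, h2⟩ := mem_completions.1 hf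
  ext r
  simp only [fib, Finset.mem_filter, Finset.mem_univ, true_and, mem_block]
  constructor
  · intro h
    cases hr : g r with
    | none => have := h2 r hr; rw [h] at this; exact absurd hl (Finset.mem_sdiff.1 this).2
    | some l' => rw [← h, h1 r l' hr]
  · exact h1 r l

lemma restrictTo_values {L : Finset ℤ} {g : ι → Option ℤ} {f : ι → ℤ}
    (hf : f ∈ completions L g) : restrictTo f (values g) = g := by
  obtain ⟨h1, h2⟩ := mem_completions.1 hf
  ext1 r
  simp only [restrictTo]
  cases hr : g r with
  | none => rw [if_neg (Finset.mem_sdiff.1 (h2 r hr)).2]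
  | some l => rw [if_pos (by rw [h1 r l hr]; exact mem_values.2 ⟨r, hr⟩), h1 r l hr]

lemma values_restrictTo {f : ι → ℤ} {T : Finset ℤ} (hT : ∀ l ∈ T, fib f l ≠ ∅) :
    values (restrictTo f T) = T := by
  ext l
  simp only [mem_values, restrictTo]
  constructor
  · rintro ⟨r, hr⟩
    split_ifs at hr with h
    simpa using (Option.some_injective _ hr) ▸ h
  · intro hl
    obtain ⟨r, hr⟩ := Finset.nonempty_iff_ne_empty.2 (hT l hl)
    have : f r = l := by simpa [fib] using hr
    exact ⟨r, by rw [this, if_pos hl]⟩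

lemma mem_completions_restrictTo {L T : Finset ℤ} {f : ι → ℤ} (hf : ∀ r, f r ∈ L)
    (hT : ∀ l ∈ T, fib f l ≠ ∅) : f ∈ completions L (restrictTo f T) := by
  rw [mem_completions, values_restrictTo hT]
  simp only [restrictTo]
  refine ⟨fun r l hr => ?_, fun r hr => ?_⟩
  · split_ifs at hr with h
    exact Option.some_injective _ hr
  · split_ifs at hr with h
    exact Finset.mem_sdiff.2 ⟨hf r, h⟩

/-- The deterministic coefficient of a partial assignment. -/
def freeCoeff (a : ι → ℤ → ℝ) (m : Finset ι → ℝ) (L : Finset ℤ) (g : ι → Option ℤ) : ℝ :=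
  ∑ f ∈ completions L g, (∏ r ∈ free g, a r (f r)) * ∏ l ∈ L \ values g, m (fib f l)

/-- The product is a sum over full assignments `f` of products over fibres. Each fibre product is
written as its difference from `m` plus `m`, and expanded over the set `T` of indices where the
difference is chosen. Because `m ∅ = 1`, the difference vanishes on an empty fibre, so `T` must
consist of values of `f`. Such pairs `(f, T)` correspond to a partial assignment `g` (`f` restricted
to the preimage of `T`) together with a completion of `g` that avoids the values of `g`. -/
lemma prod_sum_eq_sum_assignments (a : ι → ℤ → ℝ) (v : ℤ → ι → ℝ) (m : Finset ι → ℝ)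
    (hm : m ∅ = 1) (L : Finset ℤ) :
    ∏ r, ∑ l ∈ L, a r l * v l r = ∑ g ∈ assignments ι L, weight a g * freeCoeff a m L g *
      ∏ l ∈ L, (if block g l = ∅ then 1 else ∏ r ∈ block g l, v l r - m (block g l)) := by
  set t : (ι → ℤ) × Finset ℤ → ℝ := fun x => (∏ r, a r (x.1 r)) *
    ((∏ l ∈ x.2, (∏ r ∈ fib x.1 l, v l r - m (fib x.1 l))) * ∏ l ∈ L \ x.2, m (fib x.1 l)) with ht
  have step1 : ∏ r, ∑ l ∈ L, a r l * v l r
      = ∑ x ∈ Fintype.piFinset (fun _ : ι => L) ×ˢ L.powerset, t x := by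
    rw [Finset.prod_univ_sum, Finset.sum_product]
    refine Finset.sum_congr rfl fun f hf => ?_
    rw [Fintype.mem_piFinset] at hf
    simp only [ht]
    rw [← Finset.mul_sum, ← Finset.prod_add, Finset.prod_mul_distrib]
    congr 1
    simp only [sub_add_cancel]
    rw [← Finset.prod_fiberwise_of_maps_to (s := Finset.univ) (t := L) (g := f) fun r _ => hf r]
    refine Finset.prod_congr rfl fun l _ => Finset.prod_congr rfl fun r hr => ?_
    rw [(Finset.mem_filter.1 hr).2]
  have step2 : ∑ x ∈ Fintype.piFinset (fun _ : ι => L) ×ˢ L.powerset, t x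
      = ∑ x ∈ (Fintype.piFinset (fun _ : ι => L) ×ˢ L.powerset).filter
          (fun x => ∀ l ∈ x.2, fib x.1 l ≠ ∅), t x := by
    symm
    refine Finset.sum_filter_of_ne fun x _ hx l hl hfl => hx ?_
    simp only [ht]
    rw [Finset.prod_eq_zero hl (by rw [hfl, hm]; simp)]
    ring
  rw [step1, step2, ← Finset.sum_fiberwise_of_maps_to (t := assignments ι L)
    (g := fun x => restrictTo x.1 x.2)]
  · refine Finset.sum_congr rfl fun g hg => ?_
    have step3 : ∑ x ∈ ((Fintype.piFinset (fun _ : ι => L) ×ˢ L.powerset).filter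
          (fun x => ∀ l ∈ x.2, fib x.1 l ≠ ∅)).filter (fun x => restrictTo x.1 x.2 = g), t x
        = ∑ f ∈ completions L g, t (f, values g) := by
      refine Finset.sum_bij' (fun x _ => x.1) (fun f _ => (f, values g)) ?_ ?_ ?_ ?_ ?_
      · intro x hx
        simp only [Finset.mem_filter, Finset.mem_product, Fintype.mem_piFinset] at hx
        rw [← hx.2]
        exact mem_completions_restrictTo hx.1.1.1 hx.1.2
      · intro f hf
        simp only [Finset.mem_filter, Finset.mem_product, Fintype.mem_piFinset,
          Finset.mem_powerset]
        refine ⟨⟨⟨fun r => ?_, values_subset hg⟩, fun l hl => ?_⟩, restrictTo_values hf⟩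
        · obtain ⟨h1, h2⟩ := mem_completions.1 hf
          cases hr : g r with
          | none => exact (Finset.mem_sdiff.1 (h2 r hr)).1
          | some l => rw [h1 r l hr]; exact mem_assignments.1 hg r l hr
        · rw [fib_eq_block hf hl, Ne, block_eq_empty_iff]; simpa using hl
      · intro x hx
        simp only [Finset.mem_filter] at hx
        have : values g = x.2 := by rw [← hx.2, values_restrictTo hx.1.2]
        rw [this]
      · intro f _; rfl
      · intro x hx
        simp only [Finset.mem_filter] at hx
        have : values g = x.2 := by rw [← hx.2, values_restrictTo hx.1.2]
        rw [this]
    rw [step3, freeCoeff, Finset.mul_sum, Finset.sum_mul]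
    refine Finset.sum_congr rfl fun f hf => ?_
    obtain ⟨h1, h2⟩ := mem_completions.1 hf
    have e1 : ∏ r, a r (f r) = weight a g * ∏ r ∈ free g, a r (f r) := by
      rw [weight, free, Finset.prod_filter, ← Finset.prod_mul_distrib]
      refine Finset.prod_congr rfl fun r _ => ?_
      cases hr : g r with
      | none => simp
      | some l => simp [h1 r l hr]
    have e2 : ∏ l ∈ L, (if block g l = ∅ then 1 else ∏ r ∈ block g l, v l r - m (block g l))
        = ∏ l ∈ values g, (∏ r ∈ fib f l, v l r - m (fib f l)) := by
      rw [← Finset.prod_subset (values_subset hg)]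
      · refine Finset.prod_congr rfl fun l hl => ?_
        rw [fib_eq_block hf hl, if_neg]
        rw [block_eq_empty_iff]; simpa using hl
      · intro l _ hl
        rw [if_pos (block_eq_empty_iff.2 hl)]
    simp only [ht]
    rw [e1, e2]
    ring
  · intro x hx
    simp only [Finset.mem_filter, Finset.mem_product, Finset.mem_powerset] at hx
    rw [mem_assignments]
    intro r l hr
    simp only [restrictTo] at hr
    split_ifs at hr with h
    rw [← Option.some_injective _ hr]
    exact hx.1.2 h

end Combinatorics

section Decomposition

variable {Ω ι : Type*} [MeasurableSpace Ω] {μ : Measure Ω} [IsProbabilityMeasure μ] [Fintype ι]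
  [DecidableEq ι] {S : ℕ} {ξ : ℤ → Ω → ι → ℝ}

namespace IsInnovation

variable (h : IsInnovation μ S ξ)
include h

lemma integrable_prod_apply (A : Finset ι) : Integrable (fun ω => ∏ r ∈ A, ξ 1 ω r) μ :=
  (integrable_prod_of_moment (f := fun r ω => ξ 1 ω r)
    (fun r => (h.measurable_apply 1 r).aestronglyMeasurable) h.moment
    ((Finset.card_le_univ A).trans h.card_le)).1

/-- Independence lets the combinatorial sum be folded back into the expectation of a product of
linear sums from which the indices used by `g` are removed. In this form moment bounds apply to the
coefficient, and its vanishing becomes visible. -/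
lemma freeCoeff_eq_integral (a : ι → ℤ → ℝ) (L : Finset ℤ) (g : ι → Option ℤ) :
    freeCoeff a (fun A => ∫ ω, ∏ r ∈ A, ξ 1 ω r ∂μ) L g
      = ∫ ω, ∏ r ∈ free g, ∑ l ∈ L \ values g, a r l * ξ l ω r ∂μ := by
  have e1 : ∀ ω, ∏ r ∈ free g, ∑ l ∈ L \ values g, a r l * ξ l ω r
      = ∑ f ∈ completions L g, (∏ r ∈ free g, a r (f r)) *
          ∏ l ∈ L \ values g, ∏ r ∈ fib f l, ξ l ω r := fun ω => by
    have e : ∏ r ∈ free g, ∑ l ∈ L \ values g, a r l * ξ l ω r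
        = ∏ r, ∑ l ∈ (g r).elim (L \ values g) (fun l => {l}),
            if g r = none then a r l * ξ l ω r else 1 := by
      rw [free, Finset.prod_filter]
      refine Finset.prod_congr rfl fun r _ => ?_
      cases hr : g r <;> simp
    rw [e, Finset.prod_univ_sum]
    refine Finset.sum_congr rfl fun f hf => ?_
    obtain ⟨h1, h2⟩ := mem_completions.1 hf
    have e3 : ∏ l ∈ L \ values g, ∏ r ∈ fib f l, ξ l ω r = ∏ r ∈ free g, ξ (f r) ω r := by
      rw [← Finset.prod_fiberwise_of_maps_to (s := free g) (t := L \ values g) (g := f)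
        fun r hr => h2 r (mem_free.1 hr)]
      refine Finset.prod_congr rfl fun l hl => ?_
      have : fib f l = (free g).filter (fun r => f r = l) := by
        ext r
        simp only [fib, Finset.mem_filter, Finset.mem_univ, true_and, mem_free]
        refine ⟨fun hr => ⟨?_, hr⟩, fun hr => hr.2⟩
        cases hgr : g r with
        | none => rfl
        | some l' =>
          have := h1 r l' hgr
          exact absurd (mem_values.2 ⟨r, by rw [hgr, ← this, hr]⟩) (Finset.mem_sdiff.1 hl).2
      rw [this]
      refine Finset.prod_congr rfl fun r hr => ?_
      rw [(Finset.mem_filter.1 hr).2]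
    rw [e3, ← Finset.prod_mul_distrib, free, Finset.prod_filter]
  have hψ : ∀ f : ι → ℤ, ∀ l, Measurable (fun v : ι → ℝ => ∏ r ∈ fib f l, v r) := fun f l =>
    Finset.measurable_fun_prod _ fun r _ => measurable_pi_apply r
  simp only [e1]
  rw [integral_finsetSum]
  · refine Finset.sum_congr rfl fun f _ => ?_
    rw [integral_const_mul]
    congr 1
    exact (h.integral_finset_prod_comp (L \ values g) (hψ f)).symm
  · intro f _
    refine Integrable.const_mul ?_ _
    exact h.integrable_finset_prod_comp (L \ values g) (hψ f) fun l _ =>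
      h.integrable_prod_apply _

end IsInnovation

/-! ### A variance bound for the decomposition -/

/-- The product over `l ∈ L` of the block functionals selected by `g`. -/
def blockProd (φ : Finset ι → (ι → ℝ) → ℝ) (ξ : ℤ → Ω → ι → ℝ) (L : Finset ℤ)
    (g : ι → Option ℤ) (ω : Ω) : ℝ := ∏ l ∈ L, φ (block g l) (ξ l ω)

namespace IsInnovation

variable (h : IsInnovation μ S ξ)
include h

lemma measurable_blockProd {φ : Finset ι → (ι → ℝ) → ℝ} (hφ : ∀ A, Measurable (φ A))
    (L : Finset ℤ) (g : ι → Option ℤ) : Measurable (blockProd φ ξ L g) :=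
  Finset.measurable_fun_prod _ fun l _ => (hφ _).comp (h.measurable l)

lemma integrable_blockProd_mul {φ : Finset ι → (ι → ℝ) → ℝ} (hφ : ∀ A, Measurable (φ A))
    (hφ2 : ∀ A, Integrable (fun ω => φ A (ξ 1 ω) ^ 2) μ) (L : Finset ℤ) (g g' : ι → Option ℤ) :
    Integrable (fun ω => blockProd φ ξ L g ω * blockProd φ ξ L g' ω) μ := by
  simp only [blockProd, ← Finset.prod_mul_distrib]
  refine h.integrable_finset_prod_comp L (ψ := fun l v => φ (block g l) v * φ (block g' l) v)
    (fun l => (hφ _).mul (hφ _)) fun l _ => ?_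
  refine ((hφ2 (block g l)).add (hφ2 (block g' l))).mono'
    (((hφ _).comp (h.measurable 1)).mul ((hφ _).comp (h.measurable 1))).aestronglyMeasurable
    (ae_of_all _ fun ω => ?_)
  rw [norm_mul, Real.norm_eq_abs, Real.norm_eq_abs]
  simp only [Pi.add_apply]
  rw [← sq_abs (φ (block g l) _), ← sq_abs (φ (block g' l) _)]
  nlinarith [sq_nonneg (|φ (block g l) (ξ 1 ω)| - |φ (block g' l) (ξ 1 ω)|),
    sq_nonneg (|φ (block g l) (ξ 1 ω)|), sq_nonneg (|φ (block g' l) (ξ 1 ω)|)]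

/-- At an index used by only one of `g`, `g'` the factor is a single centred functional, independent
of all the others. -/
lemma integral_blockProd_mul_eq_zero {φ : Finset ι → (ι → ℝ) → ℝ} (hφ : ∀ A, Measurable (φ A))
    (hφ0 : ∀ A, A ≠ ∅ → ∫ ω, φ A (ξ 1 ω) ∂μ = 0) (hφ1 : φ ∅ = 1) {L : Finset ℤ}
    {g g' : ι → Option ℤ} {l : ℤ} (hl : l ∈ L) (hne : ¬ (l ∈ values g ↔ l ∈ values g')) :
    ∫ ω, blockProd φ ξ L g ω * blockProd φ ξ L g' ω ∂μ = 0 := by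
  simp only [blockProd, ← Finset.prod_mul_distrib]
  rw [h.integral_finset_prod_comp L (ψ := fun l v => φ (block g l) v * φ (block g' l) v)
    (fun l => (hφ _).mul (hφ _))]
  refine Finset.prod_eq_zero hl ?_
  by_cases hg : l ∈ values g
  · have hg' : l ∉ values g' := fun hg' => hne ⟨fun _ => hg', fun _ => hg⟩
    rw [block_eq_empty_iff.2 hg', hφ1]
    simp only [Pi.one_apply, mul_one]
    exact hφ0 _ (by rw [Ne, block_eq_empty_iff]; simpa using hg)
  · have hg' : l ∈ values g' := by by_contra hg'; exact hne ⟨fun h => absurd h hg,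
      fun h => absurd h hg'⟩
    rw [block_eq_empty_iff.2 hg, hφ1]
    simp only [Pi.one_apply, one_mul]
    exact hφ0 _ (by rw [Ne, block_eq_empty_iff]; simpa using hg')

lemma integral_blockProd_sq {φ : Finset ι → (ι → ℝ) → ℝ} (hφ : ∀ A, Measurable (φ A))
    (L : Finset ℤ) (g : ι → Option ℤ) :
    ∫ ω, blockProd φ ξ L g ω ^ 2 ∂μ = ∏ l ∈ L, ∫ ω, φ (block g l) (ξ 1 ω) ^ 2 ∂μ := by
  simp only [blockProd, ← Finset.prod_pow]
  exact h.integral_finset_prod_comp L (ψ := fun l v => φ (block g l) v ^ 2)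
    (fun l => (hφ _).pow_const 2)

/-- Only pairs with equal value sets contribute; each of these cross terms is at most the mean of
the two diagonal ones, and the number of assignments sharing a value set is bounded. The hypothesis
`hG` asks only that different value sets differ inside `L`, so that the lemma also applies after one
common index has been erased from `L`. -/
lemma integral_sq_sum_blockProd_le {φ : Finset ι → (ι → ℝ) → ℝ} (hφ : ∀ A, Measurable (φ A))
    (hφ2 : ∀ A, Integrable (fun ω => φ A (ξ 1 ω) ^ 2) μ)
    (hφ0 : ∀ A, A ≠ ∅ → ∫ ω, φ A (ξ 1 ω) ∂μ = 0) (hφ1 : φ ∅ = 1) {L : Finset ℤ}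
    {G : Finset (ι → Option ℤ)}
    (hG : ∀ g ∈ G, ∀ g' ∈ G, values g ≠ values g' →
      ∃ l ∈ L, ¬ (l ∈ values g ↔ l ∈ values g')) (b : (ι → Option ℤ) → ℝ) :
    Integrable (fun ω => (∑ g ∈ G, b g * blockProd φ ξ L g ω) ^ 2) μ ∧
    ∫ ω, (∑ g ∈ G, b g * blockProd φ ξ L g ω) ^ 2 ∂μ
      ≤ (Fintype.card ι + 1) ^ Fintype.card ι *
        ∑ g ∈ G, b g ^ 2 * ∫ ω, blockProd φ ξ L g ω ^ 2 ∂μ := by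
  set u : (ι → Option ℤ) → ℝ := fun g => b g ^ 2 * ∫ ω, blockProd φ ξ L g ω ^ 2 ∂μ with hu
  have hu0 : ∀ g, 0 ≤ u g := fun g =>
    mul_nonneg (sq_nonneg _) (integral_nonneg fun ω => sq_nonneg _)
  have hint : ∀ g g', Integrable (fun ω => (b g * b g') *
      (blockProd φ ξ L g ω * blockProd φ ξ L g' ω)) μ := fun g g' =>
    (h.integrable_blockProd_mul hφ hφ2 L g g').const_mul _
  have e1 : ∀ ω, (∑ g ∈ G, b g * blockProd φ ξ L g ω) ^ 2
      = ∑ g ∈ G, ∑ g' ∈ G, (b g * b g') * (blockProd φ ξ L g ω * blockProd φ ξ L g' ω) :=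
    fun ω => by
      rw [sq, Finset.sum_mul_sum]
      refine Finset.sum_congr rfl fun g _ => Finset.sum_congr rfl fun g' _ => by ring
  simp only [e1]
  refine ⟨integrable_finsetSum _ fun g _ => integrable_finsetSum _ fun g' _ => hint g g', ?_⟩
  rw [integral_finsetSum _ fun g _ => integrable_finsetSum _ fun g' _ => hint g g']
  have e2 : ∀ g ∈ G, ∫ ω, ∑ g' ∈ G, (b g * b g') *
      (blockProd φ ξ L g ω * blockProd φ ξ L g' ω) ∂μ
      ≤ ∑ g' ∈ G, if values g = values g' then (u g + u g') / 2 else 0 := by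
    intro g hg
    rw [integral_finsetSum _ fun g' _ => hint g g']
    refine Finset.sum_le_sum fun g' hg' => ?_
    rw [integral_const_mul]
    split_ifs with hv
    · have i1 : Integrable (fun ω => b g ^ 2 * blockProd φ ξ L g ω ^ 2) μ := by
        have := h.integrable_blockProd_mul hφ hφ2 L g g
        simp only [← sq] at this
        exact this.const_mul _
      have i2 : Integrable (fun ω => b g' ^ 2 * blockProd φ ξ L g' ω ^ 2) μ := by
        have := h.integrable_blockProd_mul hφ hφ2 L g' g'
        simp only [← sq] at this
        exact this.const_mul _
      have e3 : (u g + u g') / 2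
          = ∫ ω, (b g ^ 2 * blockProd φ ξ L g ω ^ 2 + b g' ^ 2 * blockProd φ ξ L g' ω ^ 2) / 2 ∂μ := by
        rw [integral_div, integral_add i1 i2, integral_const_mul, integral_const_mul]
      rw [← integral_const_mul, e3]
      refine integral_mono (hint g g') ((i1.add i2).div_const 2) fun ω => ?_
      show b g * b g' * (blockProd φ ξ L g ω * blockProd φ ξ L g' ω) ≤
        (b g ^ 2 * blockProd φ ξ L g ω ^ 2 + b g' ^ 2 * blockProd φ ξ L g' ω ^ 2) / 2
      nlinarith [sq_nonneg (b g * blockProd φ ξ L g ω - b g' * blockProd φ ξ L g' ω)]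
    · obtain ⟨l, hl, hne⟩ := hG g hg g' hg' hv
      rw [h.integral_blockProd_mul_eq_zero hφ hφ0 hφ1 hl hne, mul_zero]
  refine (Finset.sum_le_sum e2).trans ?_
  have hcard : ∀ g : ι → Option ℤ, ((G.filter fun g' => values g = values g').card : ℝ)
      ≤ (Fintype.card ι + 1) ^ Fintype.card ι := by
    intro g
    have h1 : (G.filter fun g' => values g = values g') ⊆ assignments ι (values g) := by
      intro g' hg'
      rw [mem_assignments]
      intro r l hr
      rw [(Finset.mem_filter.1 hg').2]
      exact mem_values.2 ⟨r, hr⟩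
    have h2 : (assignments ι (values g)).card
        ≤ (Fintype.card ι + 1) ^ Fintype.card ι := by
      rw [assignments, Fintype.card_piFinset]
      -- Each coordinate picks one of at most `card ι` values or `none`.
      simp only [Finset.card_insertNone, Finset.prod_const, Finset.card_univ]
      exact Nat.pow_le_pow_left (by have := card_values_le g; omega) _
    exact_mod_cast (Finset.card_le_card h1).trans h2
  have e4 : ∑ g ∈ G, ∑ g' ∈ G, (if values g = values g' then (u g + u g') / 2 else 0)
      = ∑ g ∈ G, u g * ((G.filter fun g' => values g = values g').card : ℝ) := by
    have e5 : ∀ g g' : ι → Option ℤ, (if values g = values g' then (u g + u g') / 2 else 0)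
        = (if values g = values g' then u g / 2 else 0)
          + (if values g' = values g then u g' / 2 else 0) := by
      intro g g'
      by_cases hv : values g = values g'
      · simp only [hv, if_true]; ring
      · rw [if_neg hv, if_neg hv, if_neg (Ne.symm hv)]; ring
    simp only [e5, Finset.sum_add_distrib]
    rw [Finset.sum_comm (f := fun g g' => if values g' = values g then u g' / 2 else 0),
      ← Finset.sum_add_distrib]
    refine Finset.sum_congr rfl fun g _ => ?_
    rw [← Finset.sum_filter, Finset.sum_const, nsmul_eq_mul]
    ring
  rw [e4, Finset.mul_sum]
  refine Finset.sum_le_sum fun g _ => ?_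
  rw [mul_comm]
  exact mul_le_mul_of_nonneg_right (hcard g) (hu0 g)

end IsInnovation

end Decomposition

/-! ### Truncated block functionals -/

/-- Truncation at level `T`. -/
def trunc (T x : ℝ) : ℝ := if |x| ≤ T then x else 0

lemma measurable_trunc (T : ℝ) : Measurable (trunc T) :=
  Measurable.ite (measurableSet_le (by fun_prop) measurable_const) measurable_id measurable_const

lemma abs_trunc_le_abs (T x : ℝ) : |trunc T x| ≤ |x| := by
  unfold trunc; split_ifs <;> simp

lemma trunc_sq_le {T q : ℝ} (hT : 0 < T) (hq : q ≤ 2) (x : ℝ) :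
    trunc T x ^ 2 ≤ T ^ (2 - q) * |x| ^ q := by
  unfold trunc
  split_ifs with h
  · rcases eq_or_ne x 0 with rfl | hx
    · simp; positivity
    · have hx' : 0 < |x| := abs_pos.2 hx
      calc x ^ 2 = |x| ^ (2 - q) * |x| ^ q := by
            rw [← Real.rpow_add hx', ← sq_abs]; simp
        _ ≤ _ := by gcongr
  · simp; positivity

lemma abs_sub_trunc_le {T q : ℝ} (hT : 0 < T) (hq0 : 1 ≤ q) (x : ℝ) :
    |x - trunc T x| ≤ T ^ (1 - q) * |x| ^ q := by
  unfold trunc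
  split_ifs with h
  · simp; positivity
  · push Not at h
    have hx' : 0 < |x| := hT.trans h
    calc |x - 0| = |x| ^ (1 - q) * |x| ^ q := by
          rw [← Real.rpow_add hx']; simp
      _ ≤ _ := by
          gcongr ?_ * _
          exact Real.rpow_le_rpow_of_nonpos hT h.le (by linarith)

section Functionals

variable {Ω ι : Type*} [MeasurableSpace Ω] {μ : Measure Ω} [IsProbabilityMeasure μ] [Fintype ι]
  [DecidableEq ι] {S : ℕ} {ξ : ℤ → Ω → ι → ℝ}

/-- The centred product of the coordinates in a block. -/
def centredBlock (μ : Measure Ω) (ξ : ℤ → Ω → ι → ℝ) (A : Finset ι) (v : ι → ℝ) : ℝ :=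
  if A = ∅ then 1 else ∏ r ∈ A, v r - ∫ ω, ∏ r ∈ A, ξ 1 ω r ∂μ

/-- The centred product of the coordinates in a block, truncated at level `T` beforehand if the
block has more than `S / 2` elements. -/
def truncBlock (μ : Measure Ω) (S : ℕ) (ξ : ℤ → Ω → ι → ℝ) (T : ℝ) (A : Finset ι) (v : ι → ℝ) :
    ℝ :=
  if S < 2 * A.card then trunc T (∏ r ∈ A, v r) - ∫ ω, trunc T (∏ r ∈ A, ξ 1 ω r) ∂μ
  else centredBlock μ ξ A v

lemma truncBlock_of_le {A : Finset ι} (hA : ¬ S < 2 * A.card) (T : ℝ) :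
    truncBlock μ S ξ T A = centredBlock μ ξ A := by
  ext v; simp [truncBlock, hA]

lemma measurable_prod_eval (A : Finset ι) : Measurable fun v : ι → ℝ => ∏ r ∈ A, v r :=
  Finset.measurable_fun_prod _ fun r _ => measurable_pi_apply r

lemma measurable_centredBlock (A : Finset ι) : Measurable (centredBlock μ ξ A) := by
  unfold centredBlock
  split_ifs
  · exact measurable_const
  · exact (measurable_prod_eval A).sub_const _

lemma measurable_truncBlock (T : ℝ) (A : Finset ι) : Measurable (truncBlock μ S ξ T A) := by
  unfold truncBlock
  split_ifs
  · exact ((measurable_trunc T).comp (measurable_prod_eval A)).sub_const _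
  · exact measurable_centredBlock A

lemma truncBlock_empty (T : ℝ) : truncBlock μ S ξ T ∅ = 1 := by
  ext v; simp [truncBlock, centredBlock]

namespace IsInnovation

variable (h : IsInnovation μ S ξ)
include h

lemma measurable_prod_apply (A : Finset ι) : Measurable (fun ω => ∏ r ∈ A, ξ 1 ω r) :=
  (measurable_prod_eval A).comp (h.measurable 1)

lemma integrable_trunc (T : ℝ) (A : Finset ι) :
    Integrable (fun ω => trunc T (∏ r ∈ A, ξ 1 ω r)) μ :=
  (h.integrable_prod_apply A).mono
    ((measurable_trunc T).comp (h.measurable_prod_apply A)).aestronglyMeasurable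
    (ae_of_all _ fun ω => by simpa only [Real.norm_eq_abs] using abs_trunc_le_abs T _)

/-- The square of a light block is a product of at most `S / 2` variables, each with a finite moment
of order `S / 2`. -/
lemma integrable_prod_sq {A : Finset ι} (hA : ¬ S < 2 * A.card) :
    Integrable (fun ω => (∏ r ∈ A, ξ 1 ω r) ^ 2) μ := by
  have h1 : ∀ r, Integrable (fun ω => |ξ 1 ω r ^ 2| ^ (S / 2)) μ := fun r => by
    have := integrable_abs_pow_of_le (h.measurable_apply 1 r).aestronglyMeasurable
      (Nat.mul_div_le S 2) (h.moment r)
    simpa only [abs_pow, pow_mul] using this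
  have h2 := (integrable_prod_of_moment (μ := μ) (S := S / 2) (f := fun r ω => ξ 1 ω r ^ 2)
    (fun r => ((h.measurable_apply 1 r).pow_const 2).aestronglyMeasurable) h1
    (B := A) (by omega)).1
  simpa only [Finset.prod_pow] using h2

lemma integral_truncBlock (T : ℝ) {A : Finset ι} (hA : A ≠ ∅) :
    ∫ ω, truncBlock μ S ξ T A (ξ 1 ω) ∂μ = 0 := by
  unfold truncBlock centredBlock
  split_ifs
  · rw [integral_sub (h.integrable_trunc T A) (integrable_const _)]; simp
  · rw [integral_sub (h.integrable_prod_apply A) (integrable_const _)]; simp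

lemma integral_sub_sq_le {Y : Ω → ℝ} (hY : Measurable Y)
    (hY2 : Integrable (fun ω => Y ω ^ 2) μ) :
    Integrable (fun ω => (Y ω - ∫ ω', Y ω' ∂μ) ^ 2) μ ∧
    ∫ ω, (Y ω - ∫ ω', Y ω' ∂μ) ^ 2 ∂μ ≤ ∫ ω, Y ω ^ 2 ∂μ := by
  have hm : MemLp Y 2 μ := (memLp_two_iff_integrable_sq hY.aestronglyMeasurable).2 hY2
  refine ⟨(memLp_two_iff_integrable_sq (hY.sub_const _).aestronglyMeasurable).1
    (hm.sub (memLp_const _)), ?_⟩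
  have := variance_le_expectation_sq (μ := μ) hY.aestronglyMeasurable
  rw [variance_eq_integral hY.aemeasurable] at this
  simpa using this

/-- For a heavy block the moment of order `q` is interpolated with the level `T`, upwards for the
second moment and downwards for the truncation error. The constant has the form `V ^ A.card` so that
empty blocks cost exactly `1`; products over `L` then stay bounded whatever the size of `L`. -/
lemma exists_truncBlock_le {q : ℝ} (hq1 : 1 ≤ q) (hq2 : q ≤ 2)
    (hheavy : ∀ A : Finset ι, S < 2 * A.card →
      Integrable (fun ω => |∏ r ∈ A, ξ 1 ω r| ^ q) μ) :
    ∃ V : ℝ, 1 ≤ V ∧ ∀ T : ℝ, 1 ≤ T → ∀ A : Finset ι,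
      Integrable (fun ω => truncBlock μ S ξ T A (ξ 1 ω) ^ 2) μ ∧
      (∫ ω, truncBlock μ S ξ T A (ξ 1 ω) ^ 2 ∂μ
        ≤ V ^ A.card * if S < 2 * A.card then T ^ (2 - q) else 1) ∧
      Integrable (fun ω => centredBlock μ ξ A (ξ 1 ω) - truncBlock μ S ξ T A (ξ 1 ω)) μ ∧
      ∫ ω, |centredBlock μ ξ A (ξ 1 ω) - truncBlock μ S ξ T A (ξ 1 ω)| ∂μ
        ≤ 2 * V * T ^ (1 - q) := by
  -- Some of these integrals may diverge and then have value `0`; for each `A` only the one known to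
  -- converge is used, and the other only has to be nonnegative.
  set V : ℝ := 1 + ∑ A : Finset ι, (∫ ω, (∏ r ∈ A, ξ 1 ω r) ^ 2 ∂μ
    + ∫ ω, |∏ r ∈ A, ξ 1 ω r| ^ q ∂μ) with hV
  have p1 : ∀ A : Finset ι, 0 ≤ ∫ ω, (∏ r ∈ A, ξ 1 ω r) ^ 2 ∂μ := fun A =>
    integral_nonneg fun ω => sq_nonneg _
  have p2 : ∀ A : Finset ι, 0 ≤ ∫ ω, |∏ r ∈ A, ξ 1 ω r| ^ q ∂μ := fun A =>
    integral_nonneg fun ω => by positivity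
  have hV1 : 1 ≤ V := by
    rw [hV]
    linarith [Finset.sum_nonneg fun A (_ : A ∈ Finset.univ) => add_nonneg (p1 A) (p2 A)]
  have hle : ∀ A : Finset ι, ∫ ω, (∏ r ∈ A, ξ 1 ω r) ^ 2 ∂μ
      + ∫ ω, |∏ r ∈ A, ξ 1 ω r| ^ q ∂μ ≤ V := fun A => by
    have := Finset.single_le_sum (f := fun A : Finset ι => ∫ ω, (∏ r ∈ A, ξ 1 ω r) ^ 2 ∂μ
      + ∫ ω, |∏ r ∈ A, ξ 1 ω r| ^ q ∂μ) (fun A _ => add_nonneg (p1 A) (p2 A)) (Finset.mem_univ A)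
    rw [hV]
    linarith
  have hVA : ∀ A : Finset ι, A ≠ ∅ → V ≤ V ^ A.card := fun A hA =>
    le_self_pow₀ hV1 (Finset.card_ne_zero.2 (Finset.nonempty_iff_ne_empty.2 hA))
  refine ⟨V, hV1, fun T hT A => ?_⟩
  have hT0 : 0 < T := by linarith
  by_cases hA : S < 2 * A.card
  · have hne : A ≠ ∅ := by rintro rfl; simp at hA
    have mt : Measurable (fun ω => trunc T (∏ r ∈ A, ξ 1 ω r)) :=
      (measurable_trunc T).comp (h.measurable_prod_apply A)
    have it2 : Integrable (fun ω => trunc T (∏ r ∈ A, ξ 1 ω r) ^ 2) μ := by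
      refine ((hheavy A hA).const_mul (T ^ (2 - q))).mono' (mt.pow_const 2).aestronglyMeasurable
        (ae_of_all _ fun ω => ?_)
      rw [Real.norm_of_nonneg (sq_nonneg _)]
      exact trunc_sq_le hT0 hq2 _
    have e1 : ∀ ω, truncBlock μ S ξ T A (ξ 1 ω) = trunc T (∏ r ∈ A, ξ 1 ω r)
        - ∫ ω', trunc T (∏ r ∈ A, ξ 1 ω' r) ∂μ := fun ω => by simp [truncBlock, hA]
    have e2 : ∀ ω, centredBlock μ ξ A (ξ 1 ω) = ∏ r ∈ A, ξ 1 ω r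
        - ∫ ω', ∏ r ∈ A, ξ 1 ω' r ∂μ := fun ω => by simp [centredBlock, hne]
    simp only [e1, e2, if_pos hA]
    obtain ⟨i1, l1⟩ := h.integral_sub_sq_le mt it2
    have id1 : Integrable (fun ω => ∏ r ∈ A, ξ 1 ω r - trunc T (∏ r ∈ A, ξ 1 ω r)) μ :=
      (h.integrable_prod_apply A).sub (h.integrable_trunc T A)
    set D : Ω → ℝ := fun ω => ∏ r ∈ A, ξ 1 ω r - trunc T (∏ r ∈ A, ξ 1 ω r) with hD
    have e3 : ∀ ω, (∏ r ∈ A, ξ 1 ω r - ∫ ω', ∏ r ∈ A, ξ 1 ω' r ∂μ)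
        - (trunc T (∏ r ∈ A, ξ 1 ω r) - ∫ ω', trunc T (∏ r ∈ A, ξ 1 ω' r) ∂μ)
        = D ω - ∫ ω', D ω' ∂μ := fun ω => by
      rw [hD, integral_sub (h.integrable_prod_apply A) (h.integrable_trunc T A)]; ring
    have hDle : ∫ ω, |D ω| ∂μ ≤ V * T ^ (1 - q) := by
      calc ∫ ω, |D ω| ∂μ ≤ ∫ ω, T ^ (1 - q) * |∏ r ∈ A, ξ 1 ω r| ^ q ∂μ :=
            integral_mono id1.abs ((hheavy A hA).const_mul _) fun ω => abs_sub_trunc_le hT0 hq1 _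
        _ = T ^ (1 - q) * ∫ ω, |∏ r ∈ A, ξ 1 ω r| ^ q ∂μ := integral_const_mul _ _
        _ ≤ T ^ (1 - q) * V := by gcongr; linarith [hle A, p1 A]
        _ = _ := mul_comm _ _
    simp only [e3]
    refine ⟨i1, ?_, id1.sub (integrable_const _), ?_⟩
    · calc _ ≤ _ := l1
        _ ≤ ∫ ω, T ^ (2 - q) * |∏ r ∈ A, ξ 1 ω r| ^ q ∂μ :=
            integral_mono it2 ((hheavy A hA).const_mul _) fun ω => trunc_sq_le hT0 hq2 _
        _ = T ^ (2 - q) * ∫ ω, |∏ r ∈ A, ξ 1 ω r| ^ q ∂μ := integral_const_mul _ _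
        _ ≤ T ^ (2 - q) * V ^ A.card := by
            gcongr; linarith [hle A, p1 A, hVA A hne]
        _ = _ := mul_comm _ _
    · calc ∫ ω, |D ω - ∫ ω', D ω' ∂μ| ∂μ ≤ ∫ ω, (|D ω| + |∫ ω', D ω' ∂μ|) ∂μ :=
            integral_mono (id1.sub (integrable_const _)).abs
              (id1.abs.add (integrable_const _)) fun ω => abs_sub _ _
        _ = ∫ ω, |D ω| ∂μ + |∫ ω', D ω' ∂μ| := by
            rw [integral_add id1.abs (integrable_const _)]; simp
        _ ≤ ∫ ω, |D ω| ∂μ + ∫ ω, |D ω| ∂μ := by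
            gcongr; exact abs_integral_le_integral_abs
        _ ≤ _ := by linarith
  · rw [truncBlock_of_le hA]
    simp only [sub_self, if_neg hA, mul_one]
    have hpos : (0 : ℝ) ≤ 2 * V * T ^ (1 - q) := by positivity
    rcases eq_or_ne A ∅ with rfl | hne
    · simp [centredBlock, hpos]
    · have e2 : ∀ ω, centredBlock μ ξ A (ξ 1 ω) = ∏ r ∈ A, ξ 1 ω r
          - ∫ ω', ∏ r ∈ A, ξ 1 ω' r ∂μ := fun ω => by simp [centredBlock, hne]
      simp only [e2]
      obtain ⟨i1, l1⟩ := h.integral_sub_sq_le (h.measurable_prod_apply A) (h.integrable_prod_sq hA)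
      exact ⟨i1, l1.trans (by linarith [hle A, p2 A, hVA A hne]), by simp, by simpa using hpos⟩

end IsInnovation

end Functionals

/-! ### Heavy blocks -/

section Heavy

variable {ι : Type*} [Fintype ι] [DecidableEq ι] {S : ℕ}

lemma disjoint_block {g : ι → Option ℤ} {l l' : ℤ} (hl : l ≠ l') :
    Disjoint (block g l) (block g l') := by
  rw [Finset.disjoint_left]
  intro r hr hr'
  rw [mem_block] at hr hr'
  exact hl (Option.some_injective _ (hr.symm.trans hr'))

/-- Blocks are disjoint, and two of more than `S / 2` coordinates do not fit into at most `S`. Hence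
`T` enters any term through one factor only. -/
lemma eq_of_heavy (hS : Fintype.card ι ≤ S) {g : ι → Option ℤ} {l l' : ℤ}
    (hl : S < 2 * (block g l).card) (hl' : S < 2 * (block g l').card) : l = l' := by
  by_contra hne
  have h1 := Finset.card_le_univ (block g l ∪ block g l')
  rw [Finset.card_union_of_disjoint (disjoint_block hne)] at h1
  omega

lemma sum_card_block_le (L : Finset ℤ) (g : ι → Option ℤ) :
    ∑ l ∈ L, (block g l).card ≤ Fintype.card ι := by
  rw [← Finset.card_biUnion fun l _ l' _ hne => disjoint_block hne]
  exact Finset.card_le_univ _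

lemma prod_heavy_le (hS : Fintype.card ι ≤ S) {V M : ℝ} (hV : 1 ≤ V) (hM : 1 ≤ M) (L : Finset ℤ)
    (g : ι → Option ℤ) :
    ∏ l ∈ L, (V ^ (block g l).card * if S < 2 * (block g l).card then M else 1)
      ≤ V ^ Fintype.card ι * if ∃ l ∈ L, S < 2 * (block g l).card then M else 1 := by
  rw [Finset.prod_mul_distrib, Finset.prod_pow_eq_pow_sum]
  have h1 : V ^ ∑ l ∈ L, (block g l).card ≤ V ^ Fintype.card ι :=
    pow_le_pow_right₀ hV (sum_card_block_le L g)
  have h2 : ∏ l ∈ L, (if S < 2 * (block g l).card then M else 1)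
      ≤ if ∃ l ∈ L, S < 2 * (block g l).card then M else 1 := by
    split_ifs with he
    · obtain ⟨l₀, hl₀, hh⟩ := he
      rw [Finset.prod_eq_single_of_mem l₀ hl₀ fun l _ hne => if_neg fun hl => hne
        (eq_of_heavy hS hl hh), if_pos hh]
    · push Not at he
      exact (Finset.prod_eq_one fun l hl => if_neg (not_lt.2 (he l hl))).le
  exact mul_le_mul h1 h2 (Finset.prod_nonneg fun l _ => by split_ifs <;> linarith) (by positivity)

end Heavy

/-! ### Sums of products of coefficients -/

section Weights

variable {ι : Type*} [Fintype ι] [DecidableEq ι]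

/-- The correlations of the absolute values of the coefficients decay polynomially. -/
structure IsDecaying (c : ι → ℤ → ℝ) (κ : ι → ℝ) (Λ : ℝ) : Prop where
  one_le : 1 ≤ Λ
  nonneg : ∀ r, 0 ≤ κ r
  sum_le : ∀ r (L : Finset ℤ) (k k' : ℤ), ∑ l ∈ L, |c r (k - l)| * |c r (k' - l)|
    ≤ Λ * (1 + |((k - k' : ℤ) : ℝ)|) ^ (-κ r)

/-- The coefficients at time `k`. -/
def coeffAt (c : ι → ℤ → ℝ) (k : ℤ) : ι → ℤ → ℝ := fun r l => c r (k - l)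

lemma abs_weight (a : ι → ℤ → ℝ) (g : ι → Option ℤ) :
    |weight a g| = ∏ r, (g r).elim 1 fun l => |a r l| := by
  rw [weight, Finset.abs_prod]
  refine Finset.prod_congr rfl fun r _ => ?_
  cases g r <;> simp

lemma sum_piFinset_abs_weight_mul (a a' : ι → ℤ → ℝ) (s : ι → Finset (Option ℤ)) :
    ∑ g ∈ Fintype.piFinset s, |weight a g| * |weight a' g|
      = ∏ r, ∑ o ∈ s r, (o.elim 1 fun l => |a r l|) * (o.elim 1 fun l => |a' r l|) := by
  rw [Finset.prod_univ_sum]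
  refine Finset.sum_congr rfl fun g _ => ?_
  rw [abs_weight, abs_weight, Finset.prod_mul_distrib]

namespace IsDecaying

variable {c : ι → ℤ → ℝ} {κ : ι → ℝ} {Λ : ℝ} (hc : IsDecaying c κ Λ)
include hc

lemma sum_le_const (r : ι) (L : Finset ℤ) (k k' : ℤ) :
    ∑ l ∈ L, |c r (k - l)| * |c r (k' - l)| ≤ Λ := by
  refine (hc.sum_le r L k k').trans (mul_le_of_le_one_right (by linarith [hc.one_le]) ?_)
  exact Real.rpow_le_one_of_one_le_of_nonpos
    (by linarith [abs_nonneg ((k - k' : ℤ) : ℝ)]) (by linarith [hc.nonneg r])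

lemma sum_sq_le (r : ι) (L : Finset ℤ) (k : ℤ) : ∑ l ∈ L, c r (k - l) ^ 2 ≤ Λ := by
  simpa only [← sq, sq_abs] using hc.sum_le_const r L k k

lemma sum_sq_time_le (r : ι) (W : Finset ℤ) (l : ℤ) : ∑ k ∈ W, c r (k - l) ^ 2 ≤ Λ := by
  have h1 := hc.sum_sq_le r (W.image fun k => -k) (-l)
  rw [Finset.sum_image fun x _ y _ hxy => neg_injective hxy] at h1
  refine le_trans (le_of_eq ?_) h1
  refine Finset.sum_congr rfl fun k _ => ?_
  congr 2; ring

/-- The sum over a fixed support factorises over coordinates: each `r ∈ D` gives one correlation,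
hence the exponents `κ r` add, and every other coordinate gives `1`. -/
lemma sum_weight_mul_of_support_le (L : Finset ℤ) (k k' : ℤ) (D : Finset ι) :
    ∑ g ∈ (assignments ι L).filter (fun g => Finset.univ.filter (fun r => g r ≠ none) = D),
      |weight (coeffAt c k) g| * |weight (coeffAt c k') g|
      ≤ Λ ^ Fintype.card ι * (1 + |((k - k' : ℤ) : ℝ)|) ^ (-∑ r ∈ D, κ r) := by
  set s : ι → Finset (Option ℤ) := fun r => if r ∈ D then L.map Function.Embedding.some else {none}
  have hsub : (assignments ι L).filter (fun g => Finset.univ.filter (fun r => g r ≠ none) = D)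
      ⊆ Fintype.piFinset s := by
    intro g hg
    obtain ⟨hg', rfl⟩ := Finset.mem_filter.1 hg
    rw [Fintype.mem_piFinset]
    intro r
    cases hr : g r with
    | none => simp [s, hr]
    | some l => simpa [s, hr] using mem_assignments.1 hg' r l hr
  refine (Finset.sum_le_sum_of_subset_of_nonneg hsub fun g _ _ => by positivity).trans ?_
  rw [sum_piFinset_abs_weight_mul]
  set w := (1 + |((k - k' : ℤ) : ℝ)|) with hw
  have hw0 : 0 < w := by positivity
  have h1 : ∀ r, ∑ o ∈ s r, (o.elim 1 fun l => |coeffAt c k r l|) *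
      (o.elim 1 fun l => |coeffAt c k' r l|) ≤ Λ * if r ∈ D then w ^ (-κ r) else 1 := by
    intro r
    by_cases hr : r ∈ D
    · simp only [s, if_pos hr, Finset.sum_map, Function.Embedding.some_apply, Option.elim_some,
        coeffAt]
      exact hc.sum_le r L k k'
    · simp only [s, if_neg hr, Finset.sum_singleton, Option.elim_none, mul_one]
      exact hc.one_le
  refine (Finset.prod_le_prod (fun r _ => Finset.sum_nonneg fun o _ => ?_)
    fun r _ => h1 r).trans (le_of_eq ?_)
  · cases o <;> simp only [Option.elim_none, Option.elim_some] <;> positivity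
  · rw [Finset.prod_mul_distrib, Finset.prod_const, Finset.card_univ, Finset.prod_ite_mem,
      Finset.univ_inter, ← Finset.sum_neg_distrib, Real.rpow_sum_of_pos hw0]

/-- The two coordinates pinned to `l` keep their coefficients; any other contributes `1` for `none`
plus a correlation bounded by `Λ`. -/
lemma sum_weight_mul_of_pair_le {r₁ r₂ : ι} (hr : r₁ ≠ r₂) (L : Finset ℤ) (k k' l : ℤ) :
    ∑ g ∈ (assignments ι L).filter (fun g => g r₁ = some l ∧ g r₂ = some l),
      |weight (coeffAt c k) g| * |weight (coeffAt c k') g|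
      ≤ (1 + Λ) ^ Fintype.card ι *
        ((|c r₁ (k - l)| * |c r₂ (k - l)|) * (|c r₁ (k' - l)| * |c r₂ (k' - l)|)) := by
  set s : ι → Finset (Option ℤ) := fun r => if r = r₁ ∨ r = r₂ then {some l}
    else Finset.insertNone L
  have hsub : (assignments ι L).filter (fun g => g r₁ = some l ∧ g r₂ = some l)
      ⊆ Fintype.piFinset s := by
    intro g hg
    obtain ⟨hg, h1, h2⟩ := Finset.mem_filter.1 hg
    rw [Fintype.mem_piFinset]
    intro r
    by_cases hr : r = r₁ ∨ r = r₂
    · simp only [s, if_pos hr, Finset.mem_singleton]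
      rcases hr with rfl | rfl <;> assumption
    · simp only [s, if_neg hr]
      exact Fintype.mem_piFinset.1 hg r
  refine (Finset.sum_le_sum_of_subset_of_nonneg hsub fun g _ _ => by positivity).trans ?_
  rw [sum_piFinset_abs_weight_mul]
  have hΛ := hc.one_le
  have h1 : ∀ r, ∑ o ∈ s r, (o.elim 1 fun l => |coeffAt c k r l|) *
      (o.elim 1 fun l => |coeffAt c k' r l|)
      ≤ (1 + Λ) * ((if r = r₁ then |c r₁ (k - l)| * |c r₁ (k' - l)| else 1) *
        (if r = r₂ then |c r₂ (k - l)| * |c r₂ (k' - l)| else 1)) := by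
    intro r
    have aux : ∀ x y : ℝ, |x| * |y| ≤ (1 + Λ) * (|x| * |y|) := fun x y =>
      le_mul_of_one_le_left (by positivity) (by linarith)
    by_cases hr1 : r = r₁
    · subst hr1
      simpa [s, hr, coeffAt] using aux (c r (k - l)) (c r (k' - l))
    · by_cases hr2 : r = r₂
      · subst hr2
        simpa [s, hr1, coeffAt] using aux (c r (k - l)) (c r (k' - l))
      · simp only [s, hr1, hr2, or_self, if_false, mul_one, Finset.sum_insertNone,
          Option.elim_none, Option.elim_some, coeffAt]
        linarith [hc.sum_le_const r L k k']
  refine (Finset.prod_le_prod (fun r _ => Finset.sum_nonneg fun o _ => ?_)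
    fun r _ => h1 r).trans (le_of_eq ?_)
  · cases o <;> simp only [Option.elim_none, Option.elim_some] <;> positivity
  · rw [Finset.prod_mul_distrib, Finset.prod_mul_distrib, Finset.prod_const, Finset.card_univ,
      Finset.prod_ite_eq' Finset.univ r₁, Finset.prod_ite_eq' Finset.univ r₂]
    simp only [Finset.mem_univ, if_true]
    ring

lemma sum_abs_mul_abs_le (r₁ r₂ : ι) (L : Finset ℤ) (k : ℤ) :
    ∑ l ∈ L, |c r₁ (k - l)| * |c r₂ (k - l)| ≤ Λ := by
  calc ∑ l ∈ L, |c r₁ (k - l)| * |c r₂ (k - l)|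
      ≤ ∑ l ∈ L, (c r₁ (k - l) ^ 2 + c r₂ (k - l) ^ 2) / 2 := Finset.sum_le_sum fun l _ => by
        rw [← sq_abs (c r₁ _), ← sq_abs (c r₂ _)]
        nlinarith [sq_nonneg (|c r₁ (k - l)| - |c r₂ (k - l)|)]
    _ = (∑ l ∈ L, c r₁ (k - l) ^ 2 + ∑ l ∈ L, c r₂ (k - l) ^ 2) / 2 := by
        rw [← Finset.sum_div, Finset.sum_add_distrib]
    _ ≤ Λ := by linarith [hc.sum_sq_le r₁ L k, hc.sum_sq_le r₂ L k]

lemma sum_time_abs_mul_abs_le (r₁ r₂ : ι) (W : Finset ℤ) (l : ℤ) :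
    ∑ k ∈ W, |c r₁ (k - l)| * |c r₂ (k - l)| ≤ Λ := by
  calc ∑ k ∈ W, |c r₁ (k - l)| * |c r₂ (k - l)|
      ≤ ∑ k ∈ W, (c r₁ (k - l) ^ 2 + c r₂ (k - l) ^ 2) / 2 := Finset.sum_le_sum fun k _ => by
        rw [← sq_abs (c r₁ _), ← sq_abs (c r₂ _)]
        nlinarith [sq_nonneg (|c r₁ (k - l)| - |c r₂ (k - l)|)]
    _ = (∑ k ∈ W, c r₁ (k - l) ^ 2 + ∑ k ∈ W, c r₂ (k - l) ^ 2) / 2 := by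
        rw [← Finset.sum_div, Finset.sum_add_distrib]
    _ ≤ Λ := by linarith [hc.sum_sq_time_le r₁ W l, hc.sum_sq_time_le r₂ W l]

/-- The windowed coefficients of assignments that take some value twice. -/
lemma sum_sq_window_of_pair_le {r₁ r₂ : ι} (hr : r₁ ≠ r₂) (L W : Finset ℤ) :
    ∑ l ∈ L, ∑ g ∈ (assignments ι L).filter (fun g => g r₁ = some l ∧ g r₂ = some l),
      (∑ k ∈ W, |weight (coeffAt c k) g|) ^ 2
      ≤ (1 + Λ) ^ Fintype.card ι * Λ ^ 2 * W.card := by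
  have hΛ := hc.one_le
  have e : ∀ l, ∑ g ∈ (assignments ι L).filter (fun g => g r₁ = some l ∧ g r₂ = some l),
      (∑ k ∈ W, |weight (coeffAt c k) g|) ^ 2
      = ∑ k ∈ W, ∑ k' ∈ W,
        ∑ g ∈ (assignments ι L).filter (fun g => g r₁ = some l ∧ g r₂ = some l),
          |weight (coeffAt c k) g| * |weight (coeffAt c k') g| := fun l => by
    simp only [sq, Finset.sum_mul_sum]
    rw [Finset.sum_comm]
    refine Finset.sum_congr rfl fun k _ => Finset.sum_comm
  simp only [e]
  -- With the pair tied to one `l`, the sum over `k'` at fixed `l` and the sum over `l` at fixed `k`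
  -- are both at most `Λ`; only the sum over `k` remains, so the bound is linear in the window.
  calc _ ≤ ∑ l ∈ L, ∑ k ∈ W, ∑ k' ∈ W, (1 + Λ) ^ Fintype.card ι *
        ((|c r₁ (k - l)| * |c r₂ (k - l)|) * (|c r₁ (k' - l)| * |c r₂ (k' - l)|)) :=
        Finset.sum_le_sum fun l _ => Finset.sum_le_sum fun k _ => Finset.sum_le_sum fun k' _ =>
          hc.sum_weight_mul_of_pair_le hr L k k' l
    _ = (1 + Λ) ^ Fintype.card ι * ∑ k ∈ W, ∑ l ∈ L, (|c r₁ (k - l)| * |c r₂ (k - l)|) *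
        ∑ k' ∈ W, (|c r₁ (k' - l)| * |c r₂ (k' - l)|) := by
        simp only [Finset.mul_sum]
        rw [Finset.sum_comm]
    _ ≤ (1 + Λ) ^ Fintype.card ι * ∑ k ∈ W, ∑ l ∈ L, (|c r₁ (k - l)| * |c r₂ (k - l)|) * Λ := by
        gcongr with k _ l _
        exact hc.sum_time_abs_mul_abs_le r₁ r₂ W l
    _ ≤ (1 + Λ) ^ Fintype.card ι * ∑ _k ∈ W, Λ * Λ := by
        gcongr with k _
        rw [← Finset.sum_mul]
        gcongr
        exact hc.sum_abs_mul_abs_le r₁ r₂ L k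
    _ = _ := by rw [Finset.sum_const, nsmul_eq_mul]; ring

/-- The windowed coefficients of assignments with support `D`. -/
lemma exists_sum_sq_window_of_support_le {D : Finset ι} {β : ℝ} (hβ1 : 1 ≤ β)
    (hβ : 2 - ∑ r ∈ D, κ r < β) : ∃ C : ℝ, 0 ≤ C ∧ ∀ (L : Finset ℤ) (a n : ℕ),
    ∑ g ∈ (assignments ι L).filter (fun g => Finset.univ.filter (fun r => g r ≠ none) = D),
      (∑ i ∈ Finset.range n, |weight (coeffAt c ((a + i : ℕ) : ℤ)) g|) ^ 2
      ≤ C * (n : ℝ) ^ β := by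
  obtain ⟨C, hC0, hC⟩ := exists_sum_sum_rpow_le (κ := ∑ r ∈ D, κ r) hβ1 hβ
  have hΛ := hc.one_le
  refine ⟨Λ ^ Fintype.card ι * C, by positivity, fun L a n => ?_⟩
  have e : ∑ g ∈ (assignments ι L).filter (fun g => Finset.univ.filter (fun r => g r ≠ none) = D),
      (∑ i ∈ Finset.range n, |weight (coeffAt c ((a + i : ℕ) : ℤ)) g|) ^ 2
      = ∑ i ∈ Finset.range n, ∑ i' ∈ Finset.range n,
        ∑ g ∈ (assignments ι L).filter (fun g => Finset.univ.filter (fun r => g r ≠ none) = D),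
        |weight (coeffAt c ((a + i : ℕ) : ℤ)) g| * |weight (coeffAt c ((a + i' : ℕ) : ℤ)) g| := by
    simp only [sq, Finset.sum_mul_sum]
    rw [Finset.sum_comm]
    refine Finset.sum_congr rfl fun k _ => Finset.sum_comm
  rw [e]
  calc _ ≤ ∑ i ∈ Finset.range n, ∑ i' ∈ Finset.range n, Λ ^ Fintype.card ι *
        (1 + |((((a + i : ℕ) : ℤ) - ((a + i' : ℕ) : ℤ) : ℤ) : ℝ)|) ^ (-∑ r ∈ D, κ r) :=
        Finset.sum_le_sum fun i _ => Finset.sum_le_sum fun i' _ =>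
          hc.sum_weight_mul_of_support_le L _ _ D
    _ = Λ ^ Fintype.card ι * ∑ i ∈ Finset.range n, ∑ i' ∈ Finset.range n,
        (1 + |((((a + i : ℕ) : ℤ) - ((a + i' : ℕ) : ℤ) : ℤ) : ℝ)|) ^ (-∑ r ∈ D, κ r) := by
        simp only [Finset.mul_sum]
    _ ≤ Λ ^ Fintype.card ι * (C * (n : ℝ) ^ β) := by
        gcongr; exact hC a n
    _ = _ := by ring

end IsDecaying

end Weights

/-! ### Splitting the centred products into a square integrable part and a small remainder -/

section Split

variable {Ω ι : Type*} [MeasurableSpace Ω] {μ : Measure Ω} [IsProbabilityMeasure μ] [Fintype ι]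
  [DecidableEq ι] {S : ℕ} {ξ : ℤ → Ω → ι → ℝ}

/-- The assignments that are defined somewhere. -/
def properAssignments (ι : Type*) [Fintype ι] [DecidableEq ι] (L : Finset ℤ) :
    Finset (ι → Option ℤ) :=
  (assignments ι L).erase fun _ => none

/-- The coefficient of `g` in the decomposition of the product at time `k`. -/
def decompCoeff (μ : Measure Ω) (ξ : ℤ → Ω → ι → ℝ) (c : ι → ℤ → ℝ) (L : Finset ℤ) (k : ℤ)
    (g : ι → Option ℤ) : ℝ :=
  weight (coeffAt c k) g * freeCoeff (coeffAt c k) (fun A => ∫ ω, ∏ r ∈ A, ξ 1 ω r ∂μ) L g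

/-- The product over the coordinates of the linear processes whose innovations are restricted
to `L`. -/
def restrictedProd (c : ι → ℤ → ℝ) (ξ : ℤ → Ω → ι → ℝ) (L : Finset ℤ) (k : ℤ) (ω : Ω) : ℝ :=
  ∏ r, ∑ l ∈ L, c r (k - l) * ξ l ω r

/-- The term of the nowhere defined assignment has all coordinates free, so its coefficient is the
full expectation; centring removes exactly this term. -/
lemma restrictedProd_sub_integral (h : IsInnovation μ S ξ) (c : ι → ℤ → ℝ) (L : Finset ℤ)
    (k : ℤ) (ω : Ω) :
    restrictedProd c ξ L k ω - ∫ ω', restrictedProd c ξ L k ω' ∂μ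
      = ∑ g ∈ properAssignments ι L,
        decompCoeff μ ξ c L k g * blockProd (centredBlock μ ξ) ξ L g ω := by
  have hm : (fun A : Finset ι => ∫ ω, ∏ r ∈ A, ξ 1 ω r ∂μ) ∅ = 1 := by simp
  have h1 := prod_sum_eq_sum_assignments (coeffAt c k) (fun l => ξ l ω)
    (fun A : Finset ι => ∫ ω, ∏ r ∈ A, ξ 1 ω r ∂μ) hm L
  have hnone : (fun _ => none : ι → Option ℤ) ∈ assignments ι L := by simp [mem_assignments]
  have hvn : values (fun _ => none : ι → Option ℤ) = ∅ := by
    ext l; simp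
  have hfn : free (fun _ => none : ι → Option ℤ) = Finset.univ := by
    ext r; simp
  have h2 : decompCoeff μ ξ c L k (fun _ => none) *
      blockProd (centredBlock μ ξ) ξ L (fun _ => none) ω
      = ∫ ω', restrictedProd c ξ L k ω' ∂μ := by
    have e1 : blockProd (centredBlock μ ξ) ξ L (fun _ => none) ω = 1 :=
      Finset.prod_eq_one fun l _ => by
        rw [block_eq_empty_iff.2 (by rw [hvn]; simp)]; simp [centredBlock]
    have e2 : weight (coeffAt c k) (fun _ => none) = 1 := by simp [weight]
    rw [e1, decompCoeff, e2, h.freeCoeff_eq_integral, hvn, hfn]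
    simp [restrictedProd, coeffAt]
  have h3 : restrictedProd c ξ L k ω = ∑ g ∈ assignments ι L,
      decompCoeff μ ξ c L k g * blockProd (centredBlock μ ξ) ξ L g ω := h1
  rw [h3, properAssignments, ← Finset.add_sum_erase _ _ hnone, h2]
  ring

/-- Truncation alters light blocks not at all, and there is at most one heavy block. So at most one
summand on the right is nonzero, and the other factors may be taken truncated. -/
lemma blockProd_centred_sub_trunc (hS : Fintype.card ι ≤ S) (T : ℝ) (L : Finset ℤ)
    (g : ι → Option ℤ) (ω : Ω) :
    blockProd (centredBlock μ ξ) ξ L g ω - blockProd (truncBlock μ S ξ T) ξ L g ω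
      = ∑ l ∈ L, (centredBlock μ ξ (block g l) (ξ l ω) - truncBlock μ S ξ T (block g l) (ξ l ω))
        * blockProd (truncBlock μ S ξ T) ξ (L.erase l) g ω := by
  by_cases he : ∃ l ∈ L, S < 2 * (block g l).card
  · obtain ⟨l₀, hl₀, hh⟩ := he
    have hlight : ∀ l, l ≠ l₀ → ¬ S < 2 * (block g l).card := fun l hl hlt =>
      hl (eq_of_heavy hS hlt hh)
    rw [Finset.sum_eq_single_of_mem l₀ hl₀ fun l _ hl => by
      rw [truncBlock_of_le (hlight l hl)]; ring]
    have e1 : blockProd (centredBlock μ ξ) ξ (L.erase l₀) g ω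
        = blockProd (truncBlock μ S ξ T) ξ (L.erase l₀) g ω :=
      Finset.prod_congr rfl fun l hl => by
        rw [truncBlock_of_le (hlight l (Finset.ne_of_mem_erase hl))]
    have e2 : ∀ φ : Finset ι → (ι → ℝ) → ℝ, blockProd φ ξ L g ω
        = φ (block g l₀) (ξ l₀ ω) * blockProd φ ξ (L.erase l₀) g ω := fun φ =>
      (Finset.mul_prod_erase L (fun l => φ (block g l) (ξ l ω)) hl₀).symm
    rw [e2, e2, e1]
    ring
  · push Not at he
    have e1 : ∀ l ∈ L, truncBlock μ S ξ T (block g l) = centredBlock μ ξ (block g l) :=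
      fun l hl => truncBlock_of_le (not_lt.2 (he l hl)) T
    rw [Finset.sum_eq_zero fun l hl => by rw [e1 l hl]; ring, sub_eq_zero]
    exact Finset.prod_congr rfl fun l hl => by rw [e1 l hl]

namespace IsInnovation

variable (h : IsInnovation μ S ξ) {c : ι → ℤ → ℝ} {κ : ι → ℝ} {Λ : ℝ} (hc : IsDecaying c κ Λ)
include h

include hc in
lemma exists_abs_freeCoeff_le : ∃ K : ℝ, 0 ≤ K ∧ ∀ (L : Finset ℤ) (k : ℤ) (g : ι → Option ℤ),
    |freeCoeff (coeffAt c k) (fun A => ∫ ω, ∏ r ∈ A, ξ 1 ω r ∂μ) L g| ≤ K := by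
  obtain ⟨K, hK0, hK⟩ := h.exists_integral_prod_sum_le Λ
  refine ⟨K, hK0, fun L k g => ?_⟩
  rw [h.freeCoeff_eq_integral]
  refine abs_integral_le_integral_abs.trans ?_
  simp only [Finset.abs_prod]
  exact (hK (free g) (L \ values g) (coeffAt c k) fun r => hc.sum_sq_le r _ k).2

/-- A single free coordinate leaves the mean of a linear sum of centred innovations. For two
coordinates this eliminates every proper nonempty support, which is why the rate there depends on
the sum of the decay exponents. -/
lemma freeCoeff_eq_zero (a : ι → ℤ → ℝ) (L : Finset ℤ) {g : ι → Option ℤ}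
    (hg : (free g).card = 1) :
    freeCoeff a (fun A => ∫ ω, ∏ r ∈ A, ξ 1 ω r ∂μ) L g = 0 := by
  rw [h.freeCoeff_eq_integral]
  obtain ⟨r, hr⟩ := Finset.card_eq_one.1 hg
  simp only [hr, Finset.prod_singleton]
  have hi : ∀ l, Integrable (fun ω => ξ l ω r) μ := fun l => by
    have := h.integrable_comp l (ψ := fun v => ∏ r' ∈ {r}, v r') (by fun_prop)
      (h.integrable_prod_apply {r})
    simpa using this
  rw [integral_finsetSum _ fun l _ => (hi l).const_mul _]
  exact Finset.sum_eq_zero fun l _ => by rw [integral_const_mul, h.mean_apply, mul_zero]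

include hc in
-- Sort the assignments by support `D`. The empty support is excluded, the coefficient vanishes if
-- `D` misses exactly one coordinate, and every other support is covered by `hβ`.
lemma exists_sum_sq_decompCoeff_le {β : ℝ} (hβ1 : 1 ≤ β)
    (hβ : ∀ D : Finset ι, D.Nonempty → Dᶜ.card ≠ 1 → 2 - ∑ r ∈ D, κ r < β) :
    ∃ C : ℝ, 0 ≤ C ∧ ∀ (L : Finset ℤ) (a n : ℕ), ∑ g ∈ properAssignments ι L,
      (∑ i ∈ Finset.range n, decompCoeff μ ξ c L ((a + i : ℕ) : ℤ) g) ^ 2 ≤ C * (n : ℝ) ^ β := by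
  obtain ⟨K, hK0, hK⟩ := h.exists_abs_freeCoeff_le hc
  have hD : ∀ D : Finset ι, ∃ C : ℝ, 0 ≤ C ∧ ∀ (L : Finset ℤ) (a n : ℕ),
      ∑ g ∈ (properAssignments ι L).filter
        (fun g => Finset.univ.filter (fun r => g r ≠ none) = D),
      (∑ i ∈ Finset.range n, decompCoeff μ ξ c L ((a + i : ℕ) : ℤ) g) ^ 2 ≤ C * (n : ℝ) ^ β := by
    intro D
    have hfree : ∀ g : ι → Option ℤ, Finset.univ.filter (fun r => g r ≠ none) = D →
        free g = Dᶜ := by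
      rintro g rfl
      ext r; simp
    rcases D.eq_empty_or_nonempty with rfl | hne
    · refine ⟨0, le_rfl, fun L a n => ?_⟩
      rw [zero_mul, Finset.sum_eq_zero]
      intro g hg
      obtain ⟨hg, hgD⟩ := Finset.mem_filter.1 hg
      refine absurd ?_ (Finset.ne_of_mem_erase hg)
      ext1 r
      have := hfree g hgD ▸ (Finset.mem_compl.2 (Finset.notMem_empty r))
      exact mem_free.1 this
    · by_cases h1 : Dᶜ.card = 1
      · refine ⟨0, le_rfl, fun L a n => ?_⟩
        rw [zero_mul, Finset.sum_eq_zero]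
        intro g hg
        obtain ⟨hg, hgD⟩ := Finset.mem_filter.1 hg
        rw [Finset.sum_eq_zero fun i _ => ?_]
        · simp
        · rw [decompCoeff, h.freeCoeff_eq_zero _ _ (by rw [hfree g hgD, h1]), mul_zero]
      · obtain ⟨C, hC0, hC⟩ := hc.exists_sum_sq_window_of_support_le hβ1 (hβ D hne h1)
        refine ⟨K ^ 2 * C, by positivity, fun L a n => ?_⟩
        calc _ ≤ ∑ g ∈ (properAssignments ι L).filter
              (fun g => Finset.univ.filter (fun r => g r ≠ none) = D),
              K ^ 2 * (∑ i ∈ Finset.range n, |weight (coeffAt c ((a + i : ℕ) : ℤ)) g|) ^ 2 := by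
              refine Finset.sum_le_sum fun g _ => ?_
              rw [← mul_pow, Finset.mul_sum, ← sq_abs]
              refine pow_le_pow_left₀ (abs_nonneg _) ?_ 2
              refine (Finset.abs_sum_le_sum_abs _ _).trans (Finset.sum_le_sum fun i _ => ?_)
              rw [decompCoeff, abs_mul, mul_comm]
              gcongr
              exact hK _ _ _
          _ ≤ K ^ 2 * ∑ g ∈ (assignments ι L).filter
              (fun g => Finset.univ.filter (fun r => g r ≠ none) = D),
              (∑ i ∈ Finset.range n, |weight (coeffAt c ((a + i : ℕ) : ℤ)) g|) ^ 2 := by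
              rw [← Finset.mul_sum]
              refine mul_le_mul_of_nonneg_left ?_ (sq_nonneg K)
              exact Finset.sum_le_sum_of_subset_of_nonneg
                (Finset.filter_subset_filter _ (Finset.erase_subset _ _))
                fun g _ _ => by positivity
          _ ≤ K ^ 2 * (C * (n : ℝ) ^ β) := by gcongr; exact hC L a n
          _ = _ := by ring
  choose C hC0 hC using hD
  refine ⟨∑ D, C D, Finset.sum_nonneg fun D _ => hC0 D, fun L a n => ?_⟩
  rw [← Finset.sum_fiberwise (properAssignments ι L)
    (fun g => Finset.univ.filter (fun r => g r ≠ none)), Finset.sum_mul]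
  exact Finset.sum_le_sum fun D _ => hC D L a n

include hc in
-- As `S ≥ 2`, a heavy block contains two distinct coordinates with a common index. Summing over all
-- such pairs and indices reduces to the linear window bound `sum_sq_window_of_pair_le`.
lemma exists_sum_sq_decompCoeff_heavy_le :
    ∃ C : ℝ, 0 ≤ C ∧ ∀ (L : Finset ℤ) (a n : ℕ),
      ∑ g ∈ (properAssignments ι L).filter (fun g => ∃ l ∈ L, S < 2 * (block g l).card),
      (∑ i ∈ Finset.range n, decompCoeff μ ξ c L ((a + i : ℕ) : ℤ) g) ^ 2 ≤ C * n := by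
  obtain ⟨K, hK0, hK⟩ := h.exists_abs_freeCoeff_le hc
  have hΛ := hc.one_le
  set P : Finset (ι × ι) := Finset.univ.filter fun p => p.1 ≠ p.2 with hP
  refine ⟨K ^ 2 * (P.card * ((1 + Λ) ^ Fintype.card ι * Λ ^ 2)), by positivity, fun L a n => ?_⟩
  set B : (ι → Option ℤ) → ℝ := fun g =>
    (∑ i ∈ Finset.range n, |weight (coeffAt c ((a + i : ℕ) : ℤ)) g|) ^ 2 with hB
  have hB0 : ∀ g, 0 ≤ B g := fun g => sq_nonneg _
  calc _ ≤ ∑ g ∈ (properAssignments ι L).filter (fun g => ∃ l ∈ L, S < 2 * (block g l).card),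
        K ^ 2 * B g := by
        refine Finset.sum_le_sum fun g _ => ?_
        rw [hB, ← mul_pow, Finset.mul_sum, ← sq_abs]
        refine pow_le_pow_left₀ (abs_nonneg _) ?_ 2
        refine (Finset.abs_sum_le_sum_abs _ _).trans (Finset.sum_le_sum fun i _ => ?_)
        rw [decompCoeff, abs_mul, mul_comm]
        gcongr
        exact hK _ _ _
    _ ≤ ∑ g ∈ (properAssignments ι L).filter (fun g => ∃ l ∈ L, S < 2 * (block g l).card),
        K ^ 2 * ∑ p ∈ P, ∑ l ∈ L, if g p.1 = some l ∧ g p.2 = some l then B g else 0 := by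
        refine Finset.sum_le_sum fun g hg => ?_
        obtain ⟨_, l, hl, hlt⟩ := Finset.mem_filter.1 hg
        have h2 := h.two_le
        obtain ⟨r₁, hr₁, r₂, hr₂, hne⟩ := Finset.one_lt_card.1
          (show 1 < (block g l).card by omega)
        gcongr
        have n0 : ∀ p : ι × ι, ∀ l, 0 ≤ if g p.1 = some l ∧ g p.2 = some l then B g else 0 :=
          fun p l => by split_ifs <;> simp [hB0]
        calc B g = if g (r₁, r₂).1 = some l ∧ g (r₁, r₂).2 = some l then B g else 0 := by
              rw [if_pos ⟨mem_block.1 hr₁, mem_block.1 hr₂⟩]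
          _ ≤ ∑ l ∈ L, if g (r₁, r₂).1 = some l ∧ g (r₁, r₂).2 = some l then B g else 0 :=
              Finset.single_le_sum (f := fun l => if g (r₁, r₂).1 = some l ∧ g (r₁, r₂).2 = some l
                then B g else 0) (fun l _ => n0 _ l) hl
          _ ≤ _ := Finset.single_le_sum (f := fun p : ι × ι => ∑ l ∈ L,
                if g p.1 = some l ∧ g p.2 = some l then B g else 0)
                (fun p _ => Finset.sum_nonneg fun l _ => n0 p l)
                (Finset.mem_filter.2 ⟨Finset.mem_univ (r₁, r₂), hne⟩)
    _ ≤ ∑ g ∈ assignments ι L,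
        K ^ 2 * ∑ p ∈ P, ∑ l ∈ L, if g p.1 = some l ∧ g p.2 = some l then B g else 0 := by
        refine Finset.sum_le_sum_of_subset_of_nonneg
          ((Finset.filter_subset _ _).trans (Finset.erase_subset _ _)) fun g _ _ => ?_
        refine mul_nonneg (sq_nonneg _) (Finset.sum_nonneg fun p _ => Finset.sum_nonneg
          fun l _ => ?_)
        split_ifs <;> simp [hB0]
    _ = K ^ 2 * ∑ p ∈ P, ∑ l ∈ L,
        ∑ g ∈ (assignments ι L).filter (fun g => g p.1 = some l ∧ g p.2 = some l), B g := by
        rw [← Finset.mul_sum, Finset.sum_comm]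
        simp only [Finset.sum_filter]
        congr 1
        exact Finset.sum_congr rfl fun p _ => Finset.sum_comm
    _ ≤ K ^ 2 * ∑ _p ∈ P, (1 + Λ) ^ Fintype.card ι * Λ ^ 2 * n := by
        gcongr with p hp
        have hW := hc.sum_sq_window_of_pair_le (Finset.mem_filter.1 hp).2 L
          ((Finset.range n).map ⟨fun i : ℕ => ((a + i : ℕ) : ℤ), fun x y h => by simpa using h⟩)
        simp only [Finset.sum_map, Finset.card_map, Finset.card_range] at hW
        exact hW
    _ = _ := by rw [Finset.sum_const, nsmul_eq_mul]; ring

end IsInnovation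

end Split

/-! ### Second moment of the main part and first moment of the remainder -/

section Split

variable {Ω ι : Type*} [MeasurableSpace Ω] {μ : Measure Ω} [IsProbabilityMeasure μ] [Fintype ι]
  [DecidableEq ι] {S : ℕ} {ξ : ℤ → Ω → ι → ℝ}

lemma integral_abs_le_of_integral_sq_le {R : Ω → ℝ} (hR : Measurable R)
    (hR2 : Integrable (fun ω => R ω ^ 2) μ) {t : ℝ} (ht : 0 ≤ t) (hle : ∫ ω, R ω ^ 2 ∂μ ≤ t ^ 2) :
    Integrable R μ ∧ ∫ ω, |R ω| ∂μ ≤ t := by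
  have hm : MemLp R 2 μ := (memLp_two_iff_integrable_sq hR.aestronglyMeasurable).2 hR2
  have hv := variance_eq_sub hm.abs
  have h0 := variance_nonneg |R| μ
  refine ⟨hm.integrable (by norm_num), abs_le_of_sq_le_sq' ?_ ht |>.2⟩
  have e1 : ∫ ω, (|R| ^ 2) ω ∂μ = ∫ ω, R ω ^ 2 ∂μ := by
    refine integral_congr_ae (ae_of_all _ fun ω => ?_)
    simp
  rw [e1] at hv
  have e2 : ∫ ω, |R| ω ∂μ = ∫ ω, |R ω| ∂μ := rfl
  rw [e2] at hv
  linarith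

/-- The square integrable part of the centred product. -/
def mainPart (μ : Measure Ω) (S : ℕ) (ξ : ℤ → Ω → ι → ℝ) (c : ι → ℤ → ℝ) (L : Finset ℤ) (T : ℝ)
    (k : ℤ) (ω : Ω) : ℝ :=
  ∑ g ∈ properAssignments ι L, decompCoeff μ ξ c L k g * blockProd (truncBlock μ S ξ T) ξ L g ω

/-- The truncation error of the centred product. -/
def remainder (μ : Measure Ω) (S : ℕ) (ξ : ℤ → Ω → ι → ℝ) (c : ι → ℤ → ℝ) (L : Finset ℤ) (T : ℝ)
    (k : ℤ) (ω : Ω) : ℝ :=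
  ∑ g ∈ properAssignments ι L, decompCoeff μ ξ c L k g *
    (blockProd (centredBlock μ ξ) ξ L g ω - blockProd (truncBlock μ S ξ T) ξ L g ω)

namespace IsInnovation

variable (h : IsInnovation μ S ξ) {c : ι → ℤ → ℝ} {κ : ι → ℝ} {Λ : ℝ} (hc : IsDecaying c κ Λ)
include h

lemma restrictedProd_sub_integral_eq (L : Finset ℤ) (T : ℝ) (k : ℤ) (ω : Ω) :
    restrictedProd c ξ L k ω - ∫ ω', restrictedProd c ξ L k ω' ∂μ
      = mainPart μ S ξ c L T k ω + remainder μ S ξ c L T k ω := by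
  rw [restrictedProd_sub_integral h, mainPart, remainder, ← Finset.sum_add_distrib]
  exact Finset.sum_congr rfl fun g _ => by ring

include hc in
-- The coefficients are summed over the window before orthogonality is applied, so their correlation
-- decay gives `n ^ β`. The large factor `T ^ (2 - q)` affects only assignments with a heavy block,
-- whose coefficients are controlled linearly in `n`.
lemma exists_integral_sq_mainPart_le {q β : ℝ} (hq1 : 1 ≤ q) (hq2 : q ≤ 2) (hβ1 : 1 ≤ β)
    (hβ : ∀ D : Finset ι, D.Nonempty → Dᶜ.card ≠ 1 → 2 - ∑ r ∈ D, κ r < β)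
    (hheavy : ∀ A : Finset ι, S < 2 * A.card →
      Integrable (fun ω => |∏ r ∈ A, ξ 1 ω r| ^ q) μ) :
    ∃ C : ℝ, 0 ≤ C ∧ ∀ (L : Finset ℤ) (T : ℝ), 1 ≤ T → ∀ a n : ℕ,
      Integrable (fun ω => (∑ i ∈ Finset.range n,
        mainPart μ S ξ c L T ((a + i : ℕ) : ℤ) ω) ^ 2) μ ∧
      ∫ ω, (∑ i ∈ Finset.range n, mainPart μ S ξ c L T ((a + i : ℕ) : ℤ) ω) ^ 2 ∂μ
        ≤ C * (n : ℝ) ^ β + C * T ^ (2 - q) * n := by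
  obtain ⟨V, hV1, hV⟩ := h.exists_truncBlock_le hq1 hq2 hheavy
  obtain ⟨C₁, hC₁, h1⟩ := h.exists_sum_sq_decompCoeff_le hc hβ1 hβ
  obtain ⟨C₂, hC₂, h2⟩ := h.exists_sum_sq_decompCoeff_heavy_le hc
  set N : ℝ := (Fintype.card ι + 1) ^ Fintype.card ι with hN
  have hN0 : 0 ≤ N := by positivity
  refine ⟨N * V ^ Fintype.card ι * (C₁ + C₂), by positivity, fun L T hT a n => ?_⟩
  set B : (ι → Option ℤ) → ℝ := fun g =>
    ∑ i ∈ Finset.range n, decompCoeff μ ξ c L ((a + i : ℕ) : ℤ) g with hB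
  have e : ∀ ω, ∑ i ∈ Finset.range n, mainPart μ S ξ c L T ((a + i : ℕ) : ℤ) ω
      = ∑ g ∈ properAssignments ι L, B g * blockProd (truncBlock μ S ξ T) ξ L g ω := fun ω => by
    simp only [mainPart, hB, Finset.sum_mul]
    rw [Finset.sum_comm]
  simp only [e]
  obtain ⟨i0, l0⟩ := h.integral_sq_sum_blockProd_le (measurable_truncBlock T)
    (fun A => (hV T hT A).1) (fun A hA => h.integral_truncBlock T hA) (truncBlock_empty T)
    (L := L) (G := properAssignments ι L) (by
      intro g hg g' hg' hne
      have hne' : ∃ l, ¬ (l ∈ values g ↔ l ∈ values g') := by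
        by_contra hcon
        push Not at hcon
        exact hne (Finset.ext hcon)
      obtain ⟨l, hl⟩ := hne'
      refine ⟨l, ?_, hl⟩
      by_contra hlL
      exact hl ⟨fun hh => absurd (values_subset (Finset.mem_of_mem_erase hg) hh) hlL,
        fun hh => absurd (values_subset (Finset.mem_of_mem_erase hg') hh) hlL⟩) B
  refine ⟨i0, l0.trans ?_⟩
  set M : ℝ := T ^ (2 - q) with hM
  have hM1 : 1 ≤ M := Real.one_le_rpow hT (by linarith)
  have hsq : ∀ g, ∫ ω, blockProd (truncBlock μ S ξ T) ξ L g ω ^ 2 ∂μ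
      ≤ V ^ Fintype.card ι * (1 + if ∃ l ∈ L, S < 2 * (block g l).card then M else 0) := by
    intro g
    rw [h.integral_blockProd_sq (measurable_truncBlock T)]
    calc _ ≤ ∏ l ∈ L, (V ^ (block g l).card * if S < 2 * (block g l).card then M else 1) :=
          Finset.prod_le_prod (fun l _ => integral_nonneg fun ω => sq_nonneg _)
            fun l _ => (hV T hT _).2.1
      _ ≤ _ := prod_heavy_le h.card_le hV1 hM1 L g
      _ ≤ _ := by
          gcongr
          split_ifs <;> linarith
  calc N * ∑ g ∈ properAssignments ι L, B g ^ 2 *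
        ∫ ω, blockProd (truncBlock μ S ξ T) ξ L g ω ^ 2 ∂μ
      ≤ N * ∑ g ∈ properAssignments ι L, B g ^ 2 * (V ^ Fintype.card ι *
          (1 + if ∃ l ∈ L, S < 2 * (block g l).card then M else 0)) := by
        gcongr with g _
        exact hsq g
    _ = N * V ^ Fintype.card ι * (∑ g ∈ properAssignments ι L, B g ^ 2 + M *
          ∑ g ∈ (properAssignments ι L).filter (fun g => ∃ l ∈ L, S < 2 * (block g l).card),
            B g ^ 2) := by
        rw [Finset.sum_filter, Finset.mul_sum, Finset.mul_sum, ← Finset.sum_add_distrib,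
          Finset.mul_sum]
        refine Finset.sum_congr rfl fun g _ => ?_
        split_ifs <;> ring
    _ ≤ N * V ^ Fintype.card ι * (C₁ * (n : ℝ) ^ β + M * (C₂ * n)) := by
        gcongr
        · exact h1 L a n
        · exact h2 L a n
    _ ≤ _ := by
        have p1 : 0 ≤ N * V ^ Fintype.card ι * (C₂ * (n : ℝ) ^ β) := by positivity
        have p2 : 0 ≤ N * V ^ Fintype.card ι * (M * (C₁ * n)) := by positivity
        nlinarith

/-- The part of the decomposition that multiplies the functional of the block `A` at `l`. -/
lemma integral_abs_blockRest_le {V K T : ℝ} (hV1 : 1 ≤ V)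
    (hV2 : ∀ A : Finset ι, Integrable (fun ω => truncBlock μ S ξ T A (ξ 1 ω) ^ 2) μ)
    (hV : ∀ A : Finset ι, ¬ S < 2 * A.card →
      ∫ ω, truncBlock μ S ξ T A (ξ 1 ω) ^ 2 ∂μ ≤ V ^ A.card)
    (hc : IsDecaying c κ Λ) {L : Finset ℤ} {k : ℤ}
    (hK : ∀ g, |freeCoeff (coeffAt c k) (fun A => ∫ ω, ∏ r ∈ A, ξ 1 ω r ∂μ) L g| ≤ K)
    {A : Finset ι} (hA : S < 2 * A.card) {r₁ r₂ : ι} (hr₁ : r₁ ∈ A) (hr₂ : r₂ ∈ A)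
    (hne : r₁ ≠ r₂) (l : ℤ) :
    Integrable (fun ω => ∑ g ∈ (properAssignments ι L).filter (fun g => block g l = A),
      decompCoeff μ ξ c L k g * blockProd (truncBlock μ S ξ T) ξ (L.erase l) g ω) μ ∧
    ∫ ω, |∑ g ∈ (properAssignments ι L).filter (fun g => block g l = A),
      decompCoeff μ ξ c L k g * blockProd (truncBlock μ S ξ T) ξ (L.erase l) g ω| ∂μ
      ≤ √((Fintype.card ι + 1) ^ Fintype.card ι * (K ^ 2 * V ^ Fintype.card ι *
        (1 + Λ) ^ Fintype.card ι)) * (|c r₁ (k - l)| * |c r₂ (k - l)|) := by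
  have hΛ := hc.one_le
  set G := (properAssignments ι L).filter (fun g => block g l = A) with hG
  have hlv : ∀ g ∈ G, l ∈ values g := fun g hg => by
    have : r₁ ∈ block g l := by rw [(Finset.mem_filter.1 hg).2]; exact hr₁
    exact mem_values.2 ⟨r₁, mem_block.1 this⟩
  -- Every `g ∈ G` takes the value `l`, so erasing `l` cannot hide a difference between two value
  -- sets.
  obtain ⟨i0, l0⟩ := h.integral_sq_sum_blockProd_le (measurable_truncBlock T) hV2
    (fun A hA => h.integral_truncBlock T hA) (truncBlock_empty T)
    (L := L.erase l) (G := G) (by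
      intro g hg g' hg' hne
      have hne' : ∃ l, ¬ (l ∈ values g ↔ l ∈ values g') := by
        by_contra hcon
        push Not at hcon
        exact hne (Finset.ext hcon)
      obtain ⟨l', hl'⟩ := hne'
      have hsub : ∀ g ∈ G, values g ⊆ L := fun g hg =>
        values_subset (Finset.mem_of_mem_erase (Finset.mem_filter.1 hg).1)
      refine ⟨l', Finset.mem_erase.2 ⟨?_, ?_⟩, hl'⟩
      · rintro rfl
        exact hl' ⟨fun _ => hlv g' hg', fun _ => hlv g hg⟩
      · by_contra hlL
        exact hl' ⟨fun hh => absurd (hsub g hg hh) hlL, fun hh => absurd (hsub g' hg' hh) hlL⟩)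
    (decompCoeff μ ξ c L k)
  have hmeas : Measurable (fun ω => ∑ g ∈ G,
      decompCoeff μ ξ c L k g * blockProd (truncBlock μ S ξ T) ξ (L.erase l) g ω) :=
    Finset.measurable_fun_sum _ fun _ _ =>
      (h.measurable_blockProd (measurable_truncBlock T) _ _).const_mul _
  refine integral_abs_le_of_integral_sq_le hmeas i0 (by positivity) (l0.trans ?_)
  have hsq : ∀ g ∈ G, ∫ ω, blockProd (truncBlock μ S ξ T) ξ (L.erase l) g ω ^ 2 ∂μ
      ≤ V ^ Fintype.card ι := by
    intro g hg
    rw [h.integral_blockProd_sq (measurable_truncBlock T)]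
    have hlight : ∀ l' ∈ L.erase l, ¬ S < 2 * (block g l').card := fun l' hl' hlt =>
      Finset.ne_of_mem_erase hl' (eq_of_heavy h.card_le hlt
        (by rw [(Finset.mem_filter.1 hg).2]; exact hA))
    calc _ ≤ ∏ l' ∈ L.erase l, V ^ (block g l').card :=
          Finset.prod_le_prod (fun l _ => integral_nonneg fun ω => sq_nonneg _)
            fun l' hl' => hV _ (hlight l' hl')
      _ ≤ _ := by
          rw [Finset.prod_pow_eq_pow_sum]
          exact pow_le_pow_right₀ hV1 (sum_card_block_le _ g)
  have hsum : ∑ g ∈ G, decompCoeff μ ξ c L k g ^ 2 *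
      ∫ ω, blockProd (truncBlock μ S ξ T) ξ (L.erase l) g ω ^ 2 ∂μ
      ≤ K ^ 2 * V ^ Fintype.card ι * ((1 + Λ) ^ Fintype.card ι *
        ((|c r₁ (k - l)| * |c r₂ (k - l)|) * (|c r₁ (k - l)| * |c r₂ (k - l)|))) := by
    calc _ ≤ ∑ g ∈ G, (K ^ 2 * V ^ Fintype.card ι) *
          (|weight (coeffAt c k) g| * |weight (coeffAt c k) g|) := by
          refine Finset.sum_le_sum fun g hg => ?_
          have h3 : decompCoeff μ ξ c L k g ^ 2
              ≤ K ^ 2 * (|weight (coeffAt c k) g| * |weight (coeffAt c k) g|) := by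
            rw [decompCoeff, mul_pow, ← sq_abs, ← sq_abs (freeCoeff _ _ _ _), ← sq, mul_comm]
            gcongr
            exact hK g
          calc _ ≤ K ^ 2 * (|weight (coeffAt c k) g| * |weight (coeffAt c k) g|) *
                V ^ Fintype.card ι :=
                mul_le_mul h3 (hsq g hg) (integral_nonneg fun ω => sq_nonneg _) (by positivity)
            _ = _ := by ring
      _ = K ^ 2 * V ^ Fintype.card ι * ∑ g ∈ G,
          (|weight (coeffAt c k) g| * |weight (coeffAt c k) g|) := by rw [Finset.mul_sum]
      _ ≤ K ^ 2 * V ^ Fintype.card ι *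
          ∑ g ∈ (assignments ι L).filter (fun g => g r₁ = some l ∧ g r₂ = some l),
          (|weight (coeffAt c k) g| * |weight (coeffAt c k) g|) := by
          refine mul_le_mul_of_nonneg_left ?_ (by positivity)
          refine Finset.sum_le_sum_of_subset_of_nonneg (fun g hg => ?_) fun g _ _ => by positivity
          obtain ⟨hg1, hg2⟩ := Finset.mem_filter.1 hg
          rw [← hg2, mem_block] at hr₁ hr₂
          exact Finset.mem_filter.2 ⟨Finset.mem_of_mem_erase hg1, hr₁, hr₂⟩
      _ ≤ _ := by
          gcongr
          exact hc.sum_weight_mul_of_pair_le hne L k k l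
  calc _ ≤ (Fintype.card ι + 1 : ℝ) ^ Fintype.card ι * (K ^ 2 * V ^ Fintype.card ι *
        ((1 + Λ) ^ Fintype.card ι *
        ((|c r₁ (k - l)| * |c r₂ (k - l)|) * (|c r₁ (k - l)| * |c r₂ (k - l)|)))) := by gcongr
    _ = _ := by
        rw [mul_pow, Real.sq_sqrt (by positivity)]
        ring

lemma remainder_eq (L : Finset ℤ) (T : ℝ) (k : ℤ) (ω : Ω) :
    remainder μ S ξ c L T k ω = ∑ l ∈ L, ∑ A : Finset ι,
      (centredBlock μ ξ A (ξ l ω) - truncBlock μ S ξ T A (ξ l ω)) *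
      ∑ g ∈ (properAssignments ι L).filter (fun g => block g l = A),
        decompCoeff μ ξ c L k g * blockProd (truncBlock μ S ξ T) ξ (L.erase l) g ω := by
  simp only [remainder, blockProd_centred_sub_trunc h.card_le, Finset.mul_sum]
  rw [Finset.sum_comm]
  refine Finset.sum_congr rfl fun l _ => ?_
  rw [← Finset.sum_fiberwise (properAssignments ι L) (fun g => block g l)]
  refine Finset.sum_congr rfl fun A _ => Finset.sum_congr rfl fun g hg => ?_
  rw [(Finset.mem_filter.1 hg).2]
  ring

lemma indepFun_blockRest (φ : Finset ι → (ι → ℝ) → ℝ) (hφ : ∀ A, Measurable (φ A))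
    (b : (ι → Option ℤ) → ℝ) (G : Finset (ι → Option ℤ)) (L : Finset ℤ) (l : ℤ)
    {ψ : (ι → ℝ) → ℝ} (hψ : Measurable ψ) :
    IndepFun (fun ω => ψ (ξ l ω)) (fun ω => ∑ g ∈ G, b g * blockProd φ ξ (L.erase l) g ω) μ := by
  have h1 := h.indep.indepFun_finset {l} (L.erase l) (by simp) h.measurable
  have h2 := h1.comp (φ := fun v : ↥({l} : Finset ℤ) → ι → ℝ => ψ (v ⟨l, by simp⟩))
    (ψ := fun v : ↥(L.erase l) → ι → ℝ =>
      ∑ g ∈ G, b g * ∏ l' : ↥(L.erase l), φ (block g l') (v l'))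
    (hψ.comp (measurable_pi_apply _))
    (Finset.measurable_fun_sum _ fun g _ => (Finset.measurable_fun_prod _ fun l' _ =>
      (hφ _).comp (measurable_pi_apply l')).const_mul _)
  have e : ∀ g ω, blockProd φ ξ (L.erase l) g ω
      = ∏ l' : ↥(L.erase l), φ (block g l') (ξ l' ω) := fun g ω =>
    (Finset.prod_coe_sort (L.erase l) (fun l' => φ (block g l') (ξ l' ω))).symm
  simp only [e]
  exact h2

include hc in
-- The truncation error of a heavy block at `l` is independent of the factors at the other indices,
-- so first moments multiply. The rest has first moment of order `|c r₁ (k - l)| * |c r₂ (k - l)|`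
-- for two coordinates of the block, which is summable in `l` uniformly in `k`.
lemma exists_integral_abs_remainder_le {q : ℝ} (hq1 : 1 ≤ q) (hq2 : q ≤ 2)
    (hheavy : ∀ A : Finset ι, S < 2 * A.card →
      Integrable (fun ω => |∏ r ∈ A, ξ 1 ω r| ^ q) μ) :
    ∃ C : ℝ, 0 ≤ C ∧ ∀ (L : Finset ℤ) (T : ℝ), 1 ≤ T → ∀ k : ℤ,
      Integrable (remainder μ S ξ c L T k) μ ∧
      ∫ ω, |remainder μ S ξ c L T k ω| ∂μ ≤ C * T ^ (1 - q) := by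
  obtain ⟨V, hV1, hV⟩ := h.exists_truncBlock_le hq1 hq2 hheavy
  obtain ⟨K, hK0, hK⟩ := h.exists_abs_freeCoeff_le hc
  have hΛ := hc.one_le
  set t : ℝ := √((Fintype.card ι + 1) ^ Fintype.card ι * (K ^ 2 * V ^ Fintype.card ι *
        (1 + Λ) ^ Fintype.card ι)) with ht
  refine ⟨Fintype.card (Finset ι) * (2 * V * t * Λ), by positivity, fun L T hT k => ?_⟩
  have hT0 : 0 < T := by linarith
  set R : Finset ι → ℤ → Ω → ℝ := fun A l ω =>
    (centredBlock μ ξ A (ξ l ω) - truncBlock μ S ξ T A (ξ l ω)) *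
      ∑ g ∈ (properAssignments ι L).filter (fun g => block g l = A),
        decompCoeff μ ξ c L k g * blockProd (truncBlock μ S ξ T) ξ (L.erase l) g ω with hR
  have hRA : ∀ A : Finset ι, (∀ l, Integrable (R A l) μ) ∧
      ∑ l ∈ L, ∫ ω, |R A l ω| ∂μ ≤ 2 * V * t * Λ * T ^ (1 - q) := by
    intro A
    by_cases hA : S < 2 * A.card
    · have h2 := h.two_le
      obtain ⟨r₁, hr₁, r₂, hr₂, hne⟩ := Finset.one_lt_card.1 (show 1 < A.card by omega)
      have hψ : Measurable fun v => centredBlock μ ξ A v - truncBlock μ S ξ T A v :=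
        (measurable_centredBlock A).sub (measurable_truncBlock T A)
      have key : ∀ l, Integrable (R A l) μ ∧ ∫ ω, |R A l ω| ∂μ
          ≤ (2 * V * T ^ (1 - q)) * (t * (|c r₁ (k - l)| * |c r₂ (k - l)|)) := by
        intro l
        obtain ⟨i1, l1⟩ := h.integral_abs_blockRest_le hV1 (fun A => (hV T hT A).1)
          (fun A hA => by simpa [hA] using (hV T hT A).2.1) hc (hK L k) hA hr₁ hr₂ hne l
        have ind := h.indepFun_blockRest (truncBlock μ S ξ T) (measurable_truncBlock T)
          (decompCoeff μ ξ c L k) ((properAssignments ι L).filter (fun g => block g l = A)) L l hψ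
        have i2 := h.integrable_comp l hψ (hV T hT A).2.2.1
        have l2 : ∫ ω, |centredBlock μ ξ A (ξ l ω) - truncBlock μ S ξ T A (ξ l ω)| ∂μ
            ≤ 2 * V * T ^ (1 - q) := by
          rw [h.integral_comp l (ψ := fun v => |centredBlock μ ξ A v - truncBlock μ S ξ T A v|)
            (by fun_prop)]
          exact (hV T hT A).2.2.2
        refine ⟨ind.integrable_mul i2 i1, ?_⟩
        simp only [hR, abs_mul]
        have ind' := ind.comp (φ := fun x : ℝ => |x|) (ψ := fun x : ℝ => |x|) (by fun_prop)
          (by fun_prop)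
        have := ind'.integral_fun_mul_eq_mul_integral i2.abs.aestronglyMeasurable
          i1.abs.aestronglyMeasurable
        simp only [Function.comp] at this
        rw [this]
        exact mul_le_mul l2 l1 (integral_nonneg fun ω => abs_nonneg _) (by positivity)
      refine ⟨fun l => (key l).1, (Finset.sum_le_sum fun l _ => (key l).2).trans ?_⟩
      rw [← Finset.mul_sum, ← Finset.mul_sum]
      have := hc.sum_abs_mul_abs_le r₁ r₂ L k
      calc _ ≤ (2 * V * T ^ (1 - q)) * (t * Λ) := by gcongr
        _ = _ := by ring
    · have hz : R A = fun _ _ => 0 := by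
        ext l ω; simp [hR, truncBlock_of_le hA]
      rw [hz]
      refine ⟨fun l => integrable_const 0, ?_⟩
      simp only [abs_zero, integral_zero, Finset.sum_const_zero]
      positivity
  have hrem : remainder μ S ξ c L T k = fun ω => ∑ l ∈ L, ∑ A : Finset ι, R A l ω := by
    ext ω; exact h.remainder_eq L T k ω
  have hint : Integrable (fun ω => ∑ l ∈ L, ∑ A : Finset ι, R A l ω) μ :=
    integrable_finsetSum _ fun l _ => integrable_finsetSum _ fun A _ => (hRA A).1 l
  rw [hrem]
  refine ⟨hint, ?_⟩
  calc ∫ ω, |∑ l ∈ L, ∑ A : Finset ι, R A l ω| ∂μ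
      ≤ ∫ ω, ∑ l ∈ L, ∑ A : Finset ι, |R A l ω| ∂μ :=
        integral_mono hint.abs (integrable_finsetSum _ fun l _ => integrable_finsetSum _
          fun A _ => ((hRA A).1 l).abs) fun ω => (Finset.abs_sum_le_sum_abs _ _).trans
            (Finset.sum_le_sum fun l _ => Finset.abs_sum_le_sum_abs _ _)
    _ = ∑ A : Finset ι, ∑ l ∈ L, ∫ ω, |R A l ω| ∂μ := by
        rw [integral_finsetSum _ fun l _ => integrable_finsetSum _ fun A _ => ((hRA A).1 l).abs]
        rw [Finset.sum_comm]
        refine Finset.sum_congr rfl fun l _ => ?_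
        rw [integral_finsetSum _ fun A _ => ((hRA A).1 l).abs]
    _ ≤ ∑ _A : Finset ι, 2 * V * t * Λ * T ^ (1 - q) := Finset.sum_le_sum fun A _ => (hRA A).2
    _ = _ := by rw [Finset.sum_const, nsmul_eq_mul, Finset.card_univ]; ring

end IsInnovation

end Split

/-! ### Tail bounds and the Borel–Cantelli argument -/

section Tail

variable {Ω ι : Type*} [MeasurableSpace Ω] {μ : Measure Ω} [IsProbabilityMeasure μ] [Fintype ι]
  [DecidableEq ι] {S : ℕ} {ξ : ℤ → Ω → ι → ℝ}

/-- The centred partial sums of the products with innovations restricted to `L`. -/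
def restrictedSum (μ : Measure Ω) (c : ι → ℤ → ℝ) (ξ : ℤ → Ω → ι → ℝ) (L : Finset ℤ) (n : ℕ)
    (ω : Ω) : ℝ :=
  ∑ i ∈ Finset.range n, (restrictedProd c ξ L ((1 + i : ℕ) : ℤ) ω
    - ∫ ω', restrictedProd c ξ L ((1 + i : ℕ) : ℤ) ω' ∂μ)

lemma measureReal_le_div {f : Ω → ℝ} (hf : ∀ ω, 0 ≤ f ω) (hi : Integrable f μ) {ε B : ℝ}
    (hε : 0 < ε) (hB : ∫ ω, f ω ∂μ ≤ B) : μ.real {ω | ε ≤ f ω} ≤ B / ε := by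
  rw [le_div_iff₀ hε, mul_comm]
  exact (mul_meas_ge_le_integral_of_nonneg (ae_of_all _ hf) hi ε).trans hB

lemma summable_geometric_bound {r₁ r₂ : ℝ} (h1 : 0 ≤ r₁) (h1' : r₁ < 1) (h2 : 0 ≤ r₂)
    (h2' : r₂ < 1) (C D : ℝ) :
    Summable fun j : ℕ => C * ((j : ℝ) ^ 2 * (r₁ ^ j + r₂ ^ j)) + D * r₂ ^ j := by
  have s1 := summable_pow_mul_geometric_of_norm_lt_one (R := ℝ) 2 (r := r₁)
    (by rwa [Real.norm_of_nonneg h1])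
  have s2 := summable_pow_mul_geometric_of_norm_lt_one (R := ℝ) 2 (r := r₂)
    (by rwa [Real.norm_of_nonneg h2])
  have s3 := summable_geometric_of_lt_one h2 h2'
  refine (((s1.add s2).mul_left C).add (s3.mul_left D)).congr fun j => ?_
  ring

namespace IsInnovation

variable (h : IsInnovation μ S ξ) {c : ι → ℤ → ℝ} {κ : ι → ℝ} {Λ : ℝ} (hc : IsDecaying c κ Λ)
include h hc

/-- Chebyshev for the dyadic maximal function of the main part, Markov for the sum of absolute
remainders. Truncating at the normalisation `T = (2 ^ j) ^ (1 / p)` makes both heavy contributions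
scale as `(2 ^ j) ^ (1 - q / p)`. -/
lemma exists_measureReal_restrictedSum_le {p q β : ℝ} (hp : 0 < p) (hq1 : 1 ≤ q) (hq2 : q ≤ 2)
    (hβ1 : 1 ≤ β)
    (hβ : ∀ D : Finset ι, D.Nonempty → Dᶜ.card ≠ 1 → 2 - ∑ r ∈ D, κ r < β)
    (hheavy : ∀ A : Finset ι, S < 2 * A.card →
      Integrable (fun ω => |∏ r ∈ A, ξ 1 ω r| ^ q) μ) :
    ∃ C : ℝ, 0 ≤ C ∧ ∀ (ε : ℝ), 0 < ε → ∀ (L : Finset ℤ) (j : ℕ),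
      μ.real {ω | ∃ n < 2 ^ j, 2 * (ε * ((2 : ℝ) ^ j) ^ (1 / p)) < |restrictedSum μ c ξ L n ω|}
        ≤ C / ε ^ 2 * ((j : ℝ) ^ 2 * (((2 : ℝ) ^ (β - 2 / p)) ^ j + ((2 : ℝ) ^ (1 - q / p)) ^ j))
          + C / ε * ((2 : ℝ) ^ (1 - q / p)) ^ j := by
  obtain ⟨C₁, hC₁, h1⟩ := h.exists_integral_sq_mainPart_le hc hq1 hq2 hβ1 hβ hheavy
  obtain ⟨C₂, hC₂, h2⟩ := h.exists_integral_abs_remainder_le hc hq1 hq2 hheavy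
  refine ⟨C₁ + C₂, by positivity, fun ε hε L j => ?_⟩
  set u : ℝ := (2 : ℝ) ^ j with hu
  have hu1 : 1 ≤ u := one_le_pow₀ (by norm_num)
  have hu0 : 0 < u := by linarith
  set T : ℝ := u ^ (1 / p) with hT
  have hT1 : 1 ≤ T := Real.one_le_rpow hu1 (by positivity)
  have hT0 : 0 < T := by linarith
  set y : ℕ → Ω → ℝ := fun k => mainPart μ S ξ c L T k with hy
  obtain ⟨iQ, lQ⟩ := integral_dyadicSq_le (μ := μ) y hβ1 hC₁
    (by positivity : 0 ≤ C₁ * T ^ (2 - q)) (fun a n => (h1 L T hT1 a n).1)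
    (fun a n => (h1 L T hT1 a n).2) j 1
  set Q : Ω → ℝ := fun ω => j * dyadicSq (fun k => y k ω) j 1 with hQ
  set Z : Ω → ℝ := fun ω => ∑ i ∈ Finset.range (2 ^ j),
    |remainder μ S ξ c L T ((1 + i : ℕ) : ℤ) ω| with hZ
  have iZ : Integrable Z μ := integrable_finsetSum _ fun i _ => (h2 L T hT1 _).1.abs
  have lZ : ∫ ω, Z ω ∂μ ≤ u * (C₂ * T ^ (1 - q)) := by
    rw [hZ, integral_finsetSum _ fun i _ => (h2 L T hT1 _).1.abs]
    refine (Finset.sum_le_sum fun i _ => (h2 L T hT1 _).2).trans (le_of_eq ?_)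
    rw [Finset.sum_const, Finset.card_range, nsmul_eq_mul]; push_cast; rfl
  have lQ' : ∫ ω, Q ω ∂μ ≤ j * (j * (C₁ * u ^ β + C₁ * T ^ (2 - q) * u)) := by
    rw [hQ, integral_const_mul]
    gcongr
  have hsub : {ω | ∃ n < 2 ^ j, 2 * (ε * T) < |restrictedSum μ c ξ L n ω|}
      ⊆ {ω | (ε * T) ^ 2 ≤ Q ω} ∪ {ω | ε * T ≤ Z ω} := by
    rintro ω ⟨n, hn, hlt⟩
    by_contra hcon
    simp only [Set.mem_union, Set.mem_ofPred_eq, not_or, not_le] at hcon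
    obtain ⟨hcQ, hcZ⟩ := hcon
    have e : restrictedSum μ c ξ L n ω = ∑ i ∈ Finset.range n, y (1 + i) ω
        + ∑ i ∈ Finset.range n, remainder μ S ξ c L T ((1 + i : ℕ) : ℤ) ω := by
      rw [restrictedSum, ← Finset.sum_add_distrib]
      exact Finset.sum_congr rfl fun i _ => h.restrictedProd_sub_integral_eq L T _ ω
    have b1 : |∑ i ∈ Finset.range n, y (1 + i) ω| < ε * T :=
      abs_lt_of_sq_lt_sq ((sq_sum_range_le_dyadicSq (fun k => y k ω) j 1 n hn).trans_lt hcQ)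
        (by positivity)
    have b2 : |∑ i ∈ Finset.range n, remainder μ S ξ c L T ((1 + i : ℕ) : ℤ) ω| < ε * T := by
      refine ((Finset.abs_sum_le_sum_abs _ _).trans ?_).trans_lt hcZ
      exact Finset.sum_le_sum_of_subset_of_nonneg (Finset.range_subset_range.2 hn.le)
        fun i _ _ => abs_nonneg _
    rw [e] at hlt
    linarith [abs_add_le (∑ i ∈ Finset.range n, y (1 + i) ω)
      (∑ i ∈ Finset.range n, remainder μ S ξ c L T ((1 + i : ℕ) : ℤ) ω)]
  have m1 := measureReal_le_div (μ := μ) (f := Q)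
    (fun ω => mul_nonneg (Nat.cast_nonneg j) (dyadicSq_nonneg _ _ _)) (iQ.const_mul _)
    (by positivity : 0 < (ε * T) ^ 2) lQ'
  have m2 := measureReal_le_div (μ := μ) (f := Z)
    (fun ω => Finset.sum_nonneg fun i _ => abs_nonneg _) iZ (by positivity : 0 < ε * T) lZ
  have hpow : ∀ a : ℝ, ((2 : ℝ) ^ a) ^ j = u ^ a := fun a => by
    rw [hu, ← Real.rpow_natCast, ← Real.rpow_natCast, ← Real.rpow_mul (by norm_num),
      ← Real.rpow_mul (by norm_num), mul_comm]
  have hTa : ∀ a : ℝ, T ^ a = u ^ (a / p) := fun a => by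
    rw [hT, ← Real.rpow_mul hu0.le]; ring_nf
  have e1 : u ^ β / T ^ 2 = u ^ (β - 2 / p) := by
    rw [Real.rpow_sub hu0, ← hTa]; norm_num
  have e2 : T ^ (2 - q) * u / T ^ 2 = u ^ (1 - q / p) := by
    rw [Real.rpow_sub hu0, Real.rpow_one, ← hTa, Real.rpow_sub hT0]
    norm_num
    field_simp
  have e3 : u * T ^ (1 - q) / T = u ^ (1 - q / p) := by
    rw [Real.rpow_sub hu0, Real.rpow_one, ← hTa, Real.rpow_sub hT0, Real.rpow_one]
    field_simp
  rw [hpow, hpow]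
  calc _ ≤ μ.real ({ω | (ε * T) ^ 2 ≤ Q ω} ∪ {ω | ε * T ≤ Z ω}) := measureReal_mono hsub
    _ ≤ _ := measureReal_union_le _ _
    _ ≤ _ := add_le_add m1 m2
    _ = C₁ / ε ^ 2 * ((j : ℝ) ^ 2 * (u ^ β / T ^ 2 + T ^ (2 - q) * u / T ^ 2))
        + C₂ / ε * (u * T ^ (1 - q) / T) := by
        rw [mul_pow]; field_simp
    _ ≤ _ := by
        rw [e1, e2, e3]
        gcongr <;> linarith

end IsInnovation

/-- If the tail bounds hold uniformly along an approximating sequence, they hold for the limit. -/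
lemma measure_le_of_ae_eventually {A : Set Ω} {B : ℕ → Set Ω} {b : ENNReal}
    (hAB : ∀ᵐ ω ∂μ, ω ∈ A → ∀ᶠ N in atTop, ω ∈ B N) (hb : ∀ N, μ (B N) ≤ b) : μ A ≤ b := by
  have h1 : μ A ≤ μ (⋃ M, ⋂ N, ⋂ (_ : M ≤ N), B N) := by
    refine measure_mono_ae ?_
    filter_upwards [hAB] with ω hω hA
    obtain ⟨M, hM⟩ := eventually_atTop.1 (hω hA)
    exact Set.mem_iUnion.2 ⟨M, Set.mem_iInter₂.2 hM⟩
  refine h1.trans ?_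
  rw [Monotone.measure_iUnion]
  · exact iSup_le fun M => (measure_mono (Set.iInter₂_subset M le_rfl)).trans (hb M)
  · intro M M' hMM' ω hω
    exact Set.mem_iInter₂.2 fun N hN => Set.mem_iInter₂.1 hω N (hMM'.trans hN)

/-- Summable dyadic tail bounds imply a strong law with rate `n ^ (1 / p)`. -/
lemma ae_tendsto_of_summable_measure {p : ℝ} (hp : 0 < p) {Z : ℕ → Ω → ℝ}
    (hZ : ∀ ε : ℝ, 0 < ε → ∃ b : ℕ → ℝ, Summable b ∧ ∀ j : ℕ,
      μ {ω | ∃ n < 2 ^ j, ε * ((2 : ℝ) ^ j) ^ (1 / p) < |Z n ω|} ≤ ENNReal.ofReal (b j)) :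
    ∀ᵐ ω ∂μ, Tendsto (fun n : ℕ => (n : ℝ) ^ (-(1 / p)) * Z n ω) atTop (𝓝 0) := by
  have h1 : ∀ m : ℕ, ∀ᵐ ω ∂μ, ∀ᶠ j in atTop, ∀ n < 2 ^ j,
      |Z n ω| ≤ 1 / ((m : ℝ) + 1) * ((2 : ℝ) ^ j) ^ (1 / p) := by
    intro m
    obtain ⟨b, hb, hle⟩ := hZ (1 / ((m : ℝ) + 1)) (by positivity)
    have hsum : ∑' j, μ {ω | ∃ n < 2 ^ j,
        1 / ((m : ℝ) + 1) * ((2 : ℝ) ^ j) ^ (1 / p) < |Z n ω|} ≠ ⊤ :=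
      ((ENNReal.tsum_le_tsum hle).trans_lt hb.tsum_ofReal_lt_top).ne
    filter_upwards [ae_eventually_notMem hsum] with ω hω
    filter_upwards [hω] with j hj n hn
    by_contra hcon
    exact hj ⟨n, hn, not_le.1 hcon⟩
  filter_upwards [ae_all_iff.2 h1] with ω hω
  rw [Metric.tendsto_atTop]
  intro ε hε
  -- With `j = Nat.log 2 n + 1` one has `n < 2 ^ j ≤ 2 * n`; dividing `ε` by `2 ^ (1 / p)` pays for
  -- replacing `2 ^ j` by `n`.
  obtain ⟨m, hm⟩ := exists_nat_one_div_lt (show 0 < ε / 2 ^ (1 / p) by positivity)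
  obtain ⟨J, hJ⟩ := eventually_atTop.1 (hω m)
  refine ⟨2 ^ J, fun n hn => ?_⟩
  have hn0 : 0 < n := (pow_pos (by norm_num) J).trans_le hn
  have hn0' : (0 : ℝ) < n := by exact_mod_cast hn0
  have hlog := Nat.lt_pow_succ_log_self (b := 2) (by norm_num) n
  have hlog' := Nat.pow_log_le_self 2 hn0.ne'
  have hJlog : J ≤ Nat.log 2 n + 1 := by
    have := Nat.le_log_of_pow_le (b := 2) (by norm_num) hn
    omega
  have hb := hJ _ hJlog n hlog
  have h2n : ((2 : ℝ) ^ (Nat.log 2 n + 1)) ^ (1 / p) ≤ 2 ^ (1 / p) * (n : ℝ) ^ (1 / p) := by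
    rw [← Real.mul_rpow (by norm_num) hn0'.le]
    refine Real.rpow_le_rpow (by positivity) ?_ (by positivity)
    rw [pow_succ, mul_comm]
    have : ((2 : ℝ) ^ (Nat.log 2 n)) ≤ n := by exact_mod_cast hlog'
    linarith
  rw [Real.dist_eq, sub_zero, abs_mul, abs_of_pos (Real.rpow_pos_of_pos hn0' _),
    Real.rpow_neg hn0'.le, inv_mul_lt_iff₀ (by positivity), mul_comm]
  rw [lt_div_iff₀ (by positivity)] at hm
  calc |Z n ω| ≤ 1 / ((m : ℝ) + 1) * (2 ^ (1 / p) * (n : ℝ) ^ (1 / p)) := hb.trans (by gcongr)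
    _ = 1 / ((m : ℝ) + 1) * 2 ^ (1 / p) * (n : ℝ) ^ (1 / p) := by ring
    _ < ε * (n : ℝ) ^ (1 / p) := by gcongr

end Tail

/-! ### Convergence of the two-sided series -/

section Convergence

variable {Ω ι : Type*} [MeasurableSpace Ω] {μ : Measure Ω} [IsProbabilityMeasure μ] [Fintype ι]
  [DecidableEq ι] {S : ℕ} {ξ : ℤ → Ω → ι → ℝ}

/-- The partial sums form a martingale bounded in mean, to which Doob's convergence theorem applies.
-/
lemma ae_exists_tendsto_sum_range {η : ℕ → Ω → ℝ} (hmeas : ∀ i, Measurable (η i))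
    (hind : iIndepFun η μ) (hint : ∀ i, Integrable (η i) μ) (hmean : ∀ i, ∫ ω, η i ω ∂μ = 0)
    {B : ℝ} (hB : ∀ n, ∫ ω, |∑ i ∈ Finset.range n, η i ω| ∂μ ≤ B) :
    ∀ᵐ ω ∂μ, ∃ x, Tendsto (fun n => ∑ i ∈ Finset.range n, η i ω) atTop (𝓝 x) := by
  have hsm : ∀ i, StronglyMeasurable (η i) := fun i => (hmeas i).stronglyMeasurable
  set 𝒢 := Filtration.natural η hsm with h𝒢
  -- The natural filtration at `n` already contains `η n`, hence the shift to `n + 1` summands.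
  set f : ℕ → Ω → ℝ := fun n ω => ∑ i ∈ Finset.range (n + 1), η i ω with hf
  have hfi : ∀ n, Integrable (f n) μ := fun n => integrable_finsetSum _ fun i _ => hint i
  have hadp : StronglyAdapted 𝒢 f := fun n => by
    refine Finset.stronglyMeasurable_fun_sum _ fun i hi => ?_
    exact ((Filtration.stronglyAdapted_natural hsm) i).mono
      (𝒢.mono (Nat.lt_succ_iff.1 (Finset.mem_range.1 hi)))
  have hmart : Martingale f 𝒢 μ := by
    refine martingale_of_condExp_sub_eq_zero_nat hadp hfi fun n => ?_
    have e : f (n + 1) - f n = η (n + 1) := by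
      ext ω; simp [hf, Finset.sum_range_succ _ (n + 1)]
    rw [e]
    refine (hind.condExp_natural_ae_eq_of_lt hsm (Nat.lt_succ_self n)).trans ?_
    rw [hmean]; rfl
  have hbdd : ∀ n, eLpNorm (f n) 1 μ ≤ (B.toNNReal : ENNReal) := fun n => by
    rw [eLpNorm_one_eq_lintegral_enorm, ← ofReal_integral_norm_eq_lintegral_enorm (hfi n)]
    exact ENNReal.ofReal_le_ofReal (hB (n + 1))
  filter_upwards [hmart.submartingale.exists_ae_tendsto_of_bdd hbdd] with ω ⟨x, hx⟩
  exact ⟨x, (tendsto_add_atTop_iff_nat (f := fun n => ∑ i ∈ Finset.range n, η i ω) 1).1 hx⟩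

lemma sum_Icc_neg_eq (u : ℤ → ℝ) (M N : ℕ) :
    ∑ l ∈ Finset.Icc (-(M : ℤ)) (N : ℤ), u l
      = ∑ i ∈ Finset.range M, u (-((i : ℤ) + 1)) + ∑ i ∈ Finset.range (N + 1), u i := by
  have h1 : Finset.Icc (-(M : ℤ)) (N : ℤ)
      = (Finset.range M).image (fun i : ℕ => -((i : ℤ) + 1))
        ∪ (Finset.range (N + 1)).image (fun i : ℕ => (i : ℤ)) := by
    ext l
    simp only [Finset.mem_Icc, Finset.mem_union, Finset.mem_image, Finset.mem_range]
    constructor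
    · rintro ⟨h1, h2⟩
      rcases lt_or_ge l 0 with h | h
      · exact Or.inl ⟨(-l - 1).toNat, by omega, by omega⟩
      · exact Or.inr ⟨l.toNat, by omega, by omega⟩
    · rintro (⟨i, hi, rfl⟩ | ⟨i, hi, rfl⟩) <;> constructor <;> omega
  rw [h1, Finset.sum_union, Finset.sum_image, Finset.sum_image]
  · intro x _ y _ hxy; simpa using hxy
  · intro x _ y _ hxy; simpa using hxy
  · rw [Finset.disjoint_left]
    simp only [Finset.mem_image, Finset.mem_range]
    rintro l ⟨i, _, rfl⟩ ⟨i', _, h⟩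
    omega

namespace IsInnovation

variable (h : IsInnovation μ S ξ)
include h

lemma integrable_apply (l : ℤ) (r : ι) : Integrable (fun ω => ξ l ω r) μ := by
  have := h.integrable_comp l (ψ := fun v => ∏ r' ∈ {r}, v r') (by fun_prop)
    (h.integrable_prod_apply {r})
  simpa using this

lemma ae_exists_tendsto_sum_comp (r : ι) {a : ℤ → ℝ} {Λ : ℝ}
    (ha : ∀ L : Finset ℤ, ∑ l ∈ L, a l ^ 2 ≤ Λ) {e : ℕ → ℤ} (he : Function.Injective e) :
    ∀ᵐ ω ∂μ, ∃ x, Tendsto (fun n => ∑ i ∈ Finset.range n, a (e i) * ξ (e i) ω r)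
      atTop (𝓝 x) := by
  obtain ⟨K, hK0, hK⟩ := h.exists_moment_sum_le
  have hΛ : 0 ≤ Λ := by simpa using ha ∅
  refine ae_exists_tendsto_sum_range (μ := μ) (η := fun i ω => a (e i) * ξ (e i) ω r)
    (B := 1 + K * (1 + Λ) ^ S) (fun i => (h.measurable_apply _ r).const_mul _) ?_
    (fun i => (h.integrable_apply _ r).const_mul _)
    (fun i => by rw [integral_const_mul, h.mean_apply, mul_zero]) fun n => ?_
  · exact ((h.iIndepFun_apply r).comp (fun l x => a l * x) fun l => by fun_prop).precomp he
  · have e1 : ∀ ω, ∑ i ∈ Finset.range n, a (e i) * ξ (e i) ω r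
        = ∑ l ∈ (Finset.range n).map ⟨e, he⟩, a l * ξ l ω r := fun ω => by
      rw [Finset.sum_map]; rfl
    simp only [e1]
    obtain ⟨i1, l1⟩ := hK r ((Finset.range n).map ⟨e, he⟩) a (1 + Λ) (by linarith)
      ((ha _).trans (by nlinarith))
    have := integral_abs_pow_le_of_le (h.measurable_sum a _ r).aestronglyMeasurable
      (show 1 ≤ S by have := h.two_le; omega) i1
    simp only [pow_one] at this
    linarith

/-- The sum splits into a function of `M` and a function of `N`, so convergence of the two one-sided
series gives the joint limit. -/
lemma ae_exists_tendsto_sum_Icc (r : ι) {a : ℤ → ℝ} {Λ : ℝ}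
    (ha : ∀ L : Finset ℤ, ∑ l ∈ L, a l ^ 2 ≤ Λ) :
    ∀ᵐ ω ∂μ, ∃ x, Tendsto (fun K : ℕ × ℕ => ∑ l ∈ Finset.Icc (-(K.1 : ℤ)) (K.2 : ℤ),
      a l * ξ l ω r) atTop (𝓝 x) := by
  filter_upwards [h.ae_exists_tendsto_sum_comp r ha (e := fun i => -((i : ℤ) + 1))
      fun x y hxy => by simpa using hxy,
    h.ae_exists_tendsto_sum_comp r ha (e := fun i => (i : ℤ)) fun x y hxy => by simpa using hxy]
    with ω ⟨x, hx⟩ ⟨y, hy⟩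
  refine ⟨x + y, ?_⟩
  simp only [sum_Icc_neg_eq (fun l => a l * ξ l ω r)]
  rw [← prod_atTop_atTop_eq]
  exact (hx.comp tendsto_fst).add
    (((tendsto_add_atTop_iff_nat 1).2 hy).comp tendsto_snd)

end IsInnovation

/-! ### Convergence of the products in mean -/

/-- Expanding the product, every nonempty choice of perturbed factors carries at least one `δ`; the
remaining mixed product is dominated by `S`-th powers. -/
lemma abs_prod_add_sub_prod_le (hS : Fintype.card ι ≤ S) (y z : ι → ℝ) {δ : ℝ} (hδ0 : 0 ≤ δ)
    (hδ1 : δ ≤ 1) : |∏ r, (δ * z r + y r) - ∏ r, y r|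
      ≤ δ * (Fintype.card (Finset ι) * (1 + ∑ r, (|y r| ^ S + |z r| ^ S))) := by
  rw [Finset.prod_add, ← Finset.add_sum_erase _ _ (Finset.empty_mem_powerset Finset.univ)]
  simp only [Finset.prod_empty, Finset.sdiff_empty, one_mul, add_sub_cancel_left]
  have hR : 0 ≤ 1 + ∑ r, (|y r| ^ S + |z r| ^ S) :=
    add_nonneg zero_le_one (Finset.sum_nonneg fun r _ => by positivity)
  have hterm : ∀ A ∈ (Finset.univ : Finset ι).powerset.erase ∅,
      |(∏ r ∈ A, δ * z r) * ∏ r ∈ Finset.univ \ A, y r|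
        ≤ δ * (1 + ∑ r, (|y r| ^ S + |z r| ^ S)) := by
    intro A hA
    have hne : A.card ≠ 0 := Finset.card_ne_zero.2
      (Finset.nonempty_iff_ne_empty.2 (Finset.ne_of_mem_erase hA))
    set w : ι → ℝ := fun r => if r ∈ A then z r else y r with hw
    have e1 : ∏ r, |w r| = (∏ r ∈ A, |z r|) * ∏ r ∈ Finset.univ \ A, |y r| := by
      rw [← Finset.prod_sdiff (Finset.subset_univ A), mul_comm]
      congr 1
      · exact Finset.prod_congr rfl fun r hr => by simp [hw, hr]
      · exact Finset.prod_congr rfl fun r hr => by simp [hw, (Finset.mem_sdiff.1 hr).2]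
    have e2 : |(∏ r ∈ A, δ * z r) * ∏ r ∈ Finset.univ \ A, y r| = δ ^ A.card * ∏ r, |w r| := by
      rw [e1, abs_mul, Finset.prod_mul_distrib, abs_mul, Finset.prod_const, Finset.abs_prod,
        Finset.abs_prod, abs_pow, abs_of_nonneg hδ0]
      ring
    rw [e2]
    refine mul_le_mul (pow_le_of_le_one hδ0 hδ1 hne) ?_
      (Finset.prod_nonneg fun r _ => abs_nonneg _) hδ0
    refine (prod_abs_le_one_add_sum_pow Finset.univ w (S := S) hS).trans ?_
    gcongr with r _
    simp only [hw]
    split_ifs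
    · linarith [pow_nonneg (abs_nonneg (y r)) S]
    · linarith [pow_nonneg (abs_nonneg (z r)) S]
  calc _ ≤ ∑ A ∈ (Finset.univ : Finset ι).powerset.erase ∅,
        |(∏ r ∈ A, δ * z r) * ∏ r ∈ Finset.univ \ A, y r| := Finset.abs_sum_le_sum_abs _ _
    _ ≤ ∑ _A ∈ (Finset.univ : Finset ι).powerset.erase ∅,
        δ * (1 + ∑ r, (|y r| ^ S + |z r| ^ S)) := Finset.sum_le_sum hterm
    _ ≤ ∑ _A : Finset ι, δ * (1 + ∑ r, (|y r| ^ S + |z r| ^ S)) :=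
        Finset.sum_le_sum_of_subset_of_nonneg (Finset.subset_univ _)
          fun _ _ _ => mul_nonneg hδ0 hR
    _ = _ := by rw [Finset.sum_const, nsmul_eq_mul, Finset.card_univ]; ring

/-- The symmetric index window `[-N, N]`. -/
def window (N : ℕ) : Finset ℤ := Finset.Icc (-(N : ℤ)) (N : ℤ)

lemma window_subset {N M : ℕ} (hNM : N ≤ M) : window N ⊆ window M :=
  Finset.Icc_subset_Icc (by omega) (by omega)

namespace IsInnovation

variable (h : IsInnovation μ S ξ) {c : ι → ℤ → ℝ} {κ : ι → ℝ} {Λ : ℝ} (hc : IsDecaying c κ Λ)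
include h hc

lemma integrable_restrictedProd (L : Finset ℤ) (k : ℤ) : Integrable (restrictedProd c ξ L k) μ := by
  obtain ⟨K, -, hK⟩ := h.exists_integral_prod_sum_le Λ
  exact (hK Finset.univ L (coeffAt c k) fun r => hc.sum_sq_le r L k).1

/-- The added innovations, divided by `δ`, have weights of square sum at most `1` and so bounded
`S`-th moments. This is the Cauchy estimate behind convergence in mean of the truncated products. -/
lemma exists_integral_abs_restrictedProd_sub_le : ∃ C : ℝ, 0 ≤ C ∧ ∀ (k : ℤ) (L L' : Finset ℤ)
    (δ : ℝ), L ⊆ L' → 0 < δ → δ ≤ 1 → (∀ r, ∑ l ∈ L' \ L, c r (k - l) ^ 2 ≤ δ ^ 2) →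
    ∫ ω, |restrictedProd c ξ L' k ω - restrictedProd c ξ L k ω| ∂μ ≤ C * δ := by
  obtain ⟨K, hK0, hK⟩ := h.exists_moment_sum_le
  have hΛ := hc.one_le
  refine ⟨Fintype.card (Finset ι) * (1 + ∑ _r : ι, (K * Λ ^ S + K)), by positivity,
    fun k L L' δ hsub hδ0 hδ1 hδ => ?_⟩
  set y : ι → Ω → ℝ := fun r ω => ∑ l ∈ L, c r (k - l) * ξ l ω r with hy
  set z : ι → Ω → ℝ := fun r ω => ∑ l ∈ L' \ L, (c r (k - l) / δ) * ξ l ω r with hz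
  have hyS : ∀ r, Integrable (fun ω => |y r ω| ^ S) μ ∧ ∫ ω, |y r ω| ^ S ∂μ ≤ K * Λ ^ S :=
    fun r => hK r L (fun l => c r (k - l)) Λ (by linarith)
      ((hc.sum_sq_le r L k).trans (by nlinarith))
  have hzS : ∀ r, Integrable (fun ω => |z r ω| ^ S) μ ∧ ∫ ω, |z r ω| ^ S ∂μ ≤ K := fun r => by
    have := hK r (L' \ L) (fun l => c r (k - l) / δ) 1 one_pos (by
      simp only [div_pow]
      rw [← Finset.sum_div, div_le_iff₀ (by positivity)]
      simpa using hδ r)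
    simpa using this
  have e : ∀ ω, restrictedProd c ξ L' k ω = ∏ r, (δ * z r ω + y r ω) := fun ω => by
    refine Finset.prod_congr rfl fun r _ => ?_
    rw [← Finset.sum_sdiff hsub, hz, hy, Finset.mul_sum]
    congr 1
    refine Finset.sum_congr rfl fun l _ => ?_
    field_simp
  have hyz : ∀ r, Integrable (fun ω => |y r ω| ^ S + |z r ω| ^ S) μ := fun r =>
    (hyS r).1.add (hzS r).1
  have hsum : Integrable (fun ω => ∑ r, (|y r ω| ^ S + |z r ω| ^ S)) μ :=
    integrable_finsetSum _ fun r _ => hyz r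
  calc ∫ ω, |restrictedProd c ξ L' k ω - restrictedProd c ξ L k ω| ∂μ
      ≤ ∫ ω, δ * (Fintype.card (Finset ι) * (1 + ∑ r, (|y r ω| ^ S + |z r ω| ^ S))) ∂μ := by
        refine integral_mono ((h.integrable_restrictedProd hc L' k).sub
          (h.integrable_restrictedProd hc L k)).abs
          ((((integrable_const 1).add hsum).const_mul _).const_mul _) fun ω => ?_
        simp only [e ω]
        exact abs_prod_add_sub_prod_le h.card_le (fun r => y r ω) (fun r => z r ω) hδ0.le hδ1
    _ = δ * (Fintype.card (Finset ι) *
        (1 + ∑ r, (∫ ω, |y r ω| ^ S ∂μ + ∫ ω, |z r ω| ^ S ∂μ))) := by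
        rw [integral_const_mul, integral_const_mul, integral_add (integrable_const 1) hsum,
          integral_finsetSum _ fun r _ => hyz r]
        have : ∀ r, ∫ ω, (|y r ω| ^ S + |z r ω| ^ S) ∂μ
            = ∫ ω, |y r ω| ^ S ∂μ + ∫ ω, |z r ω| ^ S ∂μ := fun r =>
          integral_add (hyS r).1 (hzS r).1
        simp [this]
    _ ≤ δ * (Fintype.card (Finset ι) * (1 + ∑ _r : ι, (K * Λ ^ S + K))) := by
        gcongr with r _
        · exact (hyS r).2
        · exact (hzS r).2
    _ = _ := mul_comm _ _

omit h in
omit [IsProbabilityMeasure μ] in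
lemma exists_window_sum_sq_le (k : ℤ) {δ : ℝ} (hδ : 0 < δ) : ∃ N₀ : ℕ, ∀ N M : ℕ, N₀ ≤ N →
    ∀ r, ∑ l ∈ window M \ window N, c r (k - l) ^ 2 ≤ δ ^ 2 := by
  have h1 : ∀ r, ∃ N₀ : ℕ, ∀ N M : ℕ, N₀ ≤ N →
      ∑ l ∈ window M \ window N, c r (k - l) ^ 2 ≤ δ ^ 2 := by
    intro r
    have hs : Summable fun l : ℤ => c r (k - l) ^ 2 :=
      summable_of_sum_le (fun l => sq_nonneg _) fun L => hc.sum_sq_le r L k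
    obtain ⟨s, hs⟩ := summable_iff_vanishing_norm.1 hs (δ ^ 2) (by positivity)
    refine ⟨s.sup Int.natAbs, fun N M hN => ?_⟩
    refine (le_abs_self _).trans (hs _ ?_).le
    rw [Finset.disjoint_left]
    intro l hl hls
    refine (Finset.mem_sdiff.1 hl).2 ?_
    have := (Finset.le_sup (f := Int.natAbs) hls).trans hN
    rw [window, Finset.mem_Icc]
    omega
  choose N₀ hN₀ using h1
  exact ⟨Finset.univ.sup N₀, fun N M hN r =>
    hN₀ r N M ((Finset.le_sup (Finset.mem_univ r)).trans hN)⟩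

/-- The products of the truncated series converge in mean. -/
lemma tendsto_integral_restrictedProd {P : Ω → ℝ} {k : ℤ}
    (hP : ∀ᵐ ω ∂μ, Tendsto (fun N => restrictedProd c ξ (window N) k ω) atTop (𝓝 (P ω))) :
    Integrable P μ ∧ Tendsto (fun N => ∫ ω, restrictedProd c ξ (window N) k ω ∂μ) atTop
      (𝓝 (∫ ω, P ω ∂μ)) := by
  obtain ⟨C, hC0, hC⟩ := h.exists_integral_abs_restrictedProd_sub_le hc
  have hi := fun N => h.integrable_restrictedProd hc (window N) k
  have hPm : AEStronglyMeasurable P μ :=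
    aestronglyMeasurable_of_tendsto_ae _ (fun N => (hi N).aestronglyMeasurable) hP
  have key : ∀ δ : ℝ, 0 < δ → δ ≤ 1 → ∃ N₀ : ℕ, ∀ N, N₀ ≤ N →
      ∫⁻ ω, ‖restrictedProd c ξ (window N) k ω - P ω‖ₑ ∂μ ≤ ENNReal.ofReal (C * δ) := by
    intro δ hδ0 hδ1
    obtain ⟨N₀, hN₀⟩ := IsInnovation.exists_window_sum_sq_le hc k hδ0
    refine ⟨N₀, fun N hN => ?_⟩
    -- Fatou in the larger window `M` turns the Cauchy bound into a distance to the almost sure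
    -- limit, before `P` is known to be integrable.
    have e1 : ∫⁻ ω, ‖restrictedProd c ξ (window N) k ω - P ω‖ₑ ∂μ
        = ∫⁻ ω, liminf (fun M => ‖restrictedProd c ξ (window M) k ω
          - restrictedProd c ξ (window N) k ω‖ₑ) atTop ∂μ := by
      refine lintegral_congr_ae ?_
      filter_upwards [hP] with ω hω
      rw [(hω.sub_const (restrictedProd c ξ (window N) k ω)).enorm.liminf_eq, ← enorm_neg, neg_sub]
    rw [e1]
    refine (lintegral_liminf_le' fun M => ((hi M).sub (hi N)).aestronglyMeasurable.enorm).trans ?_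
    refine (liminf_le_liminf (v := fun _ => ENNReal.ofReal (C * δ)) ?_).trans (liminf_const _).le
    filter_upwards [eventually_ge_atTop N] with M hM
    have e2 := ofReal_integral_norm_eq_lintegral_enorm ((hi M).sub (hi N))
    exact e2.symm.le.trans (ENNReal.ofReal_le_ofReal
      (hC k _ _ δ (window_subset hM) hδ0 hδ1 (hN₀ N M hN)))
  have hPi : Integrable P μ := by
    obtain ⟨N₀, hN₀⟩ := key 1 one_pos le_rfl
    have hd : Integrable (fun ω => restrictedProd c ξ (window N₀) k ω - P ω) μ :=
      ⟨(hi N₀).aestronglyMeasurable.sub hPm, (hN₀ N₀ le_rfl).trans_lt ENNReal.ofReal_lt_top⟩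
    refine ((hi N₀).sub hd).congr (ae_of_all _ fun ω => ?_)
    simp
  refine ⟨hPi, tendsto_integral_of_L1 P hPi.aestronglyMeasurable
    (Eventually.of_forall hi) ?_⟩
  rw [ENNReal.tendsto_nhds_zero]
  intro ε hε
  rcases eq_or_ne ε ⊤ with rfl | hεt
  · simp
  have hε' : 0 < ε.toReal := ENNReal.toReal_pos hε.ne' hεt
  obtain ⟨N₀, hN₀⟩ := key (min 1 (ε.toReal / (C + 1))) (by positivity) (min_le_left _ _)
  filter_upwards [eventually_ge_atTop N₀] with N hN
  refine (hN₀ N hN).trans ((ENNReal.ofReal_le_ofReal ?_).trans (ENNReal.ofReal_toReal hεt).le)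
  calc C * min 1 (ε.toReal / (C + 1)) ≤ (C + 1) * (ε.toReal / (C + 1)) := by
        gcongr
        · linarith
        · exact min_le_right _ _
    _ = ε.toReal := by field_simp

end IsInnovation

end Convergence

/-! ### The scalar strong law -/

section ScalarLaw

variable {Ω ι : Type*} [MeasurableSpace Ω] {μ : Measure Ω} [IsProbabilityMeasure μ] [Fintype ι]
  [DecidableEq ι] {S : ℕ} {ξ : ℤ → Ω → ι → ℝ}

namespace IsInnovation

variable (h : IsInnovation μ S ξ) {c : ι → ℤ → ℝ} {κ : ι → ℝ} {Λ : ℝ} (hc : IsDecaying c κ Λ)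
include h hc

/-- The Marcinkiewicz–Zygmund law for products of scalar linear processes. -/
theorem ae_tendsto_sum_prod_sub_integral {p q β : ℝ} (hp : 0 < p) (hpq : p < q) (hq1 : 1 ≤ q)
    (hq2 : q ≤ 2) (hβ1 : 1 ≤ β) (hβp : β < 2 / p)
    (hβ : ∀ D : Finset ι, D.Nonempty → Dᶜ.card ≠ 1 → 2 - ∑ r ∈ D, κ r < β)
    (hheavy : ∀ A : Finset ι, S < 2 * A.card →
      Integrable (fun ω => |∏ r ∈ A, ξ 1 ω r| ^ q) μ)
    {X : ι → ℤ → Ω → ℝ} (hX : ∀ r k, ∀ᵐ ω ∂μ,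
      Tendsto (fun N => ∑ l ∈ window N, c r (k - l) * ξ l ω r) atTop (𝓝 (X r k ω))) :
    ∀ᵐ ω ∂μ, Tendsto (fun n : ℕ => (n : ℝ) ^ (-(1 / p)) * ∑ i ∈ Finset.range n,
      (∏ r, X r ((1 + i : ℕ) : ℤ) ω - ∫ ω', ∏ r, X r ((1 + i : ℕ) : ℤ) ω' ∂μ)) atTop (𝓝 0) := by
  have hprod : ∀ k, ∀ᵐ ω ∂μ,
      Tendsto (fun N => restrictedProd c ξ (window N) k ω) atTop (𝓝 (∏ r, X r k ω)) := by
    intro k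
    filter_upwards [ae_all_iff.2 fun r => hX r k] with ω hω
    exact tendsto_finsetProd _ fun r _ => hω r
  have hlim : ∀ᵐ ω ∂μ, ∀ n, Tendsto (fun N => restrictedSum μ c ξ (window N) n ω) atTop
      (𝓝 (∑ i ∈ Finset.range n,
        (∏ r, X r ((1 + i : ℕ) : ℤ) ω - ∫ ω', ∏ r, X r ((1 + i : ℕ) : ℤ) ω' ∂μ))) := by
    filter_upwards [ae_all_iff.2 hprod] with ω hω n
    exact tendsto_finsetSum _ fun i _ =>
      (hω _).sub (h.tendsto_integral_restrictedProd hc (hprod _)).2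
  obtain ⟨C, hC0, hC⟩ := h.exists_measureReal_restrictedSum_le hc hp hq1 hq2 hβ1 hβ hheavy
  have h2 : (1 : ℝ) < 2 := by norm_num
  refine ae_tendsto_of_summable_measure hp fun ε hε => ⟨_, summable_geometric_bound
    (Real.rpow_nonneg zero_le_two (β - 2 / p)) (Real.rpow_lt_one_of_one_lt_of_neg h2 (by linarith))
    (Real.rpow_nonneg zero_le_two (1 - q / p)) (Real.rpow_lt_one_of_one_lt_of_neg h2 ?_)
    (C / (ε / 2) ^ 2) (C / (ε / 2)), fun j => ?_⟩
  · have : 1 < q / p := (one_lt_div hp).2 hpq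
    linarith
  -- The event is defined by strict inequalities for finite sums, so it persists for all large
  -- windows; `ε / 2` matches the factor `2` from the two parts of the decomposition.
  · refine measure_le_of_ae_eventually (B := fun N => {ω | ∃ n < 2 ^ j,
      2 * (ε / 2 * ((2 : ℝ) ^ j) ^ (1 / p)) < |restrictedSum μ c ξ (window N) n ω|}) ?_ fun N => ?_
    · filter_upwards [hlim] with ω hω hmem
      obtain ⟨n, hn, hlt⟩ := hmem
      have e : 2 * (ε / 2 * ((2 : ℝ) ^ j) ^ (1 / p)) = ε * ((2 : ℝ) ^ j) ^ (1 / p) := by ring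
      filter_upwards [(hω n).abs.eventually_const_lt hlt] with N hN
      exact ⟨n, hn, e.trans_lt hN⟩
    · rw [← ENNReal.ofReal_toReal (measure_ne_top μ _)]
      exact ENNReal.ofReal_le_ofReal (hC (ε / 2) (by positivity) (window N) j)

end IsInnovation

lemma exists_isDecaying {c : ι → ℤ → ℝ} {κ σ : ι → ℝ} (hσ : ∀ r, σ r ≤ 1) (hκ0 : ∀ r, 0 ≤ κ r)
    (hκ : ∀ r, κ r < 2 * σ r - 1)
    (hb : ∀ r, ∃ K, ∀ l : ℤ, |c r l| ≤ K * (1 + |(l : ℝ)|) ^ (-σ r)) :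
    ∃ Λ, IsDecaying c κ Λ := by
  choose K hK using hb
  choose C hC0 hC using fun r => exists_sum_abs_mul_abs_le (hσ r) (hκ0 r) (hκ r) (hK r)
  refine ⟨1 + ∑ r, C r, le_add_of_nonneg_right (Finset.sum_nonneg fun r _ => hC0 r), hκ0,
    fun r L k k' => (hC r L k k').trans ?_⟩
  gcongr
  linarith [Finset.single_le_sum (fun r _ => hC0 r) (Finset.mem_univ r)]

/-! ### Choice of the exponents -/

/-- The conditions relating the decay exponents `κ`, the variance exponent `β` and the moment
exponent `q` under which the strong law holds with rate `n ^ (1 / p)`. -/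
structure IsAdmissibleChoice (σ : ι → ℝ) (α₀ p : ℝ) (κ : ι → ℝ) (β q : ℝ) : Prop where
  nonneg : ∀ r, 0 ≤ κ r
  lt : ∀ r, κ r < 2 * σ r - 1
  one_le_beta : 1 ≤ β
  beta_lt : β < 2 / p
  two_sub_lt : ∀ D : Finset ι, D.Nonempty → Dᶜ.card ≠ 1 → 2 - ∑ r ∈ D, κ r < β
  lt_q : p < q
  one_le_q : 1 ≤ q
  q_le : q ≤ 2
  q_lt : Fintype.card ι ≠ 1 → q < α₀

/-- A constant `κ` just below `2 * σ r₀ - 1`, with `σ r₀` minimal, works: singleton supports are the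
worst case and require `β` above `3 - 2 * σ r₀`. -/
lemma exists_choice_of_forall [Nonempty ι] {σ : ι → ℝ} {p : ℝ} (hp : 0 < p)
    (hσ : ∀ r, σ r ∈ Set.Ioc (1 / 2 : ℝ) 1) (hpσ : ∀ r, p < 2 / (3 - 2 * σ r)) :
    ∃ κ : ι → ℝ, ∃ β, (∀ r, 0 ≤ κ r) ∧ (∀ r, κ r < 2 * σ r - 1) ∧ 1 ≤ β ∧ β < 2 / p ∧
      ∀ D : Finset ι, D.Nonempty → Dᶜ.card ≠ 1 → 2 - ∑ r ∈ D, κ r < β := by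
  obtain ⟨r₀, hr₀⟩ := Finite.exists_min σ
  have h1 : 3 - 2 * σ r₀ < 2 / p := by
    have h3 : 0 < 3 - 2 * σ r₀ := by linarith [(hσ r₀).2]
    rw [lt_div_iff₀ hp]
    have := (lt_div_iff₀ h3).1 (hpσ r₀)
    linarith
  obtain ⟨β, hβ1, hβ2⟩ := exists_between h1
  have hσ₀ := hσ r₀
  have hβ3 : 1 ≤ β := by linarith [hσ₀.2]
  obtain ⟨κ, hκ1, hκ2⟩ := exists_between
    (show max 0 (2 - β) < 2 * σ r₀ - 1 from max_lt (by linarith [hσ₀.1]) (by linarith))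
  have hκ0 : 0 ≤ κ := (le_max_left _ _).trans hκ1.le
  refine ⟨fun _ => κ, β, fun _ => hκ0, fun r => hκ2.trans_le (by linarith [hr₀ r]), hβ3, hβ2,
    fun D hD _ => ?_⟩
  have h4 : κ ≤ ∑ _r ∈ D, κ := by
    obtain ⟨r, hr⟩ := hD
    exact Finset.single_le_sum (f := fun _ => κ) (fun _ _ => hκ0) hr
  linarith [(le_max_right 0 (2 - β)).trans_lt hκ1]

/-- Only `D = univ` has to be treated. With `κ r = 2 * σ r - 1 - ε` the requirement reads `4 - 2 * ∑
r, σ r + 2 * ε < β`, which fits below `2 / p` for small `ε`. -/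
lemma exists_choice_of_card_eq_two {σ : ι → ℝ} {p : ℝ} (hp : 0 < p) (hp2 : p < 2)
    (hι : Fintype.card ι = 2) (hσ : ∀ r, σ r ∈ Set.Ioc (1 / 2 : ℝ) 1)
    (hpσ : p * (2 - ∑ r, σ r) < 1) :
    ∃ κ : ι → ℝ, ∃ β, (∀ r, 0 ≤ κ r) ∧ (∀ r, κ r < 2 * σ r - 1) ∧ 1 ≤ β ∧ β < 2 / p ∧
      ∀ D : Finset ι, D.Nonempty → Dᶜ.card ≠ 1 → 2 - ∑ r ∈ D, κ r < β := by
  have : Nonempty ι := Fintype.card_pos_iff.1 (by omega)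
  have h1 : max 1 (4 - 2 * ∑ r, σ r) < 2 / p := by
    refine max_lt ((one_lt_div hp).2 hp2) ?_
    rw [lt_div_iff₀ hp]
    linarith
  obtain ⟨β, hβ1, hβ2⟩ := exists_between h1
  obtain ⟨hβ3, hβ4⟩ := max_lt_iff.1 hβ1
  obtain ⟨r₀, hr₀⟩ := Finite.exists_min σ
  obtain ⟨ε, hε0, hε1⟩ := exists_between (show (0 : ℝ) <
    min (2 * σ r₀ - 1) ((β - (4 - 2 * ∑ r, σ r)) / 2) from
      lt_min (by linarith [(hσ r₀).1]) (by linarith))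
  obtain ⟨hε2, hε3⟩ := lt_min_iff.1 hε1
  refine ⟨fun r => 2 * σ r - 1 - ε, β, fun r => by linarith [hr₀ r], fun r => by linarith,
    hβ3.le, hβ2, fun D hD hD1 => ?_⟩
  have hDc : Dᶜ.card = 0 := by
    have := Finset.card_compl D
    have := hD.card_pos
    omega
  have hDu : D = Finset.univ := by
    rwa [Finset.card_eq_zero, Finset.compl_eq_empty_iff] at hDc
  rw [hDu]
  simp only [Finset.sum_sub_distrib, Finset.sum_const, Finset.card_univ, hι, ← Finset.mul_sum]
  simp only [nsmul_eq_mul]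
  push_cast
  linarith

/-- For `s = 1` no block is heavy, since `S = 2`, so `q = 2` is allowed whatever `α₀` is. Otherwise
`q` lies strictly between `max p 1` and `min 2 α₀`. -/
lemma IsAdmissibleExponent.exists_choice {s : ℕ} (hs : 1 ≤ s) {α₀ : ℝ} (hα₀ : 1 < α₀)
    {σ : Fin s → ℝ} (hσ : ∀ r, σ r ∈ Set.Ioc (1 / 2 : ℝ) 1) {p : ℝ}
    (hp : IsAdmissibleExponent s α₀ σ p) : ∃ κ β q, IsAdmissibleChoice σ α₀ p κ β q := by
  obtain ⟨hp0, hp1, hp2, hp3⟩ := hp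
  have : Nonempty (Fin s) := ⟨⟨0, hs⟩⟩
  have hlt : (∀ r, p < 2 / (3 - 2 * σ r)) → p < 2 := fun H => by
    obtain ⟨r⟩ := this
    refine (H r).trans_le ?_
    rw [div_le_iff₀ (by linarith [(hσ r).2])]
    linarith [(hσ r).2]
  have hq : p < 2 → p < α₀ → ∃ q, p < q ∧ 1 ≤ q ∧ q ≤ 2 ∧ (Fintype.card (Fin s) ≠ 1 → q < α₀) := by
    intro h2 hα
    obtain ⟨q, hq1, hq2⟩ := exists_between
      (show max p 1 < min 2 α₀ from max_lt (lt_min h2 hα) (lt_min (by norm_num) hα₀))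
    exact ⟨q, (le_max_left _ _).trans_lt hq1, (le_max_right _ _).trans hq1.le,
      hq2.le.trans (min_le_left _ _), fun _ => hq2.trans_le (min_le_right _ _)⟩
  rcases lt_trichotomy s 2 with h | h | h
  · have hs1 : s = 1 := by omega
    obtain ⟨κ, β, a1, a2, a3, a4, a5⟩ := exists_choice_of_forall hp0 hσ (hp1 hs1)
    exact ⟨κ, β, 2, a1, a2, a3, a4, a5, hlt (hp1 hs1), one_le_two, le_rfl,
      fun hne => absurd (by simpa using hs1) hne⟩
  · obtain ⟨b1, b2, b3⟩ := hp2 h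
    obtain ⟨κ, β, a1, a2, a3, a4, a5⟩ := exists_choice_of_card_eq_two hp0 b1 (by simpa using h) hσ b3
    obtain ⟨q, q1, q2, q3, q4⟩ := hq b1 b2
    exact ⟨κ, β, q, a1, a2, a3, a4, a5, q1, q2, q3, q4⟩
  · obtain ⟨b1, b2⟩ := hp3 h
    obtain ⟨κ, β, a1, a2, a3, a4, a5⟩ := exists_choice_of_forall hp0 hσ b2
    obtain ⟨q, q1, q2, q3, q4⟩ := hq (hlt b2) b1
    exact ⟨κ, β, q, a1, a2, a3, a4, a5, q1, q2, q3, q4⟩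

end ScalarLaw

/-! ### Moments from tails -/

section Moments

variable {Ω : Type*} [MeasurableSpace Ω] {μ : Measure Ω} [IsProbabilityMeasure μ]

/-- Layer cake formula: near `0` the probability is at most `1` and `t ^ (q - 1)` is integrable,
while beyond `1` the tail leaves the integrable power `t ^ (q - 1 - α)`. -/
lemma integrable_rpow_of_tail {Y : Ω → ℝ} (hY : Measurable Y) (hY0 : ∀ ω, 0 ≤ Y ω) {α q K : ℝ}
    (hq : 0 < q) (hqα : q < α) (hK : ∀ t : ℝ, 1 ≤ t → t ^ α * μ.real {ω | t < Y ω} ≤ K) :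
    Integrable (fun ω => Y ω ^ q) μ := by
  have hm : Measurable fun ω => Y ω ^ q := hY.pow_const q
  refine ⟨hm.aestronglyMeasurable, ?_⟩
  rw [hasFiniteIntegral_iff_ofReal (ae_of_all _ fun ω => Real.rpow_nonneg (hY0 ω) q),
    lintegral_rpow_eq_lintegral_meas_lt_mul μ (ae_of_all _ hY0) hY.aemeasurable hq]
  refine ENNReal.mul_lt_top ENNReal.ofReal_lt_top ?_
  rw [← Set.Ioc_union_Ioi_eq_Ioi zero_le_one]
  refine (lintegral_union_le _ _ _).trans_lt (ENNReal.add_lt_top.2 ⟨?_, ?_⟩)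
  · have hi : IntegrableOn (fun t : ℝ => t ^ (q - 1)) (Set.Ioc 0 1) :=
      (intervalIntegrable_iff_integrableOn_Ioc_of_le zero_le_one).1
        (intervalIntegral.intervalIntegrable_rpow' (by linarith))
    refine (lintegral_mono fun t => ?_).trans_lt hi.lintegral_lt_top
    exact (mul_le_mul_left prob_le_one _).trans (one_mul _).le
  · have hi : IntegrableOn (fun t : ℝ => K * t ^ (q - 1 - α)) (Set.Ioi 1) :=
      (integrableOn_Ioi_rpow_of_lt (by linarith) one_pos).const_mul K
    refine (setLIntegral_mono' measurableSet_Ioi fun t ht => ?_).trans_lt hi.lintegral_lt_top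
    have ht1 : (1 : ℝ) < t := ht
    have ht0 : 0 < t := by linarith
    rw [← ENNReal.ofReal_toReal (measure_ne_top μ _), ← ENNReal.ofReal_mul ENNReal.toReal_nonneg]
    refine ENNReal.ofReal_le_ofReal ?_
    have h1 := hK t ht1.le
    have e : t ^ (q - 1) = t ^ (q - 1 - α) * t ^ α := by
      rw [← Real.rpow_add ht0]; congr 1; ring
    calc μ.real {ω | t < Y ω} * t ^ (q - 1)
        = (t ^ α * μ.real {ω | t < Y ω}) * t ^ (q - 1 - α) := by rw [e]; ring
      _ ≤ K * t ^ (q - 1 - α) := by gcongr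

lemma exists_perm_mem_iff {s : ℕ} (A : Finset (Fin s)) :
    ∃ π : Equiv.Perm (Fin s), ∀ r, r.val < A.card ↔ π r ∈ A := by
  have hA : A.card ≤ s := by simpa using A.card_le_univ
  have e : {r : Fin s // r.val < A.card} ≃ {r // r ∈ A} := Fintype.equivOfCardEq (by
    rw [Fintype.card_subtype, Fin.card_filter_val_lt, Fintype.card_coe, min_eq_right hA])
  exact ⟨e.extendSubtype, fun r => ⟨fun hr => e.extendSubtype_mem r hr,
    fun hr => not_imp_not.1 (e.extendSubtype_not_mem r) hr⟩⟩

lemma le_tailExponent {s i : ℕ} {α₀ : ℝ} (hα₀ : 0 ≤ α₀) (hi : i < s) :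
    α₀ ≤ tailExponent s α₀ i := by
  have h1 : (i : ℝ) < s := by exact_mod_cast hi
  have h2 : 1 ≤ (s : ℝ) / (s - i) := by
    rw [one_le_div (by linarith)]
    linarith [(i.cast_nonneg : (0 : ℝ) ≤ i)]
  exact le_mul_of_one_le_left hα₀ h2

/-- A heavy set has `s - i` elements with `i ≤ (s - 1) / 2` and is the image of an initial segment
under some permutation. For `t ≥ 1` the exponent `α_i` may be lowered to `α₀`. -/
lemma integrable_prod_norm_rpow_of_tail {s m : ℕ} {V : Ω → Fin s → EuclideanSpace ℝ (Fin m)}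
    (hV : Measurable V) {α₀ : ℝ} (hα₀ : 0 ≤ α₀)
    (htail : ∀ π : Equiv.Perm (Fin s), ∀ i : ℕ, i ≤ (s - 1) / 2 → ∃ K : ℝ, ∀ t : ℝ, 0 ≤ t →
      t ^ tailExponent s α₀ i *
        μ.real {ω | t < ∏ r : Fin s with r.val < s - i, ‖V ω (π r)‖} ≤ K)
    {q : ℝ} (hq : 0 < q) (hqα : q < α₀) {A : Finset (Fin s)} (hA : s < 2 * A.card) :
    Integrable (fun ω => (∏ r ∈ A, ‖V ω r‖) ^ q) μ := by
  have hAs : A.card ≤ s := by simpa using A.card_le_univ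
  obtain ⟨π, hπ⟩ := exists_perm_mem_iff A
  obtain ⟨K, hK⟩ := htail π (s - A.card) (by omega)
  have hsub : s - (s - A.card) = A.card := by omega
  have e : ∀ ω, ∏ r : Fin s with r.val < s - (s - A.card), ‖V ω (π r)‖ = ∏ r ∈ A, ‖V ω r‖ :=
    fun ω => Finset.prod_equiv π (by simp [hsub, hπ]) fun _ _ => rfl
  simp only [e] at hK
  have hVr : ∀ r, Measurable fun ω => V ω r := fun r => (measurable_pi_apply r).comp hV
  refine integrable_rpow_of_tail (α := α₀) (K := K)
    (Finset.measurable_fun_prod _ fun r _ => (hVr r).norm)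
    (fun ω => Finset.prod_nonneg fun r _ => norm_nonneg _) hq hqα fun t ht => ?_
  refine le_trans ?_ (hK t (by linarith))
  gcongr
  exact le_tailExponent hα₀ (by omega)

end Moments

/-! ### Coordinates -/

section Coordinates

variable {Ω : Type*} [MeasurableSpace Ω] {μ : Measure Ω} [IsProbabilityMeasure μ] {s d m : ℕ}
  {Ξ : ℤ → Ω → Fin s → EuclideanSpace ℝ (Fin m)}

lemma isInnovation_coord (hmeas : ∀ l, Measurable (Ξ l)) (hindep : iIndepFun Ξ μ)
    (hident : ∀ l, IdentDistrib (Ξ l) (Ξ 1) μ μ) (hmean : ∀ r, ∫ ω, Ξ 1 ω r ∂μ = 0)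
    (hmoment : ∀ r, Integrable (fun ω => ‖Ξ 1 ω r‖ ^ (max s 2)) μ) (I : Fin s → Fin m) :
    IsInnovation μ (max s 2) (fun l ω r => Ξ l ω r (I r)) := by
  have hg : Measurable fun (v : Fin s → EuclideanSpace ℝ (Fin m)) (r : Fin s) => v r (I r) :=
    measurable_pi_lambda _ fun r =>
      (EuclideanSpace.proj (𝕜 := ℝ) (I r)).continuous.measurable.comp (measurable_pi_apply r)
  have hr : ∀ r, Measurable fun ω => Ξ 1 ω r := fun r => (measurable_pi_apply r).comp (hmeas 1)
  have hrI : ∀ r, Measurable fun ω => Ξ 1 ω r (I r) := fun r =>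
    (measurable_pi_apply r).comp (hg.comp (hmeas 1))
  refine ⟨fun l => hg.comp (hmeas l), hindep.comp (fun _ v r => v r (I r)) fun _ => hg,
    fun l => (hident l).comp hg, fun r => ?_, fun r => ?_, by simp, le_max_right _ _⟩
  · have hi : Integrable (fun ω => Ξ 1 ω r) μ := by
      refine ((integrable_const (1 : ℝ)).add (hmoment r)).mono' (hr r).aestronglyMeasurable
        (ae_of_all _ fun ω => ?_)
      simpa using pow_le_one_add_pow (show 1 ≤ max s 2 by omega) (norm_nonneg (Ξ 1 ω r))
    have := (EuclideanSpace.proj (𝕜 := ℝ) (I r)).integral_comp_comm hi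
    rw [hmean r, map_zero] at this
    exact this
  · refine (hmoment r).mono' ((hrI r).norm.pow_const _).aestronglyMeasurable
      (ae_of_all _ fun ω => ?_)
    rw [Real.norm_of_nonneg (by positivity)]
    exact pow_le_pow_left₀ (abs_nonneg _) (PiLp.norm_apply_le (Ξ 1 ω r) (I r)) _

lemma integrable_abs_prod_coord_rpow {V : Ω → Fin s → EuclideanSpace ℝ (Fin m)}
    (hV : Measurable V) (I : Fin s → Fin m) {q : ℝ} (hq : 0 ≤ q) {A : Finset (Fin s)}
    (hi : Integrable (fun ω => (∏ r ∈ A, ‖V ω r‖) ^ q) μ) :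
    Integrable (fun ω => |∏ r ∈ A, V ω r (I r)| ^ q) μ := by
  have hVr : ∀ r, Measurable fun ω => V ω r (I r) := fun r =>
    (EuclideanSpace.proj (𝕜 := ℝ) (I r)).continuous.measurable.comp
      ((measurable_pi_apply r).comp hV)
  refine hi.mono' ((Finset.measurable_fun_prod A fun r _ => hVr r).norm.pow_const
    q).aestronglyMeasurable (ae_of_all _ fun ω => ?_)
  rw [Real.norm_of_nonneg (by positivity)]
  refine Real.rpow_le_rpow (abs_nonneg _) ?_ hq
  rw [Finset.abs_prod]
  exact Finset.prod_le_prod (fun _ _ => abs_nonneg _) fun r _ => PiLp.norm_apply_le (V ω r) (I r)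

lemma abs_apply_le_frobNorm (A : Matrix (Fin d) (Fin m) ℝ) (j : Fin d) (i : Fin m) :
    |A j i| ≤ frobNorm A := by
  refine Real.abs_le_sqrt ?_
  simp only [Matrix.trace, Matrix.diag, Matrix.mul_apply, Matrix.transpose_apply]
  calc A j i ^ 2 = A j i * A j i := sq _
    _ ≤ ∑ j, A j i * A j i :=
      Finset.single_le_sum (f := fun j => A j i * A j i) (fun _ _ => mul_self_nonneg _)
        (Finset.mem_univ j)
    _ ≤ _ := Finset.single_le_sum (f := fun i => ∑ j, A j i * A j i)
        (fun _ _ => Finset.sum_nonneg fun _ _ => mul_self_nonneg _) (Finset.mem_univ i)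

lemma exists_abs_apply_le_of_decay {B : ℤ → Matrix (Fin d) (Fin m) ℝ} {σ K : ℝ} (hσ0 : 0 ≤ σ)
    (hσ1 : σ ≤ 1) (hK : ∀ l : ℤ, |(l : ℝ)| ^ σ * frobNorm (B l) ≤ K) (j : Fin d) (i : Fin m) :
    ∃ K', ∀ l : ℤ, |B l j i| ≤ K' * (1 + |(l : ℝ)|) ^ (-σ) := by
  have hF : ∀ l, 0 ≤ frobNorm (B l) := fun l => Real.sqrt_nonneg _
  -- The decay hypothesis says nothing at `l = 0`, where `0 ^ σ = 0`, so that entry is added by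
  -- hand; the `2` bounds `(1 + |l|) ^ σ / |l| ^ σ`.
  refine ⟨2 * |K| + |B 0 j i|, fun l => ?_⟩
  rw [Real.rpow_neg (by positivity), ← div_eq_mul_inv, le_div_iff₀ (by positivity)]
  rcases eq_or_ne l 0 with rfl | hl
  · simp
  · have hl1 : (1 : ℝ) ≤ |(l : ℝ)| := by exact_mod_cast Int.one_le_abs hl
    have h1 : (1 + |(l : ℝ)|) ^ σ ≤ 2 * |(l : ℝ)| ^ σ := by
      calc (1 + |(l : ℝ)|) ^ σ ≤ (2 * |(l : ℝ)|) ^ σ := by gcongr; linarith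
        _ = 2 ^ σ * |(l : ℝ)| ^ σ := Real.mul_rpow zero_le_two (abs_nonneg _)
        _ ≤ 2 ^ (1 : ℝ) * |(l : ℝ)| ^ σ := by gcongr; norm_num
        _ = _ := by rw [Real.rpow_one]
    calc |B l j i| * (1 + |(l : ℝ)|) ^ σ ≤ frobNorm (B l) * (2 * |(l : ℝ)| ^ σ) := by
          gcongr
          · exact hF l
          · exact abs_apply_le_frobNorm _ j i
      _ = 2 * (|(l : ℝ)| ^ σ * frobNorm (B l)) := by ring
      _ ≤ 2 * |K| := by linarith [hK l, le_abs_self K]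
      _ ≤ _ := le_add_of_nonneg_right (abs_nonneg _)

end Coordinates

/-! ### Reduction of the tensor process to scalar processes -/

section Reduction

variable {Ω : Type*} [MeasurableSpace Ω] {μ : Measure Ω} [IsProbabilityMeasure μ] {s d m : ℕ}

/-- The scalar linear process built from the `(j, i)` entries of `C_l^{(r)}` and the `i`-th
coordinates of `Ξ_l^{(r)}`. -/
def entryProcess (C : ℤ → Fin s → Matrix (Fin d) (Fin m) ℝ)
    (Ξ : ℤ → Ω → Fin s → EuclideanSpace ℝ (Fin m)) (r : Fin s) (j : Fin d) (i : Fin m) (k : ℤ)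
    (ω : Ω) : ℝ :=
  limUnder atTop fun N : ℕ => ∑ l ∈ window N, C (k - l) r j i * Ξ l ω r i

lemma partialSum_apply (B : ℤ → Matrix (Fin d) (Fin m) ℝ) (ζ : ℤ → Ω → EuclideanSpace ℝ (Fin m))
    (k : ℤ) (ω : Ω) (K : ℕ × ℕ) (j : Fin d) :
    partialSum B ζ k ω K j
      = ∑ i, ∑ l ∈ Finset.Icc (-(K.1 : ℤ)) (K.2 : ℤ), B (k - l) j i * ζ l ω i := by
  rw [Finset.sum_comm]
  simp [partialSum, Matrix.mulVec, dotProduct]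

lemma tendsto_partialSum_linearProcess {B : ℤ → Matrix (Fin d) (Fin m) ℝ}
    {ζ : ℤ → Ω → EuclideanSpace ℝ (Fin m)} {k : ℤ} {ω : Ω}
    (hlim : ∀ j i, ∃ x, Tendsto (fun K : ℕ × ℕ => ∑ l ∈ Finset.Icc (-(K.1 : ℤ)) (K.2 : ℤ),
      B (k - l) j i * ζ l ω i) atTop (𝓝 x)) :
    Tendsto (partialSum B ζ k ω) atTop (𝓝 (linearProcess B ζ k ω)) := by
  choose x hx using hlim
  refine tendsto_nhds_limUnder ⟨WithLp.toLp 2 fun j => ∑ i, x j i, ?_⟩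
  have h1 : Tendsto (fun K => (partialSum B ζ k ω K).ofLp) atTop (𝓝 fun j => ∑ i, x j i) := by
    rw [tendsto_pi_nhds]
    intro j
    simp only [partialSum_apply]
    exact tendsto_finsetSum _ fun i _ => hx j i
  exact ((PiLp.continuous_toLp 2 (fun _ : Fin d => ℝ)).tendsto _).comp h1

lemma tendsto_window : Tendsto (fun N : ℕ => (N, N)) atTop (atTop : Filter (ℕ × ℕ)) := by
  rw [← prod_atTop_atTop_eq]
  exact tendsto_id.prodMk tendsto_id

lemma tendsto_sum_window {u : ℤ → ℝ} {x : ℝ}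
    (hx : Tendsto (fun K : ℕ × ℕ => ∑ l ∈ Finset.Icc (-(K.1 : ℤ)) (K.2 : ℤ), u l) atTop (𝓝 x)) :
    Tendsto (fun N => ∑ l ∈ window N, u l) atTop (𝓝 x) :=
  (hx.comp tendsto_window).congr fun _ => rfl

lemma linearProcess_apply {B : ℤ → Matrix (Fin d) (Fin m) ℝ}
    {ζ : ℤ → Ω → EuclideanSpace ℝ (Fin m)} {k : ℤ} {ω : Ω}
    (hlim : ∀ j i, ∃ x, Tendsto (fun K : ℕ × ℕ => ∑ l ∈ Finset.Icc (-(K.1 : ℤ)) (K.2 : ℤ),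
      B (k - l) j i * ζ l ω i) atTop (𝓝 x)) (j : Fin d) :
    linearProcess B ζ k ω j
      = ∑ i, limUnder atTop fun N : ℕ => ∑ l ∈ window N, B (k - l) j i * ζ l ω i := by
  have h1 := (tendsto_partialSum_linearProcess hlim).comp tendsto_window
  have h2 : Tendsto (fun N : ℕ => ∑ i, ∑ l ∈ window N, B (k - l) j i * ζ l ω i)
      atTop (𝓝 (linearProcess B ζ k ω j)) :=
    (((EuclideanSpace.proj (𝕜 := ℝ) j).continuous.tendsto _).comp h1).congr
      fun N => partialSum_apply B ζ k ω (N, N) j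
  refine tendsto_nhds_unique h2 (tendsto_finsetSum _ fun i _ => tendsto_nhds_limUnder ?_)
  obtain ⟨x, hx⟩ := hlim j i
  exact ⟨x, tendsto_sum_window hx⟩

lemma tensorProd_apply_eq_sum {v : Fin s → EuclideanSpace ℝ (Fin d)}
    {x : Fin s → Fin d → Fin m → ℝ} (hv : ∀ r j, v r j = ∑ i, x r j i) (J : Fin s → Fin d) :
    tensorProd v J = ∑ I : Fin s → Fin m, ∏ r, x r (J r) (I r) := by
  have : tensorProd v J = ∏ r, v r (J r) := rfl
  simp only [this, hv, Finset.prod_univ_sum, Fintype.piFinset_univ]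

lemma tendsto_smul_sum_sub_integral {J : Type*} [Fintype J] {T : ℕ → Ω → EuclideanSpace ℝ J}
    (hT : ∀ k, Integrable (T k) μ) {a : ℕ → ℝ} (ω : Ω)
    (h : ∀ j, Tendsto (fun n => a n * ∑ i ∈ Finset.range n,
      (T (1 + i) ω j - ∫ ω', T (1 + i) ω' j ∂μ)) atTop (𝓝 0)) :
    Tendsto (fun n => a n • ∑ k ∈ Finset.Icc 1 n, (T k ω - ∫ ω', T k ω' ∂μ)) atTop (𝓝 0) := by
  have h1 : Tendsto (fun n => (a n • ∑ k ∈ Finset.Icc 1 n, (T k ω - ∫ ω', T k ω' ∂μ)).ofLp)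
      atTop (𝓝 (fun _ => 0)) := by
    rw [tendsto_pi_nhds]
    intro j
    refine (h j).congr fun n => ?_
    have e : Finset.Icc 1 n = Finset.Ico 1 (n + 1) := by
      ext; simp
    simp only [e, Finset.sum_Ico_eq_sum_range, add_tsub_cancel_right, PiLp.smul_apply,
      WithLp.ofLp_sum, WithLp.ofLp_sub, Finset.sum_apply, Pi.sub_apply, smul_eq_mul]
    congr 1
    refine Finset.sum_congr rfl fun i _ => ?_
    rw [eval_integral_piLp fun j => (hT _).eval_piLp j]
  exact ((PiLp.continuous_toLp 2 (fun _ : J => ℝ)).tendsto _).comp h1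

end Reduction

end LinearProcessMSLLN

end

/-! ### Assembly of the theorem from its coordinates -/

theorem mainTheorem2 {Ω : Type*} [MeasurableSpace Ω] (μ : Measure Ω) [IsProbabilityMeasure μ]
    (s d m : ℕ) (hs : 1 ≤ s) (α₀ : ℝ) (hα₀ : 1 < α₀)
    (Ξ : ℤ → Ω → Fin s → EuclideanSpace ℝ (Fin m))
    (hmeas : ∀ l, Measurable (Ξ l))
    (hindep : iIndepFun Ξ μ)
    (hident : ∀ l, IdentDistrib (Ξ l) (Ξ 1) μ μ)
    (hmean : ∀ r, ∫ ω, Ξ 1 ω r ∂μ = 0)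
    (hmoment : ∀ r, Integrable (fun ω => ‖Ξ 1 ω r‖ ^ (max s 2)) μ)
    (htail : ∀ π : Equiv.Perm (Fin s), ∀ i : ℕ, i ≤ (s - 1) / 2 →
      ∃ K : ℝ, ∀ t : ℝ, 0 ≤ t →
        t ^ LinearProcessMSLLN.tailExponent s α₀ i *
          μ.real {ω | t < ∏ r : Fin s with r.val < s - i, ‖Ξ 1 ω (π r)‖} ≤ K)
    (C : ℤ → Fin s → Matrix (Fin d) (Fin m) ℝ)
    (σ : Fin s → ℝ) (hσ : ∀ r, σ r ∈ Set.Ioc (1 / 2 : ℝ) 1)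
    (hdecay : ∀ r, ∃ K : ℝ, ∀ l : ℤ,
      |(l : ℝ)| ^ σ r * LinearProcessMSLLN.frobNorm (C l r) ≤ K)
    (X : Fin s → ℤ → Ω → EuclideanSpace ℝ (Fin d))
    (hX : X = fun r => LinearProcessMSLLN.linearProcess (fun l => C l r) (fun l ω => Ξ l ω r)) :
    (∀ r k, ∀ᵐ ω ∂μ,
      Tendsto (LinearProcessMSLLN.partialSum (fun l => C l r) (fun l ω => Ξ l ω r) k ω)
        atTop (𝓝 (X r k ω))) ∧
    (∀ k, Integrable (fun ω => LinearProcessMSLLN.tensorProd (fun r => X r k ω)) μ) ∧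
    ∀ p : ℝ, LinearProcessMSLLN.IsAdmissibleExponent s α₀ σ p →
      ∀ᵐ ω ∂μ, Tendsto
        (fun n : ℕ => (n : ℝ) ^ (-(1 / p)) • ∑ k ∈ Finset.Icc 1 n,
          (LinearProcessMSLLN.tensorProd (fun r => X r (k : ℤ) ω) -
            ∫ ω', LinearProcessMSLLN.tensorProd (fun r => X r (k : ℤ) ω') ∂μ))
        atTop (𝓝 0) := by
  open LinearProcessMSLLN in
  subst hX
  have hinn : ∀ I : Fin s → Fin m, IsInnovation μ (max s 2) (fun l ω r => Ξ l ω r (I r)) :=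
    isInnovation_coord hmeas hindep hident hmean hmoment
  have hdec : ∀ (κ : Fin s → ℝ), (∀ r, 0 ≤ κ r) → (∀ r, κ r < 2 * σ r - 1) →
      ∀ (J : Fin s → Fin d) (I : Fin s → Fin m),
      ∃ Λ, IsDecaying (fun r l => C l r (J r) (I r)) κ Λ := fun κ h0 h1 J I =>
    exists_isDecaying (fun r => (hσ r).2) h0 h1 fun r => by
      obtain ⟨K, hK⟩ := hdecay r
      exact exists_abs_apply_le_of_decay (B := fun l => C l r) (by linarith [(hσ r).1]) (hσ r).2
        hK (J r) (I r)
  -- Square summability, the case `κ = 0`, already gives convergence and integrability; the sharp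
  -- `κ` matters only for the rate.
  have hdec0 := hdec (fun _ => 0) (fun _ => le_rfl) fun r => by linarith [(hσ r).1]
  have hentry : ∀ r k, ∀ᵐ ω ∂μ, ∀ j i, ∃ x, Tendsto (fun K : ℕ × ℕ =>
      ∑ l ∈ Finset.Icc (-(K.1 : ℤ)) (K.2 : ℤ), C (k - l) r j i * Ξ l ω r i) atTop (𝓝 x) := by
    intro r k
    refine ae_all_iff.2 fun j => ae_all_iff.2 fun i => ?_
    obtain ⟨Λ, hΛ⟩ := hdec0 (fun _ => j) (fun _ => i)
    exact (hinn fun _ => i).ae_exists_tendsto_sum_Icc r fun L => hΛ.sum_sq_le r L k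
  have hwin : ∀ (J : Fin s → Fin d) (I : Fin s → Fin m) r k, ∀ᵐ ω ∂μ,
      Tendsto (fun N => ∑ l ∈ window N, C (k - l) r (J r) (I r) * Ξ l ω r (I r)) atTop
        (𝓝 (entryProcess C Ξ r (J r) (I r) k ω)) := by
    intro J I r k
    filter_upwards [hentry r k] with ω hω
    obtain ⟨x, hx⟩ := hω (J r) (I r)
    exact tendsto_nhds_limUnder ⟨x, tendsto_sum_window hx⟩
  have hprod : ∀ (J : Fin s → Fin d) (I : Fin s → Fin m) k,
      Integrable (fun ω => ∏ r, entryProcess C Ξ r (J r) (I r) k ω) μ := by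
    intro J I k
    obtain ⟨Λ, hΛ⟩ := hdec0 J I
    refine ((hinn I).tendsto_integral_restrictedProd hΛ (k := k) ?_).1
    filter_upwards [ae_all_iff.2 fun r => hwin J I r k] with ω hω
    exact tendsto_finsetProd _ fun r _ => hω r
  have htensor : ∀ k, ∀ᵐ ω ∂μ, ∀ J, tensorProd (fun r => linearProcess (fun l => C l r)
      (fun l ω => Ξ l ω r) k ω) J = ∑ I : Fin s → Fin m, ∏ r, entryProcess C Ξ r (J r) (I r) k ω := by
    intro k
    filter_upwards [ae_all_iff.2 fun r => hentry r k] with ω hω J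
    exact tensorProd_apply_eq_sum
      (x := fun r j i => entryProcess C Ξ r j i k ω)
      (fun r => linearProcess_apply (B := fun l => C l r) (ζ := fun l ω => Ξ l ω r) (hω r)) J
  have hint : ∀ k, Integrable (fun ω => tensorProd (fun r => linearProcess (fun l => C l r)
      (fun l ω => Ξ l ω r) k ω)) μ := fun k => Integrable.of_eval_piLp fun J =>
    (integrable_finsetSum Finset.univ fun I _ => hprod J I k).congr
      ((htensor k).mono fun ω hω => (hω J).symm)
  refine ⟨fun r k => (hentry r k).mono fun ω hω => tendsto_partialSum_linearProcess hω, hint,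
    fun p hp => ?_⟩
  obtain ⟨κ, β, q, hch⟩ := hp.exists_choice hs hα₀ hσ
  have hlaw : ∀ (J : Fin s → Fin d) (I : Fin s → Fin m), ∀ᵐ ω ∂μ,
      Tendsto (fun n : ℕ => (n : ℝ) ^ (-(1 / p)) * ∑ i ∈ Finset.range n,
        (∏ r, entryProcess C Ξ r (J r) (I r) ((1 + i : ℕ) : ℤ) ω
          - ∫ ω', ∏ r, entryProcess C Ξ r (J r) (I r) ((1 + i : ℕ) : ℤ) ω' ∂μ)) atTop (𝓝 0) := by
    intro J I
    obtain ⟨Λ, hΛ⟩ := hdec κ hch.nonneg hch.lt J I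
    refine (hinn I).ae_tendsto_sum_prod_sub_integral hΛ hp.1 hch.lt_q hch.one_le_q hch.q_le
      hch.one_le_beta hch.beta_lt hch.two_sub_lt (fun A hA => ?_) (hwin J I)
    -- A heavy set forces `s ≠ 1`, so `q < α₀` is available, and `max s 2 < 2 * A.card` gives the
    -- size needed for the tail hypothesis.
    have hAs : A.card ≤ s := by simpa using A.card_le_univ
    have hq0 : 0 < q := zero_lt_one.trans_le hch.one_le_q
    exact integrable_abs_prod_coord_rpow (hmeas 1) I hq0.le
      (integrable_prod_norm_rpow_of_tail (hmeas 1) (by linarith) htail hq0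
        (hch.q_lt (by simp only [Fintype.card_fin]; omega)) (by omega))
  filter_upwards [ae_all_iff.2 fun J => ae_all_iff.2 (hlaw J), ae_all_iff.2 htensor] with ω h1 h2
  refine tendsto_smul_sum_sub_integral (T := fun k ω => tensorProd (fun r => linearProcess
    (fun l => C l r) (fun l ω => Ξ l ω r) (k : ℤ) ω)) (fun k => hint k) ω fun J => ?_
  have h3 := tendsto_finsetSum Finset.univ fun I _ => h1 J I
  rw [Finset.sum_const_zero] at h3
  refine h3.congr fun n => ?_
  rw [← Finset.mul_sum, Finset.sum_comm]
  congr 1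
  refine Finset.sum_congr rfl fun i _ => ?_
  rw [h2, integral_congr_ae ((htensor _).mono fun ω hω => hω J),
    integral_finsetSum _ fun I _ => hprod J I _, Finset.sum_sub_distrib]
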